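/- Let $1\le k\le n$ be integers and let $M\in\mathbb R$. There is a constant $C=C(n,k,M)$ with the following property. For $J\in\mathbb N$ let $\tilde F_J\subset\mathbb R^n$ be nonempty, open, convex sets with $\overline{\tilde F_J}\subset B_1=\{|\xi|<1\}$, let $\varphi^{J*}:\partial\tilde F_J\to\mathbb R$, and let $u^{J*}\in C^\infty(\overline{\tilde F_J})$ solve $$\Big(\frac{\sigma_n}{\sigma_{n-k}}\big(\lambda[w^*\gamma^*_{ik}u^{J*}_{kl}\gamma^*_{lj}]\big)\Big)^{1/k}=\binom nk^{-1/k}\ \text{ in }\tilde F_J,\qquad u^{J*}=\varphi^{J*}\ \text{ on }\partial\tilde F_J,$$ where $w^*=\sqrt{1-|\xi|^2}$, $\gamma^*_{ij}=\delta_{ij}-\frac{\xi_i\xi_j}{1+w^*}$, $\lambda[\cdot]$ denotes the eigenvalues, which are assumed to be all positive in $\tilde F_J$, and $\sigma_l$ is the $l$-th elementary symmetric polynomial. Let $u^J(x)=\sup_{\xi\in\tilde F_J}(x\cdot\xi-u^{J*}(\xi))$ be the Legendre transform of $u^{J*}$ and let $\Omega_J=Du^{J*}(\tilde F_J)$. For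 $x\in\Omega_J$ let $\kappa_{\max}(x)$ be the largest principal curvature at $(x,u^J(x))$ of the spacelike graph $\mathcal M_{u^J}=\{(x,u^J(x)):x\in\Omega_J\}$ in Minkowski space $\mathbb R^{n,1}$, that is, the largest eigenvalue of $\frac1w\gamma^{ik}u^J_{kl}\gamma^{lj}$, where $w=\sqrt{1-|Du^J|^2}$ and $\gamma^{ij}=\delta_{ij}+\frac{u^J_iu^J_j}{w(1+w)}$. Let $s>1$ and let $J_s\in\mathbb N$ be such that for every $J>J_s$ one has $u^J>s$ on $\partial\Omega_J$, and $\frac1{\sqrt{1-|Du^J(x)|^2}}\le M$ at all $x\in\Omega_J$ with $u^J(x)<s$. Then for every $J>J_s$ $$(s-u^J(x))\,\kappa_{\max}(x)\le C\qquad\text{for all }x\in\Omega_J.$$ -/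

import Mathlib

noncomputable section

namespace SigmaK

/-- `ℝⁿ` with its Euclidean inner product. -/
abbrev E (n : ℕ) : Type := EuclideanSpace ℝ (Fin n)

/-- The eigenvalues of a real matrix, with multiplicity. For a symmetric matrix (the only case in
which this is used) these are its `n` real eigenvalues. -/
def eigenvals {n : ℕ} (A : Matrix (Fin n) (Fin n) ℝ) : Multiset ℝ :=
  A.charpoly.roots

/-- The `k`-th elementary symmetric polynomial `σ_k(λ(A))` of the eigenvalues. -/
def sigma {n : ℕ} (k : ℕ) (A : Matrix (Fin n) (Fin n) ℝ) : ℝ :=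
  (eigenvals A).esymm k

/-- The Hessian matrix `(∂ᵢ∂ⱼ f (x))`. -/
def hessian {n : ℕ} (f : E n → ℝ) (x : E n) : Matrix (Fin n) (Fin n) ℝ :=
  Matrix.of fun i j =>
    fderiv ℝ (fderiv ℝ f) x (EuclideanSpace.single i 1) (EuclideanSpace.single j 1)

/-- `w = √(1 - |p|²)`. -/
def w {n : ℕ} (p : E n) : ℝ := √(1 - ‖p‖ ^ 2)

/-! ### Principal curvatures of a spacelike graph in Minkowski space -/

/-- `γ^{ij} = δ_{ij} + pᵢ pⱼ / (w (1 + w))`, the inverse of the square root of the induced metric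
`δ_{ij} - pᵢ pⱼ`, where `p = Du`. -/
def gammaUp {n : ℕ} (p : E n) : Matrix (Fin n) (Fin n) ℝ :=
  Matrix.of fun i j => (if i = j then 1 else 0) + p i * p j / (w p * (1 + w p))

/-- `a_{ij} = w⁻¹ γ^{ik} u_{kl} γ^{lj}`, whose eigenvalues are the principal curvatures of the graph
of `u` in `ℝ^{n,1}` at `(x, u x)`. -/
def curvatureMatrix {n : ℕ} (u : E n → ℝ) (x : E n) : Matrix (Fin n) (Fin n) ℝ :=
  (w (gradient u x))⁻¹ •
    (gammaUp (gradient u x) * hessian u x * gammaUp (gradient u x))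

/-- The largest principal curvature of the graph of `u` at `(x, u x)`. -/
def kappaMax {n : ℕ} (u : E n → ℝ) (x : E n) : ℝ :=
  sSup {κ : ℝ | κ ∈ eigenvals (curvatureMatrix u x)}

/-! ### The dual Dirichlet problem -/

/-- `γ*_{ij} = δ_{ij} - ξᵢ ξⱼ / (1 + w*)`, where `w* = √(1 - |ξ|²)`. -/
def gammaStar {n : ℕ} (ξ : E n) : Matrix (Fin n) (Fin n) ℝ :=
  Matrix.of fun i j => (if i = j then 1 else 0) - ξ i * ξ j / (1 + w ξ)

/-- `w* γ*_{ik} u*_{kl} γ*_{lj}` at the point `ξ` of the unit ball. -/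
def dualMatrix {n : ℕ} (ustar : E n → ℝ) (ξ : E n) : Matrix (Fin n) (Fin n) ℝ :=
  w ξ • (gammaStar ξ * hessian ustar ξ * gammaStar ξ)

/-- `F(A) = (σ_n / σ_{n-k})^{1/k}` of the eigenvalues of `A`. -/
def F {n : ℕ} (k : ℕ) (A : Matrix (Fin n) (Fin n) ℝ) : ℝ :=
  (sigma n A / sigma (n - k) A) ^ (1 / (k : ℝ))

/-- Convex domains that are compactly contained in the open unit ball. -/
structure IsAdmissibleDomain {n : ℕ} (D : Set (E n)) : Prop where
  isOpen : IsOpen D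
  nonempty : D.Nonempty
  convex : Convex ℝ D
  closure_subset : closure D ⊆ Metric.ball 0 1

/-- `ustar` is a classical solution, smooth up to the boundary and in the elliptic cone of positive
definite matrices, of `F(w* γ*_{ik} u*_{kl} γ*_{lj}) = (n choose k)^{-1/k}` in `D`,
`u* = φ` on `∂D`. -/
structure IsDirichletSolution {n : ℕ} (k : ℕ) (D : Set (E n)) (φ ustar : E n → ℝ) : Prop where
  smooth : ContDiffOn ℝ (⊤ : ℕ∞) ustar (closure D)
  positive : ∀ ξ ∈ D, ∀ l ∈ eigenvals (dualMatrix ustar ξ), 0 < l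
  equation : ∀ ξ ∈ D, F k (dualMatrix ustar ξ) = 1 / (n.choose k : ℝ) ^ (1 / (k : ℝ))
  boundary : ∀ ξ ∈ frontier D, ustar ξ = φ ξ

/-- The Legendre transform `u(x) = sup_{ξ ∈ D} (x · ξ - u*(ξ))`. -/
def legendre {n : ℕ} (D : Set (E n)) (ustar : E n → ℝ) (x : E n) : ℝ :=
  sSup ((fun ξ : E n => inner ℝ x ξ - ustar ξ) '' D)

/-- The gradient image `Ω = Du*(D)`, over which the graph of the Legendre transform is taken. -/
def gradImage {n : ℕ} (D : Set (E n)) (ustar : E n → ℝ) : Set (E n) :=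
  gradient ustar '' D

end SigmaK

end

/-! The dual matrix at `ξ` is the inverse of the curvature matrix at `x = Du*(ξ)`
(`dualMatrix_mul_curvatureMatrix`). Hence the Dirichlet equation says `σ_k(κ) = n.choose k`, and
`u(x)` becomes `height f ξ = ξ·Du*(ξ) - u*(ξ)`. The estimate is of Pogorelov type and is proved over
`D` by the maximum principle, applied to `(s - u) e^{nW} / λ`, where `W = 1 / w` is the Lorentz
factor and `λ` the least eigenvalue of the dual matrix. The set `{u ≤ s}` is compact in `D`, because
`u > s` on the boundary of the gradient image and `u*` is strictly convex (`isCompact_height_le`),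
so a maximum exists. Eigenvalues are never differentiated: `λ` is replaced by the quadratic form on
unit vectors, and the maximum is taken over points and vectors jointly (`sub_height_mul_le`).

At a maximum a Lorentz boost moves the point to the origin (`exists_adaptedChart`). Along each
coordinate line the dual matrix is then, in an orthonormal frame, the Hessian of one function
multiplied by powers of `√(1 - t²)`. Third derivatives form a fully symmetric array `T`, and
commuting partial derivatives play the role of the Codazzi and Gauss equations.

The second order conditions in the `n` directions are summed with the weights `σ_{k-1}(κ|i) κ_i²` of
the linearized operator, and the twice differentiated equation (`equation_second`) removes the
fourth derivatives. The remaining terms are quadratic in `T`. By `third_order_bound` they are at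
most a multiple of `(κ_o T_ooo)²`, with `o` the direction of largest curvature; the critical point
condition turns this into a gradient term of `e^{nW}`, which the test function supplies. The algebra
behind it is `es_hessian_bound`, a bound for the Hessian of `σ_k` on the kernel of `Dσ_k` when `κ_o`
is large; it follows from the concavity of `σ_{j+1}/σ_j`.

If `κ_o` is not large, it is bounded in terms of `n` and `k`, and a bound for `s - u` suffices. That
bound may not depend on `s`; it comes from a second maximum principle, for `(s - u) e^{W/(2M)}`
(`height_estimate`), together with `κ_o ≥ 1`. -/

set_option linter.unusedSectionVars false

noncomputable section

open Polynomial Filter Topology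

/-! ### Elementary symmetric polynomials of positive numbers -/

namespace SigmaK

variable {ι : Type*} [DecidableEq ι]

/-- The `j`-th elementary symmetric polynomial of the numbers `x i`, `i ∈ s`. -/
def es (s : Finset ι) (x : ι → ℝ) (j : ℕ) : ℝ :=
  (∏ i ∈ s, (1 + C (x i) * X)).coeff j

@[simp] lemma es_zero (s : Finset ι) (x : ι → ℝ) : es s x 0 = 1 := by
  simp [es, Polynomial.coeff_zero_eq_eval_zero, Polynomial.eval_prod]

@[simp] lemma es_empty_succ (x : ι → ℝ) (j : ℕ) : es ∅ x (j + 1) = 0 := by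
  simp [es, Polynomial.coeff_one]

lemma es_insert {s : Finset ι} {a : ι} (ha : a ∉ s) (x : ι → ℝ) (j : ℕ) :
    es (insert a s) x (j + 1) = es s x (j + 1) + x a * es s x j := by
  simp only [es]
  rw [Finset.prod_insert ha, add_mul, one_mul, mul_assoc, Polynomial.coeff_add,
    Polynomial.coeff_C_mul, Polynomial.coeff_X_mul]

lemma es_erase {s : Finset ι} {a : ι} (ha : a ∈ s) (x : ι → ℝ) (j : ℕ) :
    es s x (j + 1) = es (s.erase a) x (j + 1) + x a * es (s.erase a) x j := by
  conv_lhs => rw [← Finset.insert_erase ha]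
  exact es_insert (Finset.notMem_erase a s) x j

lemma es_nonneg {s : Finset ι} {x : ι → ℝ} (hx : ∀ i ∈ s, 0 < x i) (j : ℕ) : 0 ≤ es s x j := by
  induction s using Finset.induction_on generalizing j with
  | empty => cases j <;> simp
  | insert a s ha ih =>
    have hs : ∀ i ∈ s, 0 < x i := fun i hi => hx i (Finset.mem_insert_of_mem hi)
    cases j with
    | zero => simp
    | succ j =>
      rw [es_insert ha]
      have := hx a (Finset.mem_insert_self a s)
      have h1 := ih hs (j + 1)
      have h2 := ih hs j
      positivity

lemma es_pos {s : Finset ι} {x : ι → ℝ} (hx : ∀ i ∈ s, 0 < x i) {j : ℕ} (hj : j ≤ s.card) :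
    0 < es s x j := by
  induction s using Finset.induction_on generalizing j with
  | empty =>
    have : j = 0 := by simpa using hj
    subst this; simp
  | insert a s ha ih =>
    have hs : ∀ i ∈ s, 0 < x i := fun i hi => hx i (Finset.mem_insert_of_mem hi)
    cases j with
    | zero => simp
    | succ j =>
      rw [es_insert ha]
      rw [Finset.card_insert_of_notMem ha] at hj
      have := hx a (Finset.mem_insert_self a s)
      have h1 := es_nonneg hs (j + 1)
      have h2 := ih hs (j := j) (by omega)
      positivity

/-- Coefficient of `X ^ j` in the derivative of `∏ (1 + x_i X)`. -/
lemma sum_mul_es_erase (s : Finset ι) (x : ι → ℝ) (j : ℕ) :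
    ∑ i ∈ s, x i * es (s.erase i) x j = (j + 1) * es s x (j + 1) := by
  have h := congrArg (fun p : ℝ[X] => p.coeff j)
    (Polynomial.derivative_prod_finset (s := s) (f := fun i => (1 + C (x i) * X : ℝ[X])))
  simp only [Polynomial.coeff_derivative, Polynomial.finsetSum_coeff] at h
  rw [es, mul_comm, h]
  refine Finset.sum_congr rfl fun i hi => ?_
  have : derivative (1 + C (x i) * X : ℝ[X]) = C (x i) := by simp
  rw [this, Polynomial.coeff_mul_C, mul_comm, es]

lemma es_one (s : Finset ι) (x : ι → ℝ) : es s x 1 = ∑ i ∈ s, x i := by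
  have h := sum_mul_es_erase s x 0
  simp at h
  exact h.symm

lemma es_smul (s : Finset ι) (x : ι → ℝ) (c : ℝ) (j : ℕ) : es s (c • x) j = c ^ j * es s x j := by
  induction s using Finset.induction_on generalizing j with
  | empty => cases j <;> simp
  | insert a s ha ih =>
    cases j with
    | zero => simp
    | succ j =>
      rw [es_insert ha, es_insert ha, ih, ih, Pi.smul_apply, smul_eq_mul]
      ring

/-- Log-concavity of the sequence of elementary symmetric polynomials. -/
lemma es_mul_es_le {s : Finset ι} {x : ι → ℝ} (hx : ∀ i ∈ s, 0 < x i) {i j : ℕ} (hij : i ≤ j) :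
    es s x i * es s x (j + 2) ≤ es s x (i + 1) * es s x (j + 1) := by
  induction s using Finset.induction_on generalizing i j with
  | empty => simp
  | insert a s ha ih =>
    have hs : ∀ i ∈ s, 0 < x i := fun i hi => hx i (Finset.mem_insert_of_mem hi)
    have h0 := fun j => es_nonneg hs j
    have hp := hx a (Finset.mem_insert_self a s)
    cases i with
    | zero =>
      rw [es_zero, one_mul, es_insert ha, es_insert ha, es_insert ha, es_zero]
      have h1 := ih hs (Nat.zero_le j)
      simp only [es_zero, one_mul] at h1
      have h2 := mul_nonneg (h0 1) (mul_nonneg hp.le (h0 j))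
      have h3 := mul_nonneg hp.le (mul_nonneg hp.le (h0 j))
      simp only [zero_add]
      simp only [zero_add] at h1
      nlinarith
    | succ i =>
      obtain ⟨j, rfl⟩ : ∃ l, j = l + 1 := ⟨j - 1, by omega⟩
      rw [es_insert ha, es_insert ha, es_insert ha, es_insert ha]
      have h1 := ih hs hij
      have h2 : es s x i * es s x (j + 2) ≤ es s x (i + 1) * es s x (j + 1) := ih hs (by omega)
      have h3 : es s x i * es s x (j + 1 + 2) ≤ es s x (i + 2) * es s x (j + 1) := by
        have h4 : es s x i * es s x (j + 1 + 2) ≤ es s x (i + 1) * es s x (j + 2) :=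
          ih hs (by omega)
        rcases Nat.lt_or_ge i j with h | h
        · exact h4.trans (ih hs (by omega : i + 1 ≤ j))
        · have : i = j := by omega
          subst this
          linarith [mul_comm (es s x (i+1)) (es s x (i+2))]
      have e1 := mul_le_mul_of_nonneg_left h3 hp.le
      have e2 := mul_le_mul_of_nonneg_left h2 (mul_nonneg hp.le hp.le)
      have e3 : i + 1 + 1 = i + 2 := rfl
      have e4 : j + 1 + 1 = j + 2 := rfl
      have e5 : j + 1 + 2 = j + 3 := rfl
      simp only [e3, e4, e5] at *
      nlinarith

/-- By log-concavity the ratios `σ_{i+1}/σ_i` decrease in `i`. If the ratio at `j` is at least `c`,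
so are all earlier ones, and their product telescopes from `σ_0 = 1`. -/
lemma pow_le_es {s : Finset ι} {x : ι → ℝ} (hx : ∀ i ∈ s, 0 < x i) {c : ℝ} (hc : 0 ≤ c) {j : ℕ}
    (hj : j ≤ s.card) (h : c * es s x j ≤ es s x (j + 1)) {i : ℕ} (hi : i ≤ j + 1) :
    c ^ i ≤ es s x i := by
  induction i with
  | zero => simp
  | succ i ih =>
    have h1 := ih (by omega)
    have hij : c * es s x i ≤ es s x (i + 1) := by
      rcases Nat.lt_or_ge i j with h' | h'
      · obtain ⟨l, rfl⟩ : ∃ l, j = l + 1 := ⟨j - 1, by omega⟩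
        have h2 := es_mul_es_le hx (by omega : i ≤ l)
        have h3 := es_pos hx hj
        have h4 := mul_le_mul_of_nonneg_left h (es_nonneg hx i)
        have e : l + 1 + 1 = l + 2 := rfl
        rw [e] at h4
        by_contra! hcon
        nlinarith
      · have : i = j := by omega
        subst this; exact h
    calc c ^ (i + 1) = c * c ^ i := by ring
      _ ≤ c * es s x i := by gcongr
      _ ≤ _ := hij

/-! ### Concavity of quotients of consecutive elementary symmetric polynomials -/

/-- The parallel sum `x r / (x + r)` is increasing in `r`, and it is superadditive: after clearing
denominators the defect is `(x q - y r)²`. -/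
lemma parallel_sum_superadd {x r y q p : ℝ} (hx : 0 < x) (hr : 0 ≤ r) (hy : 0 < y) (hq : 0 ≤ q)
    (hp : r + q ≤ p) : x * r / (x + r) + y * q / (y + q) ≤ (x + y) * p / (x + y + p) := by
  have h1 : (x + y) * (r + q) / (x + y + (r + q)) ≤ (x + y) * p / (x + y + p) := by
    rw [div_le_div_iff₀ (by positivity) (by linarith [add_nonneg hr hq])]
    nlinarith [mul_nonneg (mul_pos (add_pos hx hy) (add_pos hx hy)).le (sub_nonneg.2 hp)]
  refine le_trans ?_ h1
  rw [div_add_div _ _ (by positivity) (by positivity), div_le_div_iff₀ (by positivity) (by positivity)]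
  have : (x + y) * (r + q) * ((x + r) * (y + q)) - (x * r * (y + q) + (x + r) * (y * q)) *
    (x + y + (r + q)) = (x * q - y * r) ^ 2 := by ring
  nlinarith [sq_nonneg (x * q - y * r)]

/-- Induction on `j`: the quotient of order `j + 1` on `s` is, up to the factor `j + 2`, a sum over
`i` of parallel sums of `z_i` with the quotient of order `j` on `s.erase i`, so
`parallel_sum_superadd` applies term by term. -/
lemma es_quotient_superadd {s : Finset ι} {x y : ι → ℝ} (hx : ∀ i ∈ s, 0 < x i)
    (hy : ∀ i ∈ s, 0 < y i) {j : ℕ} (hj : j ≤ s.card) :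
    es s x (j + 1) / es s x j + es s y (j + 1) / es s y j ≤
      es s (x + y) (j + 1) / es s (x + y) j := by
  induction j generalizing s with
  | zero => simp [es_one, Finset.sum_add_distrib]
  | succ j ih =>
    have key : ∀ z : ι → ℝ, (∀ i ∈ s, 0 < z i) →
        ((j : ℝ) + 2) * (es s z (j + 1 + 1) / es s z (j + 1)) =
        ∑ i ∈ s, z i * (es (s.erase i) z (j + 1) / es (s.erase i) z j) /
          (z i + es (s.erase i) z (j + 1) / es (s.erase i) z j) := by
      intro z hz
      have h1 := sum_mul_es_erase s z (j + 1)
      push_cast at h1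
      rw [← mul_div_assoc, show (j : ℝ) + 2 = j + 1 + 1 by ring, ← h1, Finset.sum_div]
      refine Finset.sum_congr rfl fun i hi => ?_
      have hc : (s.erase i).card = s.card - 1 := Finset.card_erase_of_mem hi
      have hz' : ∀ l ∈ s.erase i, 0 < z l := fun l hl => hz l (Finset.mem_of_mem_erase hl)
      have hb := es_pos hz' (j := j) (by omega)
      have ha := es_nonneg hz' (j + 1)
      have hzi := hz i hi
      rw [es_erase hi z j]
      have : es (s.erase i) z (j + 1) + z i * es (s.erase i) z j ≠ 0 := by positivity
      have h3 : z i + es (s.erase i) z (j + 1) / es (s.erase i) z j ≠ 0 := by positivity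
      have h4 : es (s.erase i) z (j + 1) / es (s.erase i) z j * es (s.erase i) z j =
        es (s.erase i) z (j + 1) := div_mul_cancel₀ _ hb.ne'
      rw [div_eq_div_iff this h3]
      linear_combination (-(z i * z i)) * h4
    have hxy : ∀ i ∈ s, 0 < (x + y) i := fun i hi => add_pos (hx i hi) (hy i hi)
    have hpos : (0 : ℝ) < (j : ℝ) + 2 := by positivity
    refine le_of_mul_le_mul_left ?_ hpos
    rw [mul_add, key x hx, key y hy, key _ hxy, ← Finset.sum_add_distrib]
    refine Finset.sum_le_sum fun i hi => ?_
    have hc : (s.erase i).card = s.card - 1 := Finset.card_erase_of_mem hi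
    have hx' : ∀ l ∈ s.erase i, 0 < x l := fun l hl => hx l (Finset.mem_of_mem_erase hl)
    have hy' : ∀ l ∈ s.erase i, 0 < y l := fun l hl => hy l (Finset.mem_of_mem_erase hl)
    exact parallel_sum_superadd (hx i hi) (div_nonneg (es_nonneg hx' _) (es_nonneg hx' _)) (hy i hi)
      (div_nonneg (es_nonneg hy' _) (es_nonneg hy' _)) (ih hx' hy' (by omega))

/-! ### First and second derivatives along lines -/

/-- The derivative of `es s · j` at `x` in direction `ξ`. -/
def esD (s : Finset ι) (x ξ : ι → ℝ) : ℕ → ℝ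
  | 0 => 0
  | j + 1 => ∑ i ∈ s, ξ i * es (s.erase i) x j

/-- The second derivative of `es s · j` at `x` in direction `ξ`. -/
def esDD (s : Finset ι) (x ξ : ι → ℝ) : ℕ → ℝ
  | 0 => 0
  | j + 1 => ∑ i ∈ s, ξ i * esD (s.erase i) x ξ j

lemma hasDerivAt_es (s : Finset ι) (x ξ : ι → ℝ) (j : ℕ) (t : ℝ) :
    HasDerivAt (fun t : ℝ => es s (x + t • ξ) j) (esD s (x + t • ξ) ξ j) t := by
  induction s using Finset.induction_on generalizing j with
  | empty => cases j <;> simp [esD, hasDerivAt_const]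
  | insert a s ha ih =>
    cases j with
    | zero => simp [esD, hasDerivAt_const]
    | succ j =>
      simp only [es_insert ha]
      have hl : HasDerivAt (fun t : ℝ => (x + t • ξ) a) (ξ a) t := by
        simpa using ((hasDerivAt_id t).mul_const (ξ a)).const_add (x a)
      refine ((ih (j + 1)).add (hl.mul (ih j))).congr_deriv ?_
      simp only [esD]
      rw [Finset.sum_insert ha, Finset.erase_insert ha]
      have : ∀ i ∈ s, ξ i * es ((insert a s).erase i) (x + t • ξ) j =
          ξ i * es (s.erase i) (x + t • ξ) j + (x + t • ξ) a *
            (match j with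
            | 0 => 0
            | l + 1 => ξ i * es (s.erase i) (x + t • ξ) l) := by
        intro i hi
        have hne : a ≠ i := fun h => ha (h ▸ hi)
        rw [Finset.erase_insert_of_ne hne]
        cases j with
        | zero => simp
        | succ j =>
          rw [es_insert (fun h => ha (Finset.mem_of_mem_erase h))]
          ring
      rw [Finset.sum_congr rfl this, Finset.sum_add_distrib, ← Finset.mul_sum]
      cases j with
      | zero => simp [add_comm]
      | succ j => ring

lemma hasDerivAt_esD (s : Finset ι) (x ξ : ι → ℝ) (j : ℕ) (t : ℝ) :
    HasDerivAt (fun t : ℝ => esD s (x + t • ξ) ξ j) (esDD s (x + t • ξ) ξ j) t := by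
  cases j with
  | zero => simp [esD, esDD, hasDerivAt_const]
  | succ j =>
    simp only [esD, esDD]
    exact HasDerivAt.fun_sum fun i _ => (hasDerivAt_es (s.erase i) x ξ j t).const_mul (ξ i)

end SigmaK

/-- A twice differentiable function with a local maximum has vanishing first and nonpositive second
derivative. -/
lemma second_derivative_nonpos_of_isLocalMax {f g : ℝ → ℝ} {a : ℝ}
    (hf : ∀ᶠ t in 𝓝 (0 : ℝ), HasDerivAt f (g t) t) (hg : HasDerivAt g a 0)
    (hm : IsLocalMax f 0) : g 0 = 0 ∧ a ≤ 0 := by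
  have h0 : g 0 = 0 := hm.hasDerivAt_eq_zero hf.self_of_nhds
  refine ⟨h0, ?_⟩
  by_contra! ha
  have hd : deriv f =ᶠ[𝓝 0] g := hf.mono fun t ht => ht.deriv
  have hdd : deriv (deriv f) 0 = a := by rw [hd.deriv_eq, hg.deriv]
  have hmin : IsLocalMin f 0 := isLocalMin_of_deriv_deriv_pos (by rw [hdd]; exact ha)
    (by rw [hd.self_of_nhds, h0]) hf.self_of_nhds.continuousAt
  have hc : f =ᶠ[𝓝 0] fun _ => f 0 := by
    filter_upwards [hm, hmin] with t h1 h2 using le_antisymm h1 h2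
  have h1 : deriv f =ᶠ[𝓝 0] fun _ => 0 := by
    filter_upwards [hc.deriv] with t ht
    rw [ht]; simp
  have h2 : deriv (deriv f) 0 = 0 := by rw [h1.deriv_eq]; simp
  rw [hdd] at h2
  exact ha.ne' h2

/-! ### Concavity as inequalities between first and second derivatives -/

namespace SigmaK

variable {ι : Type*} [DecidableEq ι]

lemma eventually_line_pos {s : Finset ι} {x : ι → ℝ} (hx : ∀ i ∈ s, 0 < x i) (ξ : ι → ℝ) :
    ∀ᶠ t in 𝓝 (0 : ℝ), ∀ i ∈ s, 0 < (x + t • ξ) i := by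
  rw [Filter.eventually_all_finset]
  intro i hi
  have hc : ContinuousAt (fun t : ℝ => (x + t • ξ) i) 0 := by
    simp only [Pi.add_apply, Pi.smul_apply, smul_eq_mul]
    fun_prop
  exact hc.eventually (lt_mem_nhds (by simpa using hx i hi))

/-- The quotient of consecutive elementary symmetric polynomials is concave along lines, in terms of
the first and second derivatives of numerator and denominator. -/
lemma es_quotient_concave {s : Finset ι} {x : ι → ℝ} (hx : ∀ i ∈ s, 0 < x i) (ξ : ι → ℝ) {j : ℕ}
    (hj : j ≤ s.card) :
    (esDD s x ξ (j + 1) * es s x j - es s x (j + 1) * esDD s x ξ j) * es s x j ≤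
      2 * (esD s x ξ (j + 1) * es s x j - es s x (j + 1) * esD s x ξ j) * esD s x ξ j := by
  have hA0 := es_pos hx hj
  set q : ℝ → ℝ := fun t => es s (x + t • ξ) (j + 1) / es s (x + t • ξ) j with hq
  set q1 : ℝ → ℝ := fun t => (esD s (x + t • ξ) ξ (j + 1) * es s (x + t • ξ) j -
    es s (x + t • ξ) (j + 1) * esD s (x + t • ξ) ξ j) / es s (x + t • ξ) j ^ 2 with hq1
  have e1 : ∀ᶠ t in 𝓝 (0 : ℝ), HasDerivAt q (q1 t) t := by
    filter_upwards [eventually_line_pos hx ξ] with t ht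
    exact (hasDerivAt_es s x ξ (j + 1) t).div (hasDerivAt_es s x ξ j t) (es_pos ht hj).ne'
  have e2 : HasDerivAt q1 (((esDD s x ξ (j + 1) * es s x j - es s x (j + 1) * esDD s x ξ j) *
      es s x j ^ 2 - (esD s x ξ (j + 1) * es s x j - es s x (j + 1) * esD s x ξ j) *
      (2 * es s x j * esD s x ξ j)) / (es s x j ^ 2) ^ 2) 0 := by
    have e2 := (((hasDerivAt_esD s x ξ (j + 1) 0).mul (hasDerivAt_es s x ξ j 0)).sub
      ((hasDerivAt_es s x ξ (j + 1) 0).mul (hasDerivAt_esD s x ξ j 0))).div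
      ((hasDerivAt_es s x ξ j 0).pow 2) (by simpa using (pow_pos hA0 2).ne')
    refine e2.congr_deriv ?_
    simp only [zero_smul, add_zero, Pi.mul_apply, Pi.sub_apply, Pi.pow_apply]
    norm_num
    ring
  have neg : ∀ {f : ℝ → ℝ} {a t : ℝ}, HasDerivAt f a (-t) → HasDerivAt (fun t => f (-t)) (-a) t := by
    intro f a t h
    exact (h.comp t (hasDerivAt_neg t)).congr_deriv (by ring)
  have e1' : ∀ᶠ t in 𝓝 (0 : ℝ), HasDerivAt (fun t => q t + q (-t)) (q1 t + -q1 (-t)) t := by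
    have hn : Tendsto (fun t : ℝ => -t) (𝓝 0) (𝓝 0) := by simpa using (continuous_neg.tendsto (0:ℝ))
    filter_upwards [e1, hn.eventually e1] with t h1 h2
    exact h1.add (neg h2)
  have e2' := e2.add ((neg (t := 0) (by simpa using e2)).fun_neg)
  -- Superadditivity at the points `x ± tξ`, whose sum is `2x`, and homogeneity of degree one give
  -- `q t + q (-t) ≤ 2 q 0`.
  have hmax : IsLocalMax (fun t => q t + q (-t)) 0 := by
    have hn : Tendsto (fun t : ℝ => -t) (𝓝 0) (𝓝 0) := by simpa using (continuous_neg.tendsto (0:ℝ))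
    filter_upwards [eventually_line_pos hx ξ, hn.eventually (eventually_line_pos hx ξ)] with t h1 h2
    have h := es_quotient_superadd h1 h2 hj
    have h2x : x + t • ξ + (x + -t • ξ) = (2 : ℝ) • x := by
      ext i; simp; ring
    rw [h2x, es_smul, es_smul] at h
    have h3 : (2 : ℝ) ^ (j + 1) * es s x (j + 1) / (2 ^ j * es s x j) = q 0 + q (-0) := by
      simp only [hq, neg_zero, zero_smul, add_zero]
      field_simp
      ring
    rw [h3] at h
    exact h
  have h := (second_derivative_nonpos_of_isLocalMax e1' e2' hmax).2
  rw [neg_neg, ← two_mul] at h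
  have h := nonpos_of_mul_nonpos_right h (by norm_num : (0 : ℝ) < 2)
  rw [div_le_iff₀ (by positivity), zero_mul] at h
  set A := es s x j
  set B := es s x (j + 1)
  set a := esD s x ξ j
  set b := esD s x ξ (j + 1)
  set A2 := esDD s x ξ j
  set B2 := esDD s x ξ (j + 1)
  norm_num at h
  have : ((B2 * A - B * A2) * A - 2 * (b * A - B * a) * a) * A ≤ 0 := by nlinarith
  have := nonpos_of_mul_nonpos_left this hA0
  linarith

/-- Concavity of the `j`-th root of `es s · j`. -/
lemma es_root_concave {s : Finset ι} {x : ι → ℝ} (hx : ∀ i ∈ s, 0 < x i) (ξ : ι → ℝ) {j : ℕ}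
    (hj : j + 1 ≤ s.card) :
    (j + 1) * (es s x (j + 1) * esDD s x ξ (j + 1)) ≤ j * esD s x ξ (j + 1) ^ 2 := by
  induction j with
  | zero => simp [esDD, esD]
  | succ j ih =>
    have ih := ih (by omega)
    have hc := es_quotient_concave hx ξ (j := j + 1) (by omega)
    have hA := es_pos hx (j := j + 1) (by omega)
    have hB := es_nonneg hx (j + 1 + 1)
    set A := es s x (j + 1)
    set B := es s x (j + 1 + 1)
    set a := esD s x ξ (j + 1)
    set b := esD s x ξ (j + 1 + 1)
    set A2 := esDD s x ξ (j + 1)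
    set B2 := esDD s x ξ (j + 1 + 1)
    push_cast
    have hj0 : (0 : ℝ) < (j : ℝ) + 1 := by positivity
    -- multiply everything by `A ^ 2`
    have h1 : ((j : ℝ) + 1) * (B * ((B2 * A - B * A2) * A)) ≤
        (j + 1) * (B * (2 * (b * A - B * a) * a)) := by gcongr
    have h2 : B ^ 2 * ((j + 1) * (A * A2)) ≤ B ^ 2 * (j * a ^ 2) := by gcongr
    have h3 : ((j : ℝ) + 1) * (B * B2) * A ^ 2 ≤ 2 * (j + 1) * B * a * b * A - (j + 2) * B ^ 2 * a ^ 2 := by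
      nlinarith
    have h4 : ((j : ℝ) + 1) * ((j + 1 + 1) * (B * B2) * A ^ 2) ≤ (j + 1) * ((j + 1) * b ^ 2 * A ^ 2) := by
      -- The factor `j + 2` makes the right side of `h3` the target minus the square supplied next.
      have h5 := mul_le_mul_of_nonneg_left h3 (by positivity : (0 : ℝ) ≤ (j : ℝ) + 2)
      nlinarith [sq_nonneg (((j : ℝ) + 1) * b * A - (j + 2) * B * a)]
    have h6 := le_of_mul_le_mul_left h4 hj0
    exact le_of_mul_le_mul_right h6 (by positivity : 0 < A ^ 2)

/-! ### The Hessian of `σ_k` on the kernel of `Dσ_k` -/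

lemma esD_insert {s : Finset ι} {o : ι} (ho : o ∉ s) (x ξ : ι → ℝ) (j : ℕ) :
    esD (insert o s) x ξ (j + 1) =
      esD s x ξ (j + 1) + x o * esD s x ξ j + ξ o * es s x j := by
  have h1 := hasDerivAt_es (insert o s) x ξ (j + 1) 0
  have hl : HasDerivAt (fun t : ℝ => (x + t • ξ) o) (ξ o) 0 := by
    simpa using ((hasDerivAt_id (0 : ℝ)).mul_const (ξ o)).const_add (x o)
  simp only [es_insert ho] at h1
  have h2 := h1.unique ((hasDerivAt_es s x ξ (j + 1) 0).add (hl.mul (hasDerivAt_es s x ξ j 0)))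
  simp only [zero_smul, add_zero] at h2
  linarith

lemma esDD_insert {s : Finset ι} {o : ι} (ho : o ∉ s) (x ξ : ι → ℝ) (j : ℕ) :
    esDD (insert o s) x ξ (j + 1) =
      esDD s x ξ (j + 1) + x o * esDD s x ξ j + 2 * (ξ o * esD s x ξ j) := by
  have h1 := hasDerivAt_esD (insert o s) x ξ (j + 1) 0
  have hl : HasDerivAt (fun t : ℝ => (x + t • ξ) o) (ξ o) 0 := by
    simpa using ((hasDerivAt_id (0 : ℝ)).mul_const (ξ o)).const_add (x o)
  simp only [esD_insert ho] at h1
  have h2 := h1.unique (((hasDerivAt_esD s x ξ (j + 1) 0).add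
    (hl.mul (hasDerivAt_esD s x ξ j 0))).add ((hasDerivAt_es s x ξ j 0).const_mul (ξ o)))
  simp only [zero_smul, add_zero] at h2
  linarith

/-- The arithmetic of `es_hessian_bound`. Here `A`, `B` are `σ_{m+1}`, `σ_{m+2}` of the variables
other than `κ = x_o`, lower case letters and the suffix 2 mark first and second derivatives, and `ζ
= ξ_o`. With `Q = B/A` one has `σ_{m+2} = A (κ + Q)` for all variables. Concavity of `Q` and of
`A^{1/(m+1)}`, with the vanishing of the first derivative, bounds the Hessian by a negative multiple
of `A (ζ + Q')² / (κ + Q)`; smallness of `Q` and `Q'` then lets `κ` and `ζ` replace `κ + Q` and `ζ +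
Q'`. -/
lemma hessian_bound_arith {m : ℕ} {N ε A B a b A2 B2 κ ζ Sg : ℝ} (hmN : (m : ℝ) + 2 ≤ N)
    (hε : ε = 1 / (4 * N ^ 2)) (hA : 0 < A) (hB : 0 ≤ B) (hκ : 0 < κ) (hSg0 : 0 ≤ Sg)
    (hBA : B ≤ ε * κ * A) (hq : (b * A - B * a) ^ 2 ≤ A ^ 3 * (N * ε * Sg))
    (hconc : (B2 * A - B * A2) * A ≤ 2 * (b * A - B * a) * a)
    (hroot : ((m : ℝ) + 1) * (A * A2) ≤ m * a ^ 2) (hd : 0 = b + κ * a + ζ * A) :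
    κ * (B2 + κ * A2 + 2 * (ζ * a)) + A * ζ ^ 2 ≤ 2 * Sg := by
  have hm0 : (0 : ℝ) ≤ m := by positivity
  have hNpos : 0 < N := by linarith
  have hεpos : 0 < ε := by rw [hε]; positivity
  obtain ⟨Q, rfl⟩ : ∃ Q, B = Q * A := ⟨B / A, by field_simp⟩
  -- `q` is the derivative of the quotient `Q`.
  obtain ⟨q, hqd⟩ : ∃ q, b = q * A + Q * a := ⟨(b - Q * a) / A, by field_simp; ring⟩
  subst hqd
  have hQ0 : 0 ≤ Q := by
    by_contra! h; nlinarith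
  have hQ1 : Q ≤ ε * κ := le_of_mul_le_mul_right hBA hA
  set R := κ + Q with hR
  have hRpos : 0 < R := by positivity
  set y := ζ + q with hy
  have hya : R * a = -(y * A) := by simp only [hR, hy]; linarith
  have hq' : A * q ^ 2 ≤ N * ε * Sg := by
    have : A ^ 3 * (A * q ^ 2) ≤ A ^ 3 * (N * ε * Sg) := by
      refine le_trans (le_of_eq ?_) hq
      ring
    exact le_of_mul_le_mul_left this (by positivity)
  have hB2 : B2 ≤ Q * A2 + 2 * q * a := by
    have : A ^ 2 * B2 ≤ A ^ 2 * (Q * A2 + 2 * q * a) := by linear_combination hconc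
    exact le_of_mul_le_mul_left this (by positivity)
  set T := B2 + κ * A2 + 2 * (ζ * a) with hT
  have hT1 : T ≤ R * A2 + 2 * y * a := by simp only [hT, hR, hy]; linear_combination hB2
  have hT2 : ((m : ℝ) + 1) * R * T ≤ -((m + 2) * A * y ^ 2) := by
    have h1 : A * (((m : ℝ) + 1) * R * T) ≤ A * (-((m + 2) * A * y ^ 2)) := by
      calc A * (((m : ℝ) + 1) * R * T) ≤ A * (((m : ℝ) + 1) * R * (R * A2 + 2 * y * a)) := by gcongr
        _ = R ^ 2 * ((m + 1) * (A * A2)) + 2 * (m + 1) * A * y * (R * a) := by ring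
        _ ≤ R ^ 2 * (m * a ^ 2) + 2 * (m + 1) * A * y * (R * a) := by gcongr
        _ = m * (R * a) ^ 2 + 2 * (m + 1) * A * y * (R * a) := by ring
        _ = A * (-((m + 2) * A * y ^ 2)) := by rw [hya]; ring
    exact le_of_mul_le_mul_left h1 hA
  have hT0 : T ≤ 0 := by
    by_contra! h
    have : 0 < ((m : ℝ) + 1) * R * T := by positivity
    have : 0 ≤ ((m : ℝ) + 2) * A * y ^ 2 := by positivity
    linarith
  have hT3 : ((m : ℝ) + 1) * (1 + ε) * (κ * T) ≤ -((m + 2) * A * y ^ 2) := by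
    refine le_trans ?_ hT2
    have : R ≤ (1 + ε) * κ := by simp only [hR]; linarith
    nlinarith [mul_le_mul_of_nonneg_left this (by positivity : (0 : ℝ) ≤ (m : ℝ) + 1)]
  have hε1 : 4 * N * (N * ε) = 1 := by rw [hε]; field_simp
  have hN1 : 1 ≤ N := by linarith
  -- The gap between `m + 1` and `m + 2` pays for both approximations, each of which costs at most
  -- `1/4`; this uses `m + 2 ≤ N`.
  have hη : (m + 1) * (1 + ε) ≤ (m + 2) * (1 - 1 / (4 * N)) := by
    have h1 : ((m : ℝ) + 2) * (1 / (4 * N)) ≤ 1 / 4 := by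
      rw [mul_one_div, div_le_iff₀ (by positivity)]; linarith
    have h2 : ((m : ℝ) + 1) * ε ≤ 1 / 4 := by
      rw [hε, mul_one_div, div_le_iff₀ (by positivity)]; nlinarith
    linarith
  -- Young's inequality with weight `4N`, matched to `4N · Nε = 1` so that the error in `q` costs
  -- only one multiple of `Sg`.
  have hy2 : (1 - 1 / (4 * N)) * ζ ^ 2 - 4 * N * q ^ 2 ≤ y ^ 2 := by
    have h1 : 0 ≤ (1 / (4 * N)) * (ζ + 4 * N * q) ^ 2 := by positivity
    have h2 : (1 / (4 * N)) * (ζ + 4 * N * q) ^ 2 =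
        1 / (4 * N) * ζ ^ 2 + 2 * ζ * q + 4 * N * q ^ 2 := by field_simp; ring
    have h3 : y ^ 2 = ζ ^ 2 + 2 * ζ * q + q ^ 2 := by simp only [hy]; ring
    rw [h3]; linarith [sq_nonneg q]
  have hfin : ((m : ℝ) + 1) * (1 + ε) * (κ * T + A * ζ ^ 2) ≤ ((m : ℝ) + 1) * (1 + ε) * (2 * Sg) := by
    have h1 : ((m : ℝ) + 2) * A * ((1 - 1 / (4 * N)) * ζ ^ 2 - 4 * N * q ^ 2) ≤ (m + 2) * A * y ^ 2 := by
      gcongr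
    have h2 : ((m : ℝ) + 1) * (1 + ε) * (A * ζ ^ 2) ≤ (m + 2) * (1 - 1 / (4 * N)) * (A * ζ ^ 2) := by
      gcongr
    have h3 : ((m : ℝ) + 2) * (4 * N) * (A * q ^ 2) ≤ (m + 2) * (4 * N) * (N * ε * Sg) := by gcongr
    have h4 : ((m : ℝ) + 2) * (4 * N) * (N * ε * Sg) = (m + 2) * Sg := by
      linear_combination (m + 2) * Sg * hε1
    have h5 : ((m : ℝ) + 2) * Sg ≤ ((m : ℝ) + 1) * (1 + ε) * (2 * Sg) := by
      linear_combination 2 * mul_nonneg hεpos.le hSg0 + 2 * mul_nonneg hm0 (mul_nonneg hεpos.le hSg0) +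
        mul_nonneg hm0 hSg0
    linear_combination hT3 + h1 + h2 + h3 + h4 + h5
  exact le_of_mul_le_mul_left hfin (by positivity)

/-- If `x o` is large compared with the fixed value of `σ_k`, `k = m + 2`, then on the kernel of
`Dσ_k` the Hessian of `σ_k` controls the `o`-component of the direction. -/
theorem es_hessian_bound {s : Finset ι} {o : ι} (ho : o ∉ s) {x : ι → ℝ} (hxo : 0 < x o)
    (hx : ∀ i ∈ s, 0 < x i) {m : ℕ} (hm : m + 1 ≤ s.card)
    (hlarge : es (insert o s) x (m + 2) * (4 * ((s.card : ℝ) + 1) ^ 2) ^ (m + 1) ≤ x o ^ (m + 2))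
    (ξ : ι → ℝ) (hξ : esD (insert o s) x ξ (m + 2) = 0) :
    x o * esDD (insert o s) x ξ (m + 2) + es s x (m + 1) * ξ o ^ 2 ≤
      2 * ∑ p ∈ s, es ((insert o s).erase p) x (m + 1) * ξ p ^ 2 := by
  set N : ℝ := (s.card : ℝ) + 1 with hN
  have hmN : (m : ℝ) + 2 ≤ N := by
    have : ((m + 1 : ℕ) : ℝ) ≤ s.card := by exact_mod_cast hm
    push_cast at this; linarith
  have hNpos : 0 < N := by positivity
  set ε : ℝ := 1 / (4 * N ^ 2) with hε
  have hεpos : 0 < ε := by positivity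
  have hA := es_pos hx hm
  have hB := es_nonneg hx (m + 2)
  have hb : es (insert o s) x (m + 2) = es s x (m + 2) + x o * es s x (m + 1) := es_insert ho x _
  have hS : ∀ p ∈ s, es ((insert o s).erase p) x (m + 1) =
      es (s.erase p) x (m + 1) + x o * es (s.erase p) x m := by
    intro p hp
    rw [Finset.erase_insert_of_ne (ne_of_mem_of_not_mem hp ho).symm,
      es_insert (fun h => ho (Finset.mem_of_mem_erase h))]
  -- smallness of the quotients
  have small : ∀ A' : ℝ, (ε * x o) ^ (m + 1) ≤ A' → x o * A' < es (insert o s) x (m + 2) → False := by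
    intro A' h1 h2
    have h3 : x o * (ε * x o) ^ (m + 1) < es (insert o s) x (m + 2) :=
      (mul_le_mul_of_nonneg_left h1 hxo.le).trans_lt h2
    have h4 : x o * (ε * x o) ^ (m + 1) * (4 * N ^ 2) ^ (m + 1) = x o ^ (m + 2) := by
      rw [mul_assoc, ← mul_pow, show ε * x o * (4 * N ^ 2) = x o by rw [hε]; field_simp]
      ring
    have h5 : x o * (ε * x o) ^ (m + 1) * (4 * N ^ 2) ^ (m + 1) <
        es (insert o s) x (m + 2) * (4 * N ^ 2) ^ (m + 1) := by gcongr
    linarith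
  have hc0 : 0 ≤ ε * x o := by positivity
  -- Otherwise `pow_le_es` makes `σ_{m+1}` of the other variables at least `(ε x_o)^{m+1}`, and its
  -- product with `x_o` already exceeds the value of `σ_{m+2}` allowed by `hlarge`.
  have hBA : es s x (m + 2) ≤ ε * x o * es s x (m + 1) := by
    by_contra! hcon
    refine small _ (pow_le_es hx hc0 hm hcon.le (by omega)) ?_
    rw [hb]
    have : 0 < ε * x o * es s x (m + 1) := by positivity
    linarith
  have hp : ∀ p ∈ s, es (s.erase p) x (m + 1) ≤ ε * es ((insert o s).erase p) x (m + 1) ∧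
      0 ≤ es (s.erase p) x (m + 1) ∧ es (s.erase p) x (m + 1) ≤ es s x (m + 1) := by
    intro p hp
    have hx' : ∀ i ∈ s.erase p, 0 < x i := fun i hi => hx i (Finset.mem_of_mem_erase hi)
    have hcard : (s.erase p).card = s.card - 1 := Finset.card_erase_of_mem hp
    have h1 := es_pos hx' (j := m) (by omega)
    have h2 := es_nonneg hx' (m + 1)
    have hAe := es_erase hp x m
    have h3 : 0 < x p * es (s.erase p) x m := mul_pos (hx p hp) h1
    refine ⟨?_, h2, by linarith⟩
    rw [hS p hp]
    have : es (s.erase p) x (m + 1) ≤ ε * x o * es (s.erase p) x m := by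
      by_contra! hcon
      refine small _ (pow_le_es hx' hc0 (by omega) hcon.le le_rfl) ?_
      rw [hb, hAe]
      nlinarith
    nlinarith
  set Sg : ℝ := ∑ p ∈ s, es ((insert o s).erase p) x (m + 1) * ξ p ^ 2 with hSg
  have hSg0 : 0 ≤ Sg := Finset.sum_nonneg fun p hp' => by
    have := hp p hp'
    have : 0 ≤ es ((insert o s).erase p) x (m + 1) := by
      by_contra! h; nlinarith
    positivity
  -- the derivative of the quotient
  have hq : (esD s x ξ (m + 2) * es s x (m + 1) - es s x (m + 2) * esD s x ξ (m + 1)) ^ 2 ≤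
      es s x (m + 1) ^ 3 * (N * ε * Sg) := by
    -- In the `p`-th partial derivative of `σ_{m+2}/σ_{m+1}` all terms containing `x_p` cancel. What
    -- is left is nonnegative by log-concavity, and small because `σ_{m+1}` without `x_p` is.
    have e1 : esD s x ξ (m + 2) * es s x (m + 1) - es s x (m + 2) * esD s x ξ (m + 1) =
        ∑ p ∈ s, ξ p * (es (s.erase p) x (m + 1) ^ 2 - es (s.erase p) x m * es (s.erase p) x (m + 2)) := by
      simp only [esD]
      rw [Finset.sum_mul, Finset.mul_sum, ← Finset.sum_sub_distrib]
      refine Finset.sum_congr rfl fun p hp => ?_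
      rw [es_erase hp x m, es_erase hp x (m + 1)]
      ring
    rw [e1]
    refine (sq_sum_le_card_mul_sum_sq).trans ?_
    have e2 : ∑ p ∈ s, (ξ p * (es (s.erase p) x (m + 1) ^ 2 -
        es (s.erase p) x m * es (s.erase p) x (m + 2))) ^ 2 ≤ es s x (m + 1) ^ 3 * (ε * Sg) := by
      rw [hSg, Finset.mul_sum, Finset.mul_sum]
      refine Finset.sum_le_sum fun p hps => ?_
      obtain ⟨h1, h2, h3⟩ := hp p hps
      have hx' : ∀ i ∈ s.erase p, 0 < x i := fun i hi => hx i (Finset.mem_of_mem_erase hi)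
      have h4 := es_mul_es_le hx' (le_refl m)
      have h5 := mul_nonneg (es_nonneg hx' m) (es_nonneg hx' (m + 2))
      set a := es (s.erase p) x (m + 1)
      set ρ := a ^ 2 - es (s.erase p) x m * es (s.erase p) x (m + 2)
      set A := es s x (m + 1)
      have hρ0 : 0 ≤ ρ := by simp only [ρ]; nlinarith
      have hρ1 : ρ ≤ A * a := by simp only [ρ]; nlinarith
      have hρ2 : ρ ≤ A * A := hρ1.trans (by gcongr)
      have hρ3 : ρ ^ 2 ≤ A ^ 3 * a := by
        calc ρ ^ 2 = ρ * ρ := by ring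
          _ ≤ (A * A) * (A * a) := by gcongr
          _ = A ^ 3 * a := by ring
      calc (ξ p * ρ) ^ 2 = ρ ^ 2 * ξ p ^ 2 := by ring
        _ ≤ A ^ 3 * (ε * es ((insert o s).erase p) x (m + 1)) * ξ p ^ 2 := by
          gcongr
          exact hρ3.trans (by gcongr)
        _ = _ := by ring
    have e3 : (s.card : ℝ) ≤ N := by linarith
    calc (s.card : ℝ) * _ ≤ N * (es s x (m + 1) ^ 3 * (ε * Sg)) := by gcongr
      _ = _ := by ring
  have hconc := es_quotient_concave hx ξ hm
  have hroot := es_root_concave hx ξ hm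
  have hdd : esDD (insert o s) x ξ (m + 2) =
    esDD s x ξ (m + 2) + x o * esDD s x ξ (m + 1) + 2 * (ξ o * esD s x ξ (m + 1)) := esDD_insert ho x ξ _
  have hd : esD (insert o s) x ξ (m + 2) =
    esD s x ξ (m + 2) + x o * esD s x ξ (m + 1) + ξ o * es s x (m + 1) := esD_insert ho x ξ _
  rw [hξ] at hd
  rw [hdd]
  have e11 : m + 1 + 1 = m + 2 := rfl
  rw [e11] at hconc
  exact hessian_bound_arith hmN hε hA hB hxo hSg0 hBA hq hconc hroot hd

end SigmaK

namespace SigmaK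

/-! ### Second order jets at `0` -/

/-- `f` is differentiable near `0` with derivative `a` at `0`, and its derivative is differentiable at
`0` with derivative `b`. -/
def HasJet (f : ℝ → ℝ) (a b : ℝ) : Prop :=
  ∃ g : ℝ → ℝ, (∀ᶠ t in 𝓝 (0 : ℝ), HasDerivAt f (g t) t) ∧ g 0 = a ∧ HasDerivAt g b 0

lemma HasJet.of_eq {f : ℝ → ℝ} {a b a' b' : ℝ} (h : HasJet f a b) (ha : a = a') (hb : b = b') :
    HasJet f a' b' := ha ▸ hb ▸ h

lemma HasJet.congr {f f' : ℝ → ℝ} {a b : ℝ} (h : HasJet f a b) (hf : f' =ᶠ[𝓝 0] f) :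
    HasJet f' a b := by
  obtain ⟨g, h1, h2, h3⟩ := h
  refine ⟨g, ?_, h2, h3⟩
  filter_upwards [h1, hf.eventually_nhds] with t ht ht'
  exact ht.congr_of_eventuallyEq ht'

lemma HasJet.unique {f : ℝ → ℝ} {a b a' b' : ℝ} (h : HasJet f a b) (h' : HasJet f a' b') :
    a = a' ∧ b = b' := by
  obtain ⟨g, h1, h2, h3⟩ := h
  obtain ⟨g', h1', h2', h3'⟩ := h'
  have hg : g =ᶠ[𝓝 0] g' := by
    filter_upwards [h1, h1'] with t ht ht' using ht.unique ht'
  exact ⟨by rw [← h2, ← h2', hg.self_of_nhds], h3.unique (h3'.congr_of_eventuallyEq hg)⟩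

lemma hasJet_const (c : ℝ) : HasJet (fun _ => c) 0 0 :=
  ⟨fun _ => 0, Eventually.of_forall fun t => hasDerivAt_const t c, rfl, hasDerivAt_const 0 0⟩

lemma hasJet_id : HasJet (fun t => t) 1 0 :=
  ⟨fun _ => 1, Eventually.of_forall fun t => hasDerivAt_id t, rfl, hasDerivAt_const 0 1⟩

lemma HasJet.add {f f' : ℝ → ℝ} {a b a' b' : ℝ} (h : HasJet f a b) (h' : HasJet f' a' b') :
    HasJet (fun t => f t + f' t) (a + a') (b + b') := by
  obtain ⟨g, h1, h2, h3⟩ := h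
  obtain ⟨g', h1', h2', h3'⟩ := h'
  refine ⟨fun t => g t + g' t, ?_, by simp [h2, h2'], h3.add h3'⟩
  filter_upwards [h1, h1'] with t ht ht' using ht.add ht'

lemma HasJet.mul {f f' : ℝ → ℝ} {a b a' b' : ℝ} (h : HasJet f a b) (h' : HasJet f' a' b') :
    HasJet (fun t => f t * f' t) (a * f' 0 + f 0 * a') (b * f' 0 + 2 * (a * a') + f 0 * b') := by
  obtain ⟨g, h1, h2, h3⟩ := h
  obtain ⟨g', h1', h2', h3'⟩ := h'
  refine ⟨fun t => g t * f' t + f t * g' t, ?_, by simp [h2, h2'],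
    ((h3.mul h1'.self_of_nhds).add (h1.self_of_nhds.mul h3')).congr_deriv ?_⟩
  · filter_upwards [h1, h1'] with t ht ht' using ht.mul ht'
  · rw [h2, h2']; ring

lemma HasJet.const_mul {f : ℝ → ℝ} {a b : ℝ} (h : HasJet f a b) (c : ℝ) :
    HasJet (fun t => c * f t) (c * a) (c * b) :=
  ((hasJet_const c).mul h).of_eq (by ring) (by ring)

lemma HasJet.neg {f : ℝ → ℝ} {a b : ℝ} (h : HasJet f a b) : HasJet (fun t => -f t) (-a) (-b) := by
  have := h.const_mul (-1)
  simpa using this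

lemma HasJet.sub {f f' : ℝ → ℝ} {a b a' b' : ℝ} (h : HasJet f a b) (h' : HasJet f' a' b') :
    HasJet (fun t => f t - f' t) (a - a') (b - b') := by
  simpa only [sub_eq_add_neg] using h.add h'.neg

lemma HasJet.sum {ι : Type*} {s : Finset ι} {f : ι → ℝ → ℝ} {a b : ι → ℝ}
    (h : ∀ i ∈ s, HasJet (f i) (a i) (b i)) :
    HasJet (fun t => ∑ i ∈ s, f i t) (∑ i ∈ s, a i) (∑ i ∈ s, b i) := by
  classical
  induction s using Finset.induction_on with
  | empty => simpa using hasJet_const 0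
  | insert i s hi ih =>
    simp only [Finset.sum_insert hi]
    exact (h i (Finset.mem_insert_self i s)).add
      (ih fun j hj => h j (Finset.mem_insert_of_mem hj))

/-- The second order part separates the terms in which one factor is differentiated twice from those
in which two distinct factors are differentiated once, as the determinant expansion needs. -/
lemma HasJet.prod {ι : Type*} [DecidableEq ι] {s : Finset ι} {f : ι → ℝ → ℝ} {a b : ι → ℝ}
    (h : ∀ i, HasJet (f i) (a i) (b i)) :
    HasJet (fun t => ∏ i ∈ s, f i t) (∑ p ∈ s, (∏ i ∈ s.erase p, f i 0) * a p)
      (∑ p ∈ s, (∏ i ∈ s.erase p, f i 0) * b p +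
        ∑ p ∈ s, ∑ q ∈ s.erase p, (∏ i ∈ (s.erase p).erase q, f i 0) * (a p * a q)) := by
  choose g h1 h2 h3 using h
  refine ⟨fun t => ∑ p ∈ s, (∏ i ∈ s.erase p, f i t) * g p t, ?_, by simp [h2], ?_⟩
  · filter_upwards [(Filter.eventually_all_finset s).2 fun i _ => h1 i] with t ht
    simpa [smul_eq_mul] using HasDerivAt.fun_finsetProd ht
  · have := HasDerivAt.fun_sum (u := s) fun p _ => (HasDerivAt.fun_finsetProd
      (u := s.erase p) fun i _ => (h1 i).self_of_nhds).mul (h3 p)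
    refine this.congr_deriv ?_
    rw [← Finset.sum_add_distrib]
    refine Finset.sum_congr rfl fun p _ => ?_
    rw [add_comm, Finset.sum_mul]
    congr 1
    refine Finset.sum_congr rfl fun q _ => ?_
    rw [h2, h2, smul_eq_mul]; ring

lemma HasJet.exp {f : ℝ → ℝ} {a b : ℝ} (h : HasJet f a b) :
    HasJet (fun t => Real.exp (f t)) (Real.exp (f 0) * a) (Real.exp (f 0) * (b + a ^ 2)) := by
  obtain ⟨g, h1, h2, h3⟩ := h
  refine ⟨fun t => Real.exp (f t) * g t, ?_, by simp [h2],
    ((h1.self_of_nhds.exp).mul h3).congr_deriv ?_⟩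
  · filter_upwards [h1] with t ht using ht.exp
  · rw [h2]; ring

lemma HasJet.of_isLocalMax {f : ℝ → ℝ} {a b : ℝ} (h : HasJet f a b) (hm : IsLocalMax f 0) :
    a = 0 ∧ b ≤ 0 := by
  obtain ⟨g, h1, h2, h3⟩ := h
  have := second_derivative_nonpos_of_isLocalMax h1 h3 hm
  exact ⟨h2 ▸ this.1, this.2⟩

lemma HasJet.of_isLocalMin {f : ℝ → ℝ} {a b : ℝ} (h : HasJet f a b) (hm : IsLocalMin f 0) :
    a = 0 ∧ 0 ≤ b := by
  have := h.neg.of_isLocalMax hm.neg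
  exact ⟨by linarith [this.1], by linarith [this.2]⟩

/-! ### The second order jet of a determinant at a diagonal matrix -/

variable {ι : Type*} [DecidableEq ι] [Fintype ι]

lemma perm_eq_one_of_forall_ne {σ : Equiv.Perm ι} {p : ι} (h : ∀ i, i ≠ p → σ i = i) : σ = 1 := by
  ext i
  by_cases hi : i = p
  · subst hi
    by_contra hne
    exact hne (σ.injective (h _ hne))
  · simpa using h i hi

lemma perm_eq_one_or_swap {σ : Equiv.Perm ι} {p q : ι}
    (h : ∀ i, i ≠ p → i ≠ q → σ i = i) : σ = 1 ∨ σ = Equiv.swap p q := by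
  by_cases hp : σ p = p
  · left
    refine perm_eq_one_of_forall_ne (p := q) fun i hi => ?_
    by_cases hip : i = p
    · rw [hip, hp]
    · exact h i hip hi
  · right
    have h1 : σ p = q := by
      by_contra hq
      exact hp (σ.injective (h _ hp hq))
    have : Equiv.swap p q * σ = 1 := by
      refine perm_eq_one_of_forall_ne (p := q) fun i hi => ?_
      by_cases hip : i = p
      · rw [hip, Equiv.Perm.mul_apply, h1, Equiv.swap_apply_right]
      · rw [Equiv.Perm.mul_apply, h i hip hi, Equiv.swap_apply_of_ne_of_ne hip hi]
    calc σ = Equiv.swap p q * (Equiv.swap p q * σ) := by simp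
      _ = _ := by rw [this, mul_one]

/-- In the Leibniz expansion a permutation that moves an index outside the differentiated columns
meets an off-diagonal zero of `A 0`. With one differentiated column only the identity survives; with
two, the identity and their transposition. -/
lemma HasJet.det {A : ℝ → Matrix ι ι ℝ} {A1 A2 : Matrix ι ι ℝ} {d : ι → ℝ}
    (h : ∀ i j, HasJet (fun t => A t i j) (A1 i j) (A2 i j)) (h0 : A 0 = Matrix.diagonal d) :
    HasJet (fun t => (A t).det) (∑ p, (∏ i ∈ Finset.univ.erase p, d i) * A1 p p)
      (∑ p, (∏ i ∈ Finset.univ.erase p, d i) * A2 p p +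
        ∑ p, ∑ q ∈ Finset.univ.erase p, (∏ i ∈ (Finset.univ.erase p).erase q, d i) *
          (A1 p p * A1 q q - A1 p q * A1 q p)) := by
  have h1 : ∀ (B : Matrix ι ι ℝ) (p : ι), ∑ σ : Equiv.Perm ι, ((Equiv.Perm.sign σ : ℤ) : ℝ) *
      ((∏ i ∈ Finset.univ.erase p, A 0 (σ i) i) * B (σ p) p) =
      (∏ i ∈ Finset.univ.erase p, d i) * B p p := by
    intro B p
    rw [Finset.sum_eq_single 1]
    · simp [h0]
    · intro σ _ hσ
      obtain ⟨i, hi, hi'⟩ : ∃ i, i ≠ p ∧ σ i ≠ i := by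
        by_contra! hcon
        exact hσ (perm_eq_one_of_forall_ne hcon)
      rw [Finset.prod_eq_zero (i := i) (by simp [hi]) (by simp [h0, hi'])]
      simp
    · simp
  have h2 : ∀ (p q : ι), q ∈ Finset.univ.erase p → ∑ σ : Equiv.Perm ι,
      ((Equiv.Perm.sign σ : ℤ) : ℝ) * ((∏ i ∈ (Finset.univ.erase p).erase q, A 0 (σ i) i) *
        (A1 (σ p) p * A1 (σ q) q)) =
      (∏ i ∈ (Finset.univ.erase p).erase q, d i) * (A1 p p * A1 q q - A1 p q * A1 q p) := by
    intro p q hq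
    have hpq : p ≠ q := (Finset.ne_of_mem_erase hq).symm
    have hne : (1 : Equiv.Perm ι) ≠ Equiv.swap p q := by
      intro h
      have := congrArg (fun σ : Equiv.Perm ι => σ p) h
      simp at this
      exact hpq this
    rw [← Finset.sum_subset (Finset.subset_univ {1, Equiv.swap p q}), Finset.sum_pair hne]
    · have : ∏ i ∈ (Finset.univ.erase p).erase q, A 0 (Equiv.swap p q i) i =
          ∏ i ∈ (Finset.univ.erase p).erase q, d i := by
        refine Finset.prod_congr rfl fun i hi => ?_
        simp only [Finset.mem_erase, Finset.mem_univ, and_true] at hi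
        rw [Equiv.swap_apply_of_ne_of_ne hi.2 hi.1, h0, Matrix.diagonal_apply_eq]
      rw [this, Equiv.Perm.sign_swap hpq]
      simp [h0]
      ring
    · intro σ _ hσ
      obtain ⟨i, hi1, hi2, hi'⟩ : ∃ i, i ≠ p ∧ i ≠ q ∧ σ i ≠ i := by
        by_contra! hcon
        rcases perm_eq_one_or_swap hcon with h | h <;> simp [h] at hσ
      rw [Finset.prod_eq_zero (i := i) (by simp [hi1, hi2]) (by simp [h0, hi'])]
      simp
  have hd : (fun t => (A t).det) = fun t => ∑ σ : Equiv.Perm ι, ((Equiv.Perm.sign σ : ℤ) : ℝ) *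
      ∏ i, A t (σ i) i := by
    funext t; rw [Matrix.det_apply']
  rw [hd]
  refine (HasJet.sum fun (σ : Equiv.Perm ι) _ => (HasJet.prod (s := Finset.univ)
    fun i => h (σ i) i).const_mul ((Equiv.Perm.sign σ : ℤ) : ℝ)).of_eq ?_ ?_
  · simp only [Finset.mul_sum]
    rw [Finset.sum_comm]
    exact Finset.sum_congr rfl fun p _ => h1 A1 p
  · simp only [mul_add, Finset.sum_add_distrib, Finset.mul_sum]
    congr 1
    · rw [Finset.sum_comm]
      exact Finset.sum_congr rfl fun p _ => h1 A2 p
    · rw [Finset.sum_comm]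
      refine Finset.sum_congr rfl fun p _ => ?_
      rw [Finset.sum_comm]
      exact Finset.sum_congr rfl fun q hq => h2 p q hq

/-! ### First and second derivatives of the equation along a curve of matrices -/

/-- Lagrange interpolation at `0, …, n`. The equation is linear in the coefficients of `det (x +
A)`, hence a fixed combination of finitely many determinants, which can be differentiated without
eigenvalues. -/
lemma exists_coeff_functional (n k : ℕ) (b : ℝ) : ∃ c : ℕ → ℝ, ∀ p : ℝ[X],
    p.natDegree ≤ n → p.coeff k - b * p.coeff 0 = ∑ i ∈ Finset.range (n + 1), c i * p.eval (i : ℝ) := by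
  have hinj : Set.InjOn (fun i : ℕ => (i : ℝ)) (Finset.range (n + 1)) :=
    fun _ _ _ _ h => Nat.cast_injective h
  refine ⟨fun i => (Lagrange.basis (Finset.range (n + 1)) (fun i : ℕ => (i : ℝ)) i).coeff k -
    b * (Lagrange.basis (Finset.range (n + 1)) (fun i : ℕ => (i : ℝ)) i).coeff 0, fun p hp => ?_⟩
  have h := Lagrange.eq_interpolate (f := p) hinj (by
    rw [Finset.card_range]
    exact (Polynomial.degree_le_of_natDegree_le hp).trans_lt (by exact_mod_cast Nat.lt_succ_self n))
  have hc : ∀ j, p.coeff j = ∑ i ∈ Finset.range (n + 1), p.eval (i : ℝ) *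
      (Lagrange.basis (Finset.range (n + 1)) (fun i : ℕ => (i : ℝ)) i).coeff j := by
    intro j
    conv_lhs => rw [h]
    simp [Lagrange.interpolate_apply, Polynomial.finsetSum_coeff, Polynomial.coeff_C_mul]
  rw [hc k, hc 0, Finset.mul_sum, ← Finset.sum_sub_distrib]
  exact Finset.sum_congr rfl fun i _ => by ring

lemma prod_X_add_C_inv_coeff {s : Finset ι} {κ : ι → ℝ} (hκ : ∀ i, 0 < κ i) (j : ℕ) :
    (∏ i ∈ s, (X + C (κ i)⁻¹ : ℝ[X])).coeff j = (∏ i ∈ s, (κ i)⁻¹) * es s κ j := by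
  have : ∏ i ∈ s, (X + C (κ i)⁻¹ : ℝ[X]) = C (∏ i ∈ s, (κ i)⁻¹) * ∏ i ∈ s, (1 + C (κ i) * X) := by
    rw [map_prod, ← Finset.prod_mul_distrib]
    refine Finset.prod_congr rfl fun i _ => ?_
    rw [mul_add, mul_one, ← mul_assoc, ← C_mul, inv_mul_cancel₀ (hκ i).ne', C_1, one_mul, add_comm]
  rw [this, Polynomial.coeff_C_mul, es]

/-- The equation `σ_k = b` for the inverses of the eigenvalues of `A`. -/
def SatisfiesEq (k : ℕ) (b : ℝ) (A : Matrix ι ι ℝ) : Prop :=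
  ∃ P : ℝ[X], P.natDegree ≤ Fintype.card ι ∧ (∀ x : ℝ, P.eval x = (Matrix.scalar ι x + A).det) ∧
    P.coeff k = b * P.coeff 0

section Equation

variable {A : ℝ → Matrix ι ι ℝ} {A1 A2 : Matrix ι ι ℝ} {κ : ι → ℝ} {k : ℕ} {b : ℝ}

lemma es_eq_of_satisfiesEq (hκ : ∀ i, 0 < κ i)
    (h : SatisfiesEq k b (Matrix.diagonal fun i => (κ i)⁻¹)) : es Finset.univ κ k = b := by
  obtain ⟨P, _, hP, hP'⟩ := h
  have : P = ∏ i, (X + C (κ i)⁻¹ : ℝ[X]) := by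
    refine Polynomial.funext fun x => ?_
    rw [hP, Polynomial.eval_prod]
    have : Matrix.scalar ι x + Matrix.diagonal (fun i => (κ i)⁻¹) =
        Matrix.diagonal fun i => x + (κ i)⁻¹ := by
      ext i j; by_cases hij : i = j <;> simp [hij, Matrix.scalar_apply]
    rw [this, Matrix.det_diagonal]; simp
  rw [this, prod_X_add_C_inv_coeff hκ, prod_X_add_C_inv_coeff hκ, es_zero, mul_one, mul_comm] at hP'
  exact mul_right_cancel₀ (Finset.prod_pos fun i _ => inv_pos.2 (hκ i)).ne' hP'

lemma natDegree_prod_X_add_C_le (s : Finset ι) (d : ι → ℝ) :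
    (∏ i ∈ s, (X + C (d i) : ℝ[X])).natDegree ≤ Fintype.card ι := by
  refine (Polynomial.natDegree_prod_le _ _).trans ?_
  simp only [Polynomial.natDegree_X_add_C]
  simpa using Finset.card_le_univ s

lemma equation_derivatives (hκ : ∀ i, 0 < κ i)
    (h : ∀ i j, HasJet (fun t => A t i j) (A1 i j) (A2 i j))
    (h0 : A 0 = Matrix.diagonal fun i => (κ i)⁻¹)
    (heq : ∀ᶠ t in 𝓝 (0 : ℝ), SatisfiesEq k b (A t)) :
    (∑ p, (∏ i ∈ Finset.univ.erase p, (κ i)⁻¹) * (es (Finset.univ.erase p) κ k - b) * A1 p p = 0) ∧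
    (∑ p, (∏ i ∈ Finset.univ.erase p, (κ i)⁻¹) * (es (Finset.univ.erase p) κ k - b) * A2 p p +
      ∑ p, ∑ q ∈ Finset.univ.erase p, (∏ i ∈ (Finset.univ.erase p).erase q, (κ i)⁻¹) *
        (es ((Finset.univ.erase p).erase q) κ k - b) *
          (A1 p p * A1 q q - A1 p q * A1 q p) = 0) := by
  obtain ⟨c, hc⟩ := exists_coeff_functional (Fintype.card ι) k b
  have hdet : ∀ x : ℝ, HasJet (fun t => (Matrix.scalar ι x + A t).det) _ _ := fun x =>
    HasJet.det (A := fun t => Matrix.scalar ι x + A t) (A1 := A1) (A2 := A2)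
      (d := fun i => x + (κ i)⁻¹)
      (fun i j => ((hasJet_const ((Matrix.scalar ι x) i j)).add (h i j)).of_eq (by ring) (by ring))
      (by rw [h0]; ext i j; by_cases hij : i = j <;> simp [hij, Matrix.scalar_apply])
  have hsum := HasJet.sum (s := Finset.range (Fintype.card ι + 1))
    fun (i : ℕ) _ => (hdet (i : ℝ)).const_mul (c i)
  have hzero : (fun t => ∑ i ∈ Finset.range (Fintype.card ι + 1),
      c i * (Matrix.scalar ι (i : ℝ) + A t).det) =ᶠ[𝓝 0] fun _ => 0 := by
    filter_upwards [heq] with t ⟨P, h1, h2, h3⟩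
    simp only [← h2]
    rw [← hc P h1, h3, sub_self]
  obtain ⟨e1, e2⟩ := hsum.unique ((hasJet_const 0).congr hzero)
  -- The cofactors in `HasJet.det` are again products of linear factors `x + κ_l⁻¹`, so the same
  -- functional evaluates them in closed form.
  have hL : ∀ s : Finset ι, ∑ i ∈ Finset.range (Fintype.card ι + 1),
      c i * ∏ l ∈ s, ((i : ℝ) + (κ l)⁻¹) = (∏ i ∈ s, (κ i)⁻¹) * (es s κ k - b) := by
    intro s
    have := hc (∏ i ∈ s, (X + C (κ i)⁻¹ : ℝ[X])) (natDegree_prod_X_add_C_le s _)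
    rw [prod_X_add_C_inv_coeff hκ, prod_X_add_C_inv_coeff hκ, es_zero] at this
    simp only [Polynomial.eval_prod, Polynomial.eval_add, Polynomial.eval_X, Polynomial.eval_C] at this
    rw [← this]; ring
  constructor
  · rw [← e1]
    simp only [Finset.mul_sum, ← hL, Finset.sum_mul]
    rw [Finset.sum_comm]
    exact Finset.sum_congr rfl fun i _ => Finset.sum_congr rfl fun p _ => by ring
  · rw [← e2]
    simp only [mul_add, Finset.mul_sum, ← hL, Finset.sum_mul, Finset.sum_add_distrib]
    congr 1
    · rw [Finset.sum_comm]
      exact Finset.sum_congr rfl fun i _ => Finset.sum_congr rfl fun p _ => by ring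
    · rw [Finset.sum_comm]
      refine Finset.sum_congr rfl fun p _ => ?_
      rw [Finset.sum_comm]
      exact Finset.sum_congr rfl fun i _ => Finset.sum_congr rfl fun q _ => by ring

end Equation

end SigmaK

namespace SigmaK

variable {ι : Type*} [DecidableEq ι] [Fintype ι]

/-! ### The differentiated equation in terms of the curvatures -/

lemma prod_erase_inv {s : Finset ι} {κ : ι → ℝ} (hκ : ∀ i, 0 < κ i) {p : ι} (hp : p ∈ s) :
    ∏ i ∈ s.erase p, (κ i)⁻¹ = κ p * ∏ i ∈ s, (κ i)⁻¹ := by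
  rw [← Finset.mul_prod_erase s _ hp, ← mul_assoc, mul_inv_cancel₀ (hκ p).ne', one_mul]

section Equation

variable {A : ℝ → Matrix ι ι ℝ} {A1 A2 : Matrix ι ι ℝ} {κ : ι → ℝ} {m : ℕ}

lemma equation_first (hκ : ∀ i, 0 < κ i)
    (h : ∀ i j, HasJet (fun t => A t i j) (A1 i j) (A2 i j))
    (h0 : A 0 = Matrix.diagonal fun i => (κ i)⁻¹)
    (heq : ∀ᶠ t in 𝓝 (0 : ℝ), SatisfiesEq (m + 1) (es Finset.univ κ (m + 1)) (A t)) :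
    ∑ p, κ p ^ 2 * es (Finset.univ.erase p) κ m * A1 p p = 0 := by
  have h1 := (equation_derivatives hκ h h0 heq).1
  have hP : 0 < ∏ i, (κ i)⁻¹ := Finset.prod_pos fun i _ => inv_pos.2 (hκ i)
  have h2 : (∏ i, (κ i)⁻¹) * ∑ p, κ p ^ 2 * es (Finset.univ.erase p) κ m * A1 p p = 0 := by
    rw [← neg_eq_zero, ← h1, Finset.mul_sum, ← Finset.sum_neg_distrib]
    refine Finset.sum_congr rfl fun p _ => ?_
    rw [prod_erase_inv hκ (Finset.mem_univ p), es_erase (Finset.mem_univ p)]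
    ring
  exact (mul_eq_zero.1 h2).resolve_left hP.ne'

/-- Rewriting the cofactor weights in `κ` splits the coefficient of each pair into a part with `σ_m`
and two parts with `σ_{m+1}`. For the latter, the products `A1 p p * A1 q q` sum to zero by
`equation_first`, since they contain the first order equation as a factor; only the mixed products
`A1 p q * A1 q p` remain. -/
lemma equation_second (hκ : ∀ i, 0 < κ i)
    (h : ∀ i j, HasJet (fun t => A t i j) (A1 i j) (A2 i j))
    (h0 : A 0 = Matrix.diagonal fun i => (κ i)⁻¹)
    (heq : ∀ᶠ t in 𝓝 (0 : ℝ), SatisfiesEq (m + 2) (es Finset.univ κ (m + 2)) (A t)) :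
    ∑ p, κ p ^ 2 * es (Finset.univ.erase p) κ (m + 1) * A2 p p =
      2 * ∑ p, ∑ q, es (Finset.univ.erase p) κ (m + 1) * κ p ^ 2 * κ q * (A1 p q * A1 q p) +
      ∑ p, ∑ q ∈ Finset.univ.erase p, es ((Finset.univ.erase p).erase q) κ m *
        (κ p ^ 2 * κ q ^ 2) * (A1 p p * A1 q q - A1 p q * A1 q p) := by
  have h1 := equation_first hκ h h0 heq
  have h2 := (equation_derivatives hκ h h0 heq).2
  have hP : 0 < ∏ i, (κ i)⁻¹ := Finset.prod_pos fun i _ => inv_pos.2 (hκ i)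
  set P := ∏ i, (κ i)⁻¹ with hPdef
  set S : ι → ℝ := fun p => es (Finset.univ.erase p) κ (m + 1) with hS
  have e1 : ∑ p, (∏ i ∈ Finset.univ.erase p, (κ i)⁻¹) * (es (Finset.univ.erase p) κ (m + 2) -
      es Finset.univ κ (m + 2)) * A2 p p = -P * ∑ p, κ p ^ 2 * S p * A2 p p := by
    rw [Finset.mul_sum]
    refine Finset.sum_congr rfl fun p _ => ?_
    rw [prod_erase_inv hκ (Finset.mem_univ p), es_erase (Finset.mem_univ p)]
    simp only [hS]; ring
  have e2 : ∀ p, ∑ q ∈ Finset.univ.erase p, (∏ i ∈ (Finset.univ.erase p).erase q, (κ i)⁻¹) *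
      (es ((Finset.univ.erase p).erase q) κ (m + 2) - es Finset.univ κ (m + 2)) *
        (A1 p p * A1 q q - A1 p q * A1 q p) =
      P * ∑ q ∈ Finset.univ.erase p, es ((Finset.univ.erase p).erase q) κ m *
        (κ p ^ 2 * κ q ^ 2) * (A1 p p * A1 q q - A1 p q * A1 q p) -
      P * ∑ q ∈ Finset.univ.erase p, (κ p ^ 2 * κ q * S p + κ q ^ 2 * κ p * S q) *
        (A1 p p * A1 q q - A1 p q * A1 q p) := by
    intro p
    rw [Finset.mul_sum, Finset.mul_sum, ← Finset.sum_sub_distrib]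
    refine Finset.sum_congr rfl fun q hq => ?_
    have hpq : p ∈ Finset.univ.erase q := by
      simpa using (Finset.ne_of_mem_erase hq).symm
    have e3 : S p = es ((Finset.univ.erase p).erase q) κ (m + 1) +
      κ q * es ((Finset.univ.erase p).erase q) κ m := es_erase hq κ m
    have e4 : S q = es ((Finset.univ.erase p).erase q) κ (m + 1) +
        κ p * es ((Finset.univ.erase p).erase q) κ m := by
      rw [Finset.erase_right_comm]; exact es_erase hpq κ m
    rw [prod_erase_inv hκ hq, prod_erase_inv hκ (Finset.mem_univ p), ← hPdef,
      es_erase (Finset.mem_univ p) κ (m + 1), es_erase hq κ (m + 1), es_erase hq κ m, e3, e4]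
    ring
  have e5 : ∀ p, ∑ q ∈ Finset.univ.erase p, (κ p ^ 2 * κ q * S p + κ q ^ 2 * κ p * S q) *
        (A1 p p * A1 q q - A1 p q * A1 q p) =
      ∑ q, (κ p ^ 2 * κ q * S p + κ q ^ 2 * κ p * S q) * (A1 p p * A1 q q - A1 p q * A1 q p) := by
    intro p
    rw [← Finset.add_sum_erase _ _ (Finset.mem_univ p)]
    simp
  have e6 : ∑ p, ∑ q, (κ p ^ 2 * κ q * S p + κ q ^ 2 * κ p * S q) *
      (A1 p p * A1 q q - A1 p q * A1 q p) =
      -(2 * ∑ p, ∑ q, S p * κ p ^ 2 * κ q * (A1 p q * A1 q p)) := by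
    have f1 : ∑ p, ∑ q, κ p ^ 2 * κ q * S p * (A1 p p * A1 q q) = 0 := by
      have : ∀ p, ∑ q, κ p ^ 2 * κ q * S p * (A1 p p * A1 q q) =
          κ p ^ 2 * S p * A1 p p * ∑ q, κ q * A1 q q := by
        intro p
        rw [Finset.mul_sum]
        exact Finset.sum_congr rfl fun q _ => by ring
      simp only [this]
      rw [← Finset.sum_mul, h1, zero_mul]
    have f2 : ∑ p, ∑ q, κ q ^ 2 * κ p * S q * (A1 p p * A1 q q) = 0 := by
      rw [Finset.sum_comm, ← f1]
      exact Finset.sum_congr rfl fun q _ => Finset.sum_congr rfl fun p _ => by ring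
    have f3 : ∑ p, ∑ q, κ q ^ 2 * κ p * S q * (A1 p q * A1 q p) =
        ∑ p, ∑ q, S p * κ p ^ 2 * κ q * (A1 p q * A1 q p) := by
      rw [Finset.sum_comm]
      exact Finset.sum_congr rfl fun q _ => Finset.sum_congr rfl fun p _ => by ring
    have f4 : ∑ p, ∑ q, (κ p ^ 2 * κ q * S p + κ q ^ 2 * κ p * S q) *
        (A1 p p * A1 q q - A1 p q * A1 q p) =
        ∑ p, ∑ q, κ p ^ 2 * κ q * S p * (A1 p p * A1 q q) +
        ∑ p, ∑ q, κ q ^ 2 * κ p * S q * (A1 p p * A1 q q) -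
        ∑ p, ∑ q, S p * κ p ^ 2 * κ q * (A1 p q * A1 q p) -
        ∑ p, ∑ q, κ q ^ 2 * κ p * S q * (A1 p q * A1 q p) := by
      simp only [← Finset.sum_add_distrib, ← Finset.sum_sub_distrib]
      exact Finset.sum_congr rfl fun q _ => Finset.sum_congr rfl fun p _ => by ring
    rw [f4, f1, f2, f3]; ring
  rw [e1] at h2
  simp only [e2, e5] at h2
  rw [Finset.sum_sub_distrib, ← Finset.mul_sum, ← Finset.mul_sum, e6] at h2
  have h3 : P * (∑ p, κ p ^ 2 * S p * A2 p p) = P * (2 * ∑ p, ∑ q, S p * κ p ^ 2 * κ q *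
      (A1 p q * A1 q p) + ∑ p, ∑ q ∈ Finset.univ.erase p, es ((Finset.univ.erase p).erase q) κ m *
        (κ p ^ 2 * κ q ^ 2) * (A1 p p * A1 q q - A1 p q * A1 q p)) := by linarith
  exact mul_left_cancel₀ hP.ne' h3

end Equation

/-! ### The test function at a maximum point, along one direction -/

/-- The maximum condition in product form says that a smooth function of `t` and `v` is nonnegative
and vanishes at `t = 0`, `v = e_o`. Testing it on the curve `v = e_o + t c` gives first and second
order conditions. The free vector `c` replaces the second order perturbation formula for the least
eigenvalue. -/
lemma test_function_jets {A : ℝ → Matrix ι ι ℝ} {A1 A2 : Matrix ι ι ℝ} {κ : ι → ℝ}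
    {U W : ℝ → ℝ} {U1 U2 W1 W2 s N : ℝ} {o : ι} (c : ι → ℝ) (hc : c o = 0) (hκ : ∀ i, 0 < κ i)
    (hA : ∀ i j, HasJet (fun t => A t i j) (A1 i j) (A2 i j))
    (hA0 : A 0 = Matrix.diagonal fun i => (κ i)⁻¹) (hsymm : ∀ i j, A1 i j = A1 j i)
    (hU : HasJet U U1 U2) (hW : HasJet W W1 W2)
    (hmax : ∀ᶠ t in 𝓝 (0 : ℝ), ∀ v : ι → ℝ, (s - U t) * Real.exp (N * W t) * ∑ a, v a ^ 2 ≤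
      (s - U 0) * Real.exp (N * W 0) * κ o * ∑ a, ∑ b, A t a b * (v a * v b)) :
    (s - U 0) * κ o * A1 o o = -U1 + (s - U 0) * (N * W1) ∧
    -U2 - 2 * U1 * (N * W1) + (s - U 0) * (N * W2 + (N * W1) ^ 2) + 2 * (s - U 0) * ∑ a, c a ^ 2 ≤
      (s - U 0) * κ o * (A2 o o + 4 * ∑ a, c a * A1 o a + 2 * ∑ a, (κ a)⁻¹ * c a ^ 2) := by
  set E := Real.exp (N * W 0) with hE
  have hEpos : 0 < E := Real.exp_pos _
  set v : ℝ → ι → ℝ := fun t a => (if a = o then 1 else 0) + c a * t with hv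
  have hvj : ∀ a, HasJet (fun t => v t a) (c a) 0 := fun a =>
    ((hasJet_const (if a = o then (1 : ℝ) else 0)).add (hasJet_id.const_mul (c a))).of_eq
      (by ring) (by ring)
  have hv0 : ∀ a, v 0 a = if a = o then 1 else 0 := fun a => by simp [hv]
  have j1 : HasJet (fun t => ∑ a, ∑ b, A t a b * (v t a * v t b)) (A1 o o)
      (A2 o o + 4 * ∑ a, c a * A1 o a + 2 * ∑ a, (κ a)⁻¹ * c a ^ 2) := by
    refine (HasJet.sum fun a _ => HasJet.sum fun b _ => (hA a b).mul ((hvj a).mul (hvj b))).of_eq ?_ ?_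
    · simp only [hv0, hA0, Matrix.diagonal_apply]
      simp [Finset.sum_add_distrib, mul_add, hc]
    · simp only [hv0, hA0, Matrix.diagonal_apply]
      have e1 : ∑ a, c a * A1 a o = ∑ a, c a * A1 o a :=
        Finset.sum_congr rfl fun a _ => by rw [hsymm]
      simp [Finset.sum_add_distrib, mul_add]
      have e2 : ∀ a, 2 * (A1 a o * c a) = 2 * (c a * A1 o a) := fun a => by rw [hsymm]; ring
      have e3 : ∀ a, 2 * (A1 o a * c a) = 2 * (c a * A1 o a) := fun a => by ring
      have e4 : ∀ a, (κ a)⁻¹ * (2 * (c a * c a)) = 2 * ((κ a)⁻¹ * c a ^ 2) := fun a => by ring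
      simp only [e2, e3, e4, ← Finset.mul_sum]
      ring
  have j2 : HasJet (fun t => ∑ a, v t a ^ 2) 0 (2 * ∑ a, c a ^ 2) := by
    have : (fun t => ∑ a, v t a ^ 2) = fun t => ∑ a, v t a * v t a := by
      funext t; simp only [sq]
    rw [this]
    refine (HasJet.sum fun a _ => (hvj a).mul (hvj a)).of_eq ?_ ?_
    · simp [hv0, Finset.sum_add_distrib, hc]
    · simp [Finset.mul_sum, sq]
  have j3 : HasJet (fun t => (s - U t) * Real.exp (N * W t)) (E * (-U1 + (s - U 0) * (N * W1)))
      (E * (-U2 - 2 * U1 * (N * W1) + (s - U 0) * (N * W2 + (N * W1) ^ 2))) :=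
    (((hasJet_const s).sub hU).mul (hW.const_mul N).exp).of_eq (by ring) (by ring)
  have hv0' : ∑ a, v 0 a ^ 2 = 1 := by simp [hv0]
  have hA0' : ∑ a, ∑ b, A 0 a b * (v 0 a * v 0 b) = (κ o)⁻¹ := by
    simp [hv0, hA0, Matrix.diagonal_apply]
  have j4 := (j1.const_mul ((s - U 0) * E * κ o)).sub (j3.mul j2)
  have hmin : IsLocalMin (fun t => (s - U 0) * E * κ o * ∑ a, ∑ b, A t a b * (v t a * v t b) -
      (s - U t) * Real.exp (N * W t) * ∑ a, v t a ^ 2) 0 := by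
    filter_upwards [hmax] with t ht
    have := ht (v t)
    rw [hv0', hA0', mul_assoc _ (κ o), mul_inv_cancel₀ (hκ o).ne']
    linarith
  obtain ⟨h1, h2⟩ := j4.of_isLocalMin hmin
  rw [hv0'] at h1 h2
  constructor
  · have : E * ((s - U 0) * κ o * A1 o o) = E * (-U1 + (s - U 0) * (N * W1)) := by linarith
    exact mul_left_cancel₀ hEpos.ne' this
  · refine le_of_mul_le_mul_left ?_ hEpos
    linarith

end SigmaK

/-! ### Adapted charts and the third order terms -/

namespace SigmaK

variable {ι : Type*} [DecidableEq ι] [Fintype ι]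

/-- The curves obtained from a chart adapted to a point: along the `i`-th coordinate direction `A i`
is the dual matrix, `U i` the height function and `W i` the Lorentz factor. -/
structure IsAdaptedChart (κ : ι → ℝ) (T : ι → ι → ι → ℝ) (q : ι → ι → ℝ) (β : ι → ℝ) (u₀ W₀ : ℝ)
    (A : ι → ℝ → Matrix ι ι ℝ) (A2 : ι → Matrix ι ι ℝ) (U W : ι → ℝ → ℝ) : Prop where
  pos : ∀ i, 0 < κ i
  swap : ∀ i j l, T i j l = T j i l
  swap' : ∀ i j l, T i j l = T i l j
  symm : ∀ i j, q i j = q j i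
  sq : W₀ ^ 2 = 1 + ∑ i, β i ^ 2
  W_pos : 0 < W₀
  A_zero : ∀ i, A i 0 = Matrix.diagonal fun a => (κ a)⁻¹
  U_zero : ∀ i, U i 0 = u₀
  W_zero : ∀ i, W i 0 = W₀
  A_jet : ∀ i a b, HasJet (fun t => A i t a b) (T a b i) (A2 i a b)
  A2_diag : ∀ i a, A2 i a a = q a i - (1 + if a = i then 2 else 0) * (κ a)⁻¹
  U_jet : ∀ i, HasJet (U i) (-(β i * (κ i)⁻¹)) (W₀ * (κ i)⁻¹ - ∑ j, β j * T i i j)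
  W_jet : ∀ i, HasJet (W i) (-β i) W₀

/-- The sum over all pairs of distinct indices of a nonnegative function bounds the part of the sum
which involves the index `o`. -/
lemma sum_pairs_ge {f : ι → ι → ℝ} (hf : ∀ p q, 0 ≤ f p q) (hsymm : ∀ p q, f p q = f q p) (o : ι) :
    2 * ∑ p ∈ Finset.univ.erase o, f o p ≤ ∑ p, ∑ q ∈ Finset.univ.erase p, f p q := by
  rw [← Finset.add_sum_erase _ _ (Finset.mem_univ o), two_mul]
  refine add_le_add le_rfl (Finset.sum_le_sum fun p hp => ?_)
  rw [hsymm]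
  exact Finset.single_le_sum (f := fun q => f p q) (fun q _ => hf p q)
    (by simpa using (Finset.ne_of_mem_erase hp).symm)

/-- The third order terms at a maximum of the largest curvature are bounded by the `o`-th gradient
term. -/
lemma third_order_bound {κ : ι → ℝ} (hκ : ∀ i, 0 < κ i) {o : ι} {m : ℕ} (hm : m + 2 ≤ Fintype.card ι)
    (hlarge : es Finset.univ κ (m + 2) * (4 * (Fintype.card ι : ℝ) ^ 2) ^ (m + 1) ≤ κ o ^ (m + 2))
    {T : ι → ι → ι → ℝ} (swap : ∀ i j l, T i j l = T j i l) (swap' : ∀ i j l, T i j l = T i l j)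
    (h1 : ∑ p, κ p ^ 2 * es (Finset.univ.erase p) κ (m + 1) * T p p o = 0) :
    κ o * (2 * ∑ p, ∑ q, es (Finset.univ.erase p) κ (m + 1) * κ p ^ 2 * κ q * (T p q o * T q p o) +
      ∑ p, ∑ q ∈ Finset.univ.erase p, es ((Finset.univ.erase p).erase q) κ m *
        (κ p ^ 2 * κ q ^ 2) * (T p p o * T q q o - T p q o * T q p o)) -
      2 * κ o * ∑ i, ∑ p ∈ Finset.univ.erase o, es (Finset.univ.erase i) κ (m + 1) * κ i ^ 2 *
        ((κ p + κ p ^ 2 * (κ o)⁻¹) * T o p i ^ 2) ≤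
    es (Finset.univ.erase o) κ (m + 1) * κ o ^ 2 * (κ o * T o o o) ^ 2 := by
  set S : ι → ℝ := fun p => es (Finset.univ.erase p) κ (m + 1) with hS
  have hSnn : ∀ p, 0 ≤ S p := fun p => es_nonneg (fun i _ => hκ i) _
  have hSS : ∀ p q, 0 ≤ es ((Finset.univ.erase p).erase q) κ m :=
    fun p q => es_nonneg (fun i _ => hκ i) _
  have hκo := hκ o
  -- the quadratic terms in the second derivatives of the equation
  have r1 : κ o * (2 * ∑ p, ∑ q, S p * κ p ^ 2 * κ q * (T p q o * T q p o)) =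
      2 * ∑ i, S i * κ i ^ 2 * (κ o * T o o i) ^ 2 +
      2 * κ o * ∑ i, ∑ p ∈ Finset.univ.erase o, S i * κ i ^ 2 * (κ p * T o p i ^ 2) := by
    simp only [Finset.mul_sum]
    rw [← Finset.sum_add_distrib]
    refine Finset.sum_congr rfl fun i _ => ?_
    rw [← Finset.add_sum_erase _ _ (Finset.mem_univ o)]
    congr 1
    · rw [swap o i o, swap' i o o, swap' o o i, swap o i o, swap' i o o]; ring
    · refine Finset.sum_congr rfl fun p _ => ?_
      rw [swap p i o, swap' i p o, swap i o p, swap' o i p]; ring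
  -- Of the part with weight `κ_p² / κ_o` only the indices `i = o` and `i = p` are kept: the first
  -- pays for `T_oop` in `r5`, the second for `T_ppo` in `r6`.
  have r2 : ∑ p ∈ Finset.univ.erase o, (S o * κ p ^ 2 * (κ o * T o o p) ^ 2 +
      S p * (κ p ^ 2 * T p p o) ^ 2) ≤
      κ o * ∑ i, ∑ p ∈ Finset.univ.erase o, S i * κ i ^ 2 * (κ p ^ 2 * (κ o)⁻¹ * T o p i ^ 2) := by
    rw [Finset.sum_comm, Finset.mul_sum]
    refine Finset.sum_le_sum fun p hp => ?_
    have hpo : p ∈ Finset.univ.erase o := hp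
    rw [← Finset.add_sum_erase _ _ (Finset.mem_univ o), ← Finset.add_sum_erase _ _ hpo, mul_add,
      mul_add]
    have e1 : κ o * (S o * κ o ^ 2 * (κ p ^ 2 * (κ o)⁻¹ * T o p o ^ 2)) =
        S o * κ p ^ 2 * (κ o * T o o p) ^ 2 := by
      rw [swap' o p o]; field_simp
    have e2 : κ o * (S p * κ p ^ 2 * (κ p ^ 2 * (κ o)⁻¹ * T o p p ^ 2)) =
        S p * (κ p ^ 2 * T p p o) ^ 2 := by
      rw [swap o p p, swap' p o p]; field_simp
    have e3 : 0 ≤ κ o * ∑ i ∈ (Finset.univ.erase o).erase p,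
        S i * κ i ^ 2 * (κ p ^ 2 * (κ o)⁻¹ * T o p i ^ 2) := by
      refine mul_nonneg hκo.le (Finset.sum_nonneg fun i _ => ?_)
      have := hSnn i
      positivity
    rw [e1, e2]; linarith
  have r3 : ∑ p, ∑ q ∈ Finset.univ.erase p, es ((Finset.univ.erase p).erase q) κ m *
      (κ p ^ 2 * κ q ^ 2) * (T p p o * T q q o) =
      esDD Finset.univ κ (fun p => κ p ^ 2 * T p p o) (m + 2) := by
    simp only [esDD, esD, Finset.mul_sum]
    exact Finset.sum_congr rfl fun p _ => Finset.sum_congr rfl fun q _ => by ring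
  have r4 : 2 * ∑ p ∈ Finset.univ.erase o, es ((Finset.univ.erase o).erase p) κ m *
      (κ p ^ 2 * (κ o * T o o p) ^ 2) ≤
      ∑ p, ∑ q ∈ Finset.univ.erase p, es ((Finset.univ.erase p).erase q) κ m *
      (κ p ^ 2 * κ q ^ 2) * (T p q o * T q p o) := by
    have := sum_pairs_ge (f := fun p q => es ((Finset.univ.erase p).erase q) κ m *
      (κ p ^ 2 * κ q ^ 2) * (T p q o * T q p o)) (fun p q => by
        have := hSS p q
        rw [swap p q o]
        have := mul_self_nonneg (T q p o)
        positivity) (fun p q => by rw [Finset.erase_right_comm]; ring) o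
    refine le_trans (le_of_eq ?_) this
    congr 1
    refine Finset.sum_congr rfl fun p _ => ?_
    rw [swap p o o, swap' o p o]; ring
  have r5 : ∑ p ∈ Finset.univ.erase o, S p * κ p ^ 2 * (κ o * T o o p) ^ 2 ≤
      ∑ p ∈ Finset.univ.erase o, S o * κ p ^ 2 * (κ o * T o o p) ^ 2 +
      κ o * ∑ p ∈ Finset.univ.erase o, es ((Finset.univ.erase o).erase p) κ m *
        (κ p ^ 2 * (κ o * T o o p) ^ 2) := by
    rw [Finset.mul_sum, ← Finset.sum_add_distrib]
    refine Finset.sum_le_sum fun p hp => ?_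
    have hpo : o ∈ Finset.univ.erase p := by simpa using (Finset.ne_of_mem_erase hp).symm
    have e1 : S p = es ((Finset.univ.erase o).erase p) κ (m + 1) +
        κ o * es ((Finset.univ.erase o).erase p) κ m := by
      rw [Finset.erase_right_comm]; exact es_erase hpo κ m
    have e2 : S o = es ((Finset.univ.erase o).erase p) κ (m + 1) +
      κ p * es ((Finset.univ.erase o).erase p) κ m := es_erase hp κ m
    have e3 : S p ≤ S o + κ o * es ((Finset.univ.erase o).erase p) κ m := by
      have := mul_nonneg (hκ p).le (hSS o p)
      linarith
    have := mul_le_mul_of_nonneg_right e3 (by positivity : 0 ≤ κ p ^ 2 * (κ o * T o o p) ^ 2)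
    linarith
  -- The direction `κ_p² T_ppo` lies in the kernel of `Dσ_{m+2}` by the first order equation `h1`.
  -- The `o`-term gained here removes one of the two copies of the `T_ooo` term produced by `r1`.
  have r6 := es_hessian_bound (s := Finset.univ.erase o) (Finset.notMem_erase o _) hκo
    (fun i _ => hκ i) (m := m) (by
      rw [Finset.card_erase_of_mem (Finset.mem_univ o), Finset.card_univ]; omega) (by
      rw [Finset.insert_erase (Finset.mem_univ o), Finset.card_erase_of_mem (Finset.mem_univ o),
        Finset.card_univ, Nat.cast_sub (by omega)]
      simpa using hlarge) (fun p => κ p ^ 2 * T p p o) (by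
      rw [Finset.insert_erase (Finset.mem_univ o)]
      simp only [esD]
      rw [← h1]
      exact Finset.sum_congr rfl fun p _ => by ring)
  rw [Finset.insert_erase (Finset.mem_univ o)] at r6
  have e0 : ∑ i, S i * κ i ^ 2 * (κ o * T o o i) ^ 2 = S o * κ o ^ 2 * (κ o * T o o o) ^ 2 +
      ∑ p ∈ Finset.univ.erase o, S p * κ p ^ 2 * (κ o * T o o p) ^ 2 :=
    (Finset.add_sum_erase _ _ (Finset.mem_univ o)).symm
  have e1 : ∑ p, ∑ q ∈ Finset.univ.erase p, es ((Finset.univ.erase p).erase q) κ m *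
        (κ p ^ 2 * κ q ^ 2) * (T p p o * T q q o - T p q o * T q p o) =
      ∑ p, ∑ q ∈ Finset.univ.erase p, es ((Finset.univ.erase p).erase q) κ m *
        (κ p ^ 2 * κ q ^ 2) * (T p p o * T q q o) -
      ∑ p, ∑ q ∈ Finset.univ.erase p, es ((Finset.univ.erase p).erase q) κ m *
        (κ p ^ 2 * κ q ^ 2) * (T p q o * T q p o) := by
    simp only [mul_sub, Finset.sum_sub_distrib]
  have e2 : ∑ i, ∑ p ∈ Finset.univ.erase o, S i * κ i ^ 2 *
      ((κ p + κ p ^ 2 * (κ o)⁻¹) * T o p i ^ 2) =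
      ∑ i, ∑ p ∈ Finset.univ.erase o, S i * κ i ^ 2 * (κ p * T o p i ^ 2) +
      ∑ i, ∑ p ∈ Finset.univ.erase o, S i * κ i ^ 2 * (κ p ^ 2 * (κ o)⁻¹ * T o p i ^ 2) := by
    simp only [← Finset.sum_add_distrib]
    exact Finset.sum_congr rfl fun p _ => Finset.sum_congr rfl fun q _ => by ring
  rw [e1, e2, r3, mul_add, r1, e0]
  rw [Finset.sum_add_distrib] at r2
  have r4' := mul_le_mul_of_nonneg_left r4 hκo.le
  have e7 : S o * (κ o ^ 2 * T o o o) ^ 2 = S o * κ o ^ 2 * (κ o * T o o o) ^ 2 := by ring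
  have r6' : κ o * esDD Finset.univ κ (fun p => κ p ^ 2 * T p p o) (m + 2) +
      S o * (κ o ^ 2 * T o o o) ^ 2 ≤
      2 * ∑ p ∈ Finset.univ.erase o, S p * (κ p ^ 2 * T p p o) ^ 2 := r6
  rw [e7] at r6'
  linarith

end SigmaK

/-! ### The curvature bound at a maximum point -/

namespace SigmaK

variable {ι : Type*} [DecidableEq ι] [Fintype ι]

lemma es_erase_mul_le {κ : ι → ℝ} (hκ : ∀ i, 0 < κ i) (o : ι) (m : ℕ) :
    es (Finset.univ.erase o) κ m * κ o ≤ es Finset.univ κ (m + 1) := by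
  have h1 := es_erase (Finset.mem_univ o) κ m
  have h2 := es_nonneg (s := Finset.univ.erase o) (fun i _ => hκ i) (m + 1)
  linarith

lemma sum_es_erase_mul (κ : ι → ℝ) (m : ℕ) :
    ∑ i, es (Finset.univ.erase i) κ m * κ i = (m + 1) * es Finset.univ κ (m + 1) := by
  rw [← sum_mul_es_erase]
  exact Finset.sum_congr rfl fun i _ => mul_comm _ _

/-- Among the summands `σ_m(κ|i) κ_i`, whose total is `(m + 1) σ_{m+1}`, the one for the largest
`κ_i` is the largest. -/
lemma le_card_mul_es_erase {κ : ι → ℝ} (hκ : ∀ i, 0 < κ i) {o : ι} (ho : ∀ i, κ i ≤ κ o) (m : ℕ) :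
    (m + 1) * es Finset.univ κ (m + 1) ≤
      Fintype.card ι * (es (Finset.univ.erase o) κ m * κ o) := by
  rw [← sum_es_erase_mul, ← Finset.card_univ, ← nsmul_eq_mul]
  refine Finset.sum_le_card_nsmul _ _ _ fun i _ => ?_
  by_cases hio : i = o
  · rw [hio]
  · cases m with
    | zero => simpa using ho i
    | succ m =>
      have h1 : o ∈ Finset.univ.erase i := by simpa using Ne.symm hio
      have h2 : i ∈ Finset.univ.erase o := by simpa using hio
      rw [es_erase h1, es_erase h2, Finset.erase_right_comm]
      have h3 := es_nonneg (s := (Finset.univ.erase o).erase i) (fun i _ => hκ i) (m + 1)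
      have h4 := mul_le_mul_of_nonneg_left (ho i) h3
      linarith

namespace IsAdaptedChart

variable {κ : ι → ℝ} {T : ι → ι → ι → ℝ} {q : ι → ι → ℝ} {β : ι → ℝ} {u₀ W₀ : ℝ}
  {A : ι → ℝ → Matrix ι ι ℝ} {A2 : ι → Matrix ι ι ℝ} {U W : ι → ℝ → ℝ}

lemma sq_le (h : IsAdaptedChart κ T q β u₀ W₀ A A2 U W) (i : ι) : β i ^ 2 ≤ W₀ ^ 2 := by
  rw [h.sq]
  have := Finset.single_le_sum (f := fun i => β i ^ 2) (fun i _ => sq_nonneg (β i)) (Finset.mem_univ i)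
  linarith

lemma one_le (h : IsAdaptedChart κ T q β u₀ W₀ A A2 U W) : 1 ≤ W₀ := by
  have h1 : 0 ≤ ∑ i, β i ^ 2 := Finset.sum_nonneg fun i _ => sq_nonneg (β i)
  have h2 := h.sq
  have h3 := h.W_pos
  nlinarith

/-- The differentiated equation, contracted with the gradient of the height function. -/
lemma sum_gradient (h : IsAdaptedChart κ T q β u₀ W₀ A A2 U W) {m : ℕ}
    (heq : ∀ i, ∀ᶠ t in 𝓝 (0 : ℝ), SatisfiesEq (m + 1) (es Finset.univ κ (m + 1)) (A i t)) :
    ∑ i, es (Finset.univ.erase i) κ m * κ i ^ 2 * ∑ j, β j * T i i j = 0 := by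
  simp only [Finset.mul_sum]
  rw [Finset.sum_comm]
  refine Finset.sum_eq_zero fun j _ => ?_
  have h1 := equation_first h.pos (h.A_jet j) (h.A_zero j) (heq j)
  have : ∑ i, es (Finset.univ.erase i) κ m * κ i ^ 2 * (β j * T i i j) =
      β j * ∑ p, κ p ^ 2 * es (Finset.univ.erase p) κ m * T p p j := by
    rw [Finset.mul_sum]
    exact Finset.sum_congr rfl fun p _ => by ring
  rw [this, h1, mul_zero]

/-- The inequality obtained from the maximum principle in the `i`-th direction. -/
lemma direction_inequality (h : IsAdaptedChart κ T q β u₀ W₀ A A2 U W) {o : ι} {s N : ℝ} (hs : u₀ < s)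
    (hN : 0 ≤ N) (i : ι)
    (hmax : ∀ᶠ t in 𝓝 (0 : ℝ), ∀ v : ι → ℝ, (s - U i t) * Real.exp (N * W i t) * ∑ a, v a ^ 2 ≤
      (s - u₀) * Real.exp (N * W₀) * κ o * ∑ a, ∑ b, A i t a b * (v a * v b)) :
    -(W₀ * (κ i)⁻¹) + ∑ j, β j * T i i j + (s - u₀) * (N * W₀) - 2 * N * (β i ^ 2 * (κ i)⁻¹) +
      (if i = o then (s - u₀) * (κ o * T o o o) ^ 2 - β o ^ 2 * (κ o)⁻¹ ^ 2 * (s - u₀)⁻¹ else 0) ≤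
    (s - u₀) * (κ o * q i o - (1 + if i = o then 2 else 0) -
      2 * κ o * ∑ p ∈ Finset.univ.erase o, ((κ p + κ p ^ 2 * (κ o)⁻¹) * T o p i ^ 2)) := by
  have hσ : 0 < s - u₀ := sub_pos.2 hs
  set σ := s - u₀ with hσd
  -- The optimal variation would have denominator `κ_a⁻¹ - κ_o⁻¹`, which vanishes at a repeated
  -- largest curvature. Dropping `κ_o⁻¹` avoids this; the normalization of the test vector then
  -- contributes the term `κ_p² / κ_o`.
  set c : ι → ℝ := fun a => if a = o then 0 else -(κ a * T o a i) with hc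
  have hκo := h.pos o
  obtain ⟨h1, h2⟩ := test_function_jets c (by simp [hc]) h.pos (h.A_jet i) (h.A_zero i)
    (fun a b => h.swap a b i) (h.U_jet i) (h.W_jet i) (s := s) (N := N) (o := o)
    (by simpa only [h.U_zero, h.W_zero] using hmax)
  rw [h.U_zero, ← hσd] at h1 h2
  rw [h.A2_diag] at h2
  have e1 : ∀ g : ι → ℝ, (∑ a, (if a = o then 0 else g a)) = ∑ a ∈ Finset.univ.erase o, g a := by
    intro g
    rw [← Finset.add_sum_erase _ _ (Finset.mem_univ o)]
    simp only [if_true, zero_add]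
    exact Finset.sum_congr rfl fun a ha => if_neg (Finset.ne_of_mem_erase ha)
  have e2 : ∑ a, c a * T o a i = -∑ p ∈ Finset.univ.erase o, κ p * T o p i ^ 2 := by
    rw [← Finset.sum_neg_distrib, ← e1]
    refine Finset.sum_congr rfl fun a _ => ?_
    simp only [hc]; split_ifs <;> ring
  have e3 : ∑ a, (κ a)⁻¹ * c a ^ 2 = ∑ p ∈ Finset.univ.erase o, κ p * T o p i ^ 2 := by
    rw [← e1]
    refine Finset.sum_congr rfl fun a _ => ?_
    have := h.pos a
    simp only [hc]; split_ifs
    · ring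
    · field_simp
  have e4 : ∑ a, c a ^ 2 = κ o * ∑ p ∈ Finset.univ.erase o, κ p ^ 2 * (κ o)⁻¹ * T o p i ^ 2 := by
    rw [Finset.mul_sum, ← e1]
    refine Finset.sum_congr rfl fun a _ => ?_
    simp only [hc]; split_ifs
    · ring
    · field_simp
  have e5 : ∑ p ∈ Finset.univ.erase o, ((κ p + κ p ^ 2 * (κ o)⁻¹) * T o p i ^ 2) =
      ∑ p ∈ Finset.univ.erase o, κ p * T o p i ^ 2 +
      ∑ p ∈ Finset.univ.erase o, κ p ^ 2 * (κ o)⁻¹ * T o p i ^ 2 := by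
    rw [← Finset.sum_add_distrib]
    exact Finset.sum_congr rfl fun p _ => by ring
  rw [e2, e3, e4, h.symm] at h2
  rw [e5]
  -- In direction `o` the critical point equation expresses `N β_o` through `κ_o T_ooo`, so the
  -- squared gradient of the exponential yields the term that absorbs the remainder of
  -- `third_order_bound`. In the other directions this square is dropped.
  have e6 : (if i = o then σ * (κ o * T o o o) ^ 2 - β o ^ 2 * (κ o)⁻¹ ^ 2 * σ⁻¹ else 0) ≤
      σ * (N * β i) ^ 2 := by
    split_ifs with hio
    · subst hio
      have e7 : κ i * T i i i = β i * (κ i)⁻¹ * σ⁻¹ - N * β i := by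
        field_simp
        field_simp at h1
        linarith
      have e8 : 0 ≤ 2 * N * (β i ^ 2 * (κ i)⁻¹) := by positivity
      rw [e7]
      have e9 : σ * (β i * (κ i)⁻¹ * σ⁻¹ - N * β i) ^ 2 - β i ^ 2 * (κ i)⁻¹ ^ 2 * σ⁻¹ =
        σ * (N * β i) ^ 2 - 2 * N * (β i ^ 2 * (κ i)⁻¹) := by field_simp; ring
      rw [e9]; linarith
    · positivity
  have e10 : κ o * ((1 + if o = i then 2 else 0) * (κ o)⁻¹) = 1 + if i = o then 2 else 0 := by
    rw [mul_left_comm, mul_inv_cancel₀ hκo.ne', mul_one]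
    simp only [eq_comm]
  have e11 : κ o * (q i o - (1 + if o = i then 2 else 0) * (κ o)⁻¹) =
      κ o * q i o - (1 + if i = o then 2 else 0) := by rw [mul_sub, e10]
  have e12 : σ * κ o * (q i o - (1 + if o = i then 2 else 0) * (κ o)⁻¹) =
      σ * (κ o * q i o - (1 + if i = o then 2 else 0)) := by rw [mul_assoc, e11]
  generalize (if i = o then σ * (κ o * T o o o) ^ 2 - β o ^ 2 * (κ o)⁻¹ ^ 2 * σ⁻¹ else 0) = Z at *
  generalize (1 + if i = o then (2 : ℝ) else 0) = Z2 at *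
  generalize (1 + if o = i then (2 : ℝ) else 0) = Z3 at *
  linarith

/-- The curvature bound at a maximum point of the test function, if the largest curvature is large. -/
theorem curvature_bound (h : IsAdaptedChart κ T q β u₀ W₀ A A2 U W) {m : ℕ}
    (hm : m + 2 ≤ Fintype.card ι) {o : ι} (ho : ∀ i, κ i ≤ κ o)
    (hlarge : es Finset.univ κ (m + 2) * (4 * (Fintype.card ι : ℝ) ^ 2) ^ (m + 1) ≤ κ o ^ (m + 2))
    (heq : ∀ i, ∀ᶠ t in 𝓝 (0 : ℝ), SatisfiesEq (m + 2) (es Finset.univ κ (m + 2)) (A i t))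
    {s M : ℝ} (hs : u₀ < s) (hM : W₀ ≤ M)
    (hmax : ∀ i, ∀ᶠ t in 𝓝 (0 : ℝ), ∀ v : ι → ℝ,
      (s - U i t) * Real.exp (Fintype.card ι * W i t) * ∑ a, v a ^ 2 ≤
      (s - u₀) * Real.exp (Fintype.card ι * W₀) * κ o * ∑ a, ∑ b, A i t a b * (v a * v b)) :
    (s - u₀) * κ o ≤ 1 + Fintype.card ι * (M + 2 * Fintype.card ι * M ^ 2) + Fintype.card ι * M ^ 2 := by
  have hσ : 0 < s - u₀ := sub_pos.2 hs
  have hn : (2 : ℝ) ≤ Fintype.card ι := by exact_mod_cast (by omega : 2 ≤ Fintype.card ι)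
  have hdir := fun i => h.direction_inequality hs (by linarith : (0 : ℝ) ≤ Fintype.card ι) i (hmax i)
  have hfirst := equation_first h.pos (h.A_jet o) (h.A_zero o) (heq o)
  have hthird := third_order_bound h.pos hm hlarge h.swap h.swap' hfirst
  have hsecond := equation_second h.pos (h.A_jet o) (h.A_zero o) (heq o)
  have hgrad := h.sum_gradient heq
  have hb := es_pos (s := Finset.univ) (x := κ) (j := m + 2) (fun i _ => h.pos i) hm
  have hsum := sum_es_erase_mul κ (m + 1)
  have hSlow := le_card_mul_es_erase h.pos ho (m + 1)
  have hSup := es_erase_mul_le h.pos o (m + 1)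
  have hW1 := h.one_le
  have hβ := h.sq_le
  have hκo := h.pos o
  push_cast at hsum hSlow
  set n : ℝ := (Fintype.card ι : ℝ)
  set b := es Finset.univ κ (m + 2)
  set σ := s - u₀
  set S : ι → ℝ := fun p => es (Finset.univ.erase p) κ (m + 1) with hS
  have hSnn : ∀ p, 0 ≤ S p := fun p => es_nonneg (fun i _ => h.pos i) _
  set R := 2 * ∑ p, ∑ q, S p * κ p ^ 2 * κ q * (T p q o * T q p o) +
      ∑ p, ∑ q ∈ Finset.univ.erase p, es ((Finset.univ.erase p).erase q) κ m *
        (κ p ^ 2 * κ q ^ 2) * (T p p o * T q q o - T p q o * T q p o)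
  have hsum' : ∑ i, S i * κ i ^ 2 * (κ i)⁻¹ = (m + 1 + 1) * b := by
    rw [← hsum]
    refine Finset.sum_congr rfl fun i _ => ?_
    have := h.pos i
    simp only [hS]; field_simp
  -- the second derivative of the equation
  have hsec : κ o * ∑ i, S i * κ i ^ 2 * q i o = κ o * R + κ o * ((m + 1 + 1) * b) +
      2 * (S o * κ o ^ 2) := by
    have e1 : ∑ p, κ p ^ 2 * S p * A2 o p p = ∑ i, S i * κ i ^ 2 * q i o -
        ∑ i, S i * κ i ^ 2 * (κ i)⁻¹ - 2 * (S o * κ o) := by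
      have e2 : 2 * (S o * κ o) = ∑ i, if i = o then 2 * (S o * κ o) else 0 := by simp
      rw [e2, ← Finset.sum_sub_distrib, ← Finset.sum_sub_distrib]
      refine Finset.sum_congr rfl fun i _ => ?_
      have := h.pos i
      rw [h.A2_diag]
      split_ifs with hio
      · subst hio; field_simp; ring
      · ring
    have e3 : ∑ p, κ p ^ 2 * S p * A2 o p p = R := hsecond
    rw [e1, hsum'] at e3
    have : ∑ i, S i * κ i ^ 2 * q i o = R + (m + 1 + 1) * b + 2 * (S o * κ o) := by linarith
    rw [this]; ring
  -- sum of the inequalities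
  have key := Finset.sum_le_sum fun i (_ : i ∈ Finset.univ) =>
    mul_le_mul_of_nonneg_left (hdir i) (mul_nonneg (hSnn i) (sq_nonneg (κ i)))
  set Zo := σ * (κ o * T o o o) ^ 2 - β o ^ 2 * (κ o)⁻¹ ^ 2 * σ⁻¹
  have kl : ∑ i, S i * κ i ^ 2 * (-(W₀ * (κ i)⁻¹) + ∑ j, β j * T i i j + σ * (n * W₀) -
      2 * n * (β i ^ 2 * (κ i)⁻¹) + (if i = o then Zo else 0)) =
      -W₀ * ((m + 1 + 1) * b) + σ * (n * W₀) * ∑ i, S i * κ i ^ 2 -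
      2 * n * ∑ i, S i * κ i ^ 2 * (κ i)⁻¹ * β i ^ 2 + S o * κ o ^ 2 * Zo := by
    have e2 : S o * κ o ^ 2 * Zo = ∑ i, if i = o then S o * κ o ^ 2 * Zo else 0 := by simp
    have hgrad' : ∑ i, S i * κ i ^ 2 * ∑ j, β j * T i i j = 0 := hgrad
    refine Eq.trans ?_ (add_zero _)
    conv_rhs => rw [← hgrad']
    rw [← hsum', e2, Finset.mul_sum, Finset.mul_sum, Finset.mul_sum, ← Finset.sum_add_distrib,
      ← Finset.sum_sub_distrib, ← Finset.sum_add_distrib, ← Finset.sum_add_distrib]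
    refine Finset.sum_congr rfl fun i _ => ?_
    split_ifs with hio
    · subst hio; ring
    · ring
  have kr : ∑ i, S i * κ i ^ 2 * (σ * (κ o * q i o - (1 + if i = o then 2 else 0) -
      2 * κ o * ∑ p ∈ Finset.univ.erase o, ((κ p + κ p ^ 2 * (κ o)⁻¹) * T o p i ^ 2))) =
      σ * (κ o * ∑ i, S i * κ i ^ 2 * q i o - ∑ i, S i * κ i ^ 2 - 2 * (S o * κ o ^ 2) -
      2 * κ o * ∑ i, ∑ p ∈ Finset.univ.erase o, S i * κ i ^ 2 *
        ((κ p + κ p ^ 2 * (κ o)⁻¹) * T o p i ^ 2)) := by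
    have e2 : 2 * (S o * κ o ^ 2) = ∑ i, if i = o then 2 * (S o * κ o ^ 2) else 0 := by simp
    simp only [← Finset.mul_sum]
    rw [e2, Finset.mul_sum, Finset.mul_sum, ← Finset.sum_sub_distrib, ← Finset.sum_sub_distrib,
      ← Finset.sum_sub_distrib, Finset.mul_sum]
    refine Finset.sum_congr rfl fun i _ => ?_
    split_ifs with hio
    · subst hio; ring
    · ring
  rw [kl, kr, hsec] at key
  have hthird' : κ o * R - 2 * κ o * ∑ i, ∑ p ∈ Finset.univ.erase o, S i * κ i ^ 2 *
        ((κ p + κ p ^ 2 * (κ o)⁻¹) * T o p i ^ 2) ≤ S o * κ o ^ 2 * (κ o * T o o o) ^ 2 := hthird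
  have hβsum : ∑ i, S i * κ i ^ 2 * (κ i)⁻¹ * β i ^ 2 ≤ (m + 1 + 1) * b * M ^ 2 := by
    rw [← hsum', Finset.sum_mul]
    refine Finset.sum_le_sum fun i _ => ?_
    have h1 := hβ i
    have h2 : W₀ ^ 2 ≤ M ^ 2 := by gcongr
    have h3 := h.pos i
    have h4 := hSnn i
    exact mul_le_mul_of_nonneg_left (h1.trans h2) (by positivity)
  have hSa : S o * κ o ^ 2 ≤ ∑ i, S i * κ i ^ 2 :=
    Finset.single_le_sum (f := fun i => S i * κ i ^ 2) (fun i _ => mul_nonneg (hSnn i) (sq_nonneg _))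
      (Finset.mem_univ o)
  have hthird'' := mul_le_mul_of_nonneg_left hthird' hσ.le
  have hZo : S o * κ o ^ 2 * Zo = σ * (S o * κ o ^ 2 * (κ o * T o o o) ^ 2) -
      S o * β o ^ 2 * σ⁻¹ := by
    simp only [Zo]; field_simp
  rw [hZo] at key
  set Y := ∑ i, S i * κ i ^ 2
  set k : ℝ := (m : ℝ) + 1 + 1 with hk
  have hk1 : 1 ≤ k := by simp only [hk]; linarith [(Nat.cast_nonneg m : (0 : ℝ) ≤ m)]
  have main : σ * ((1 + n * W₀) * Y) ≤ σ * (κ o * (k * b)) + W₀ * (k * b) +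
      2 * n * (k * b * M ^ 2) + S o * β o ^ 2 * σ⁻¹ := by
    have : 2 * n * ∑ i, S i * κ i ^ 2 * (κ i)⁻¹ * β i ^ 2 ≤ 2 * n * (k * b * M ^ 2) := by gcongr
    linarith
  have hSo : n * (S o * κ o) ≥ k * b := hSlow
  have hSo' : S o * κ o ≤ b := hSup
  -- This is why the exponent of the test function is `n`: after multiplication by `n`, the good
  -- term in `main` is at least `n + 1` copies of `σ κ_o k b`, against `n` copies on the right.
  have low : κ o * (k * b) * (1 + n) ≤ n * ((1 + n * W₀) * Y) := by
    have h1 : S o * κ o ^ 2 * (1 + n) ≤ (1 + n * W₀) * Y := by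
      rw [mul_comm]
      have h2 : 1 + n ≤ 1 + n * W₀ := by
        have := mul_le_mul_of_nonneg_left hW1 (by linarith : (0 : ℝ) ≤ n)
        linarith
      have := hSnn o
      gcongr
    calc κ o * (k * b) * (1 + n) ≤ κ o * (n * (S o * κ o)) * (1 + n) := by gcongr
      _ = n * (S o * κ o ^ 2 * (1 + n)) := by ring
      _ ≤ _ := by gcongr
  have hβo : β o ^ 2 ≤ M ^ 2 := (hβ o).trans (by gcongr)
  have up : S o * β o ^ 2 * σ⁻¹ * (σ * κ o) ≤ b * M ^ 2 := by
    calc S o * β o ^ 2 * σ⁻¹ * (σ * κ o) = (S o * κ o) * β o ^ 2 := by field_simp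
      _ ≤ b * M ^ 2 := by gcongr
  -- the quadratic inequality for `y = σ κ_o`
  have quad : k * (σ * κ o) ^ 2 ≤ n * (k * (M + 2 * n * M ^ 2)) * (σ * κ o) + n * M ^ 2 := by
    have h1 : σ * (κ o * (k * b)) ≤ n * (M * (k * b) + 2 * n * (k * b * M ^ 2) +
        S o * β o ^ 2 * σ⁻¹) := by
      have h2 := mul_le_mul_of_nonneg_left low hσ.le
      have h3 := mul_le_mul_of_nonneg_left main (by linarith : (0 : ℝ) ≤ n)
      have h4 : W₀ * (k * b) ≤ M * (k * b) := by gcongr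
      have h5 := mul_le_mul_of_nonneg_left h4 (by linarith : (0 : ℝ) ≤ n)
      linarith
    have h2 := mul_le_mul_of_nonneg_right h1 (by positivity : 0 ≤ σ * κ o)
    have h3 := mul_le_mul_of_nonneg_left up (by linarith : (0 : ℝ) ≤ n)
    refine le_of_mul_le_mul_left ?_ hb
    linarith
  set y := σ * κ o
  by_contra! hy
  have hM0 : 0 < M := by linarith
  have hy1 : 1 ≤ y := by
    have : 0 ≤ n * (M + 2 * n * M ^ 2) + n * M ^ 2 := by positivity
    linarith
  have h1 : k * y * (1 + n * (M + 2 * n * M ^ 2) + n * M ^ 2) ≤ k * y * y := by gcongr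
  have h2 : n * M ^ 2 * 1 ≤ n * M ^ 2 * (k * y) := by
    gcongr
    exact one_le_mul_of_one_le_of_one_le hk1 hy1
  have h3 : 0 < k * y := by positivity
  linarith

end IsAdaptedChart

end SigmaK

/-! ### The height bound at a maximum point -/

namespace SigmaK

section Height

variable {ι : Type*} [DecidableEq ι] [Fintype ι]
  {κ : ι → ℝ} {T : ι → ι → ι → ℝ} {q : ι → ι → ℝ} {β : ι → ℝ} {u₀ W₀ : ℝ}
  {A : ι → ℝ → Matrix ι ι ℝ} {A2 : ι → Matrix ι ι ℝ} {U W : ι → ℝ → ℝ}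

/-- The bound at a maximum point of the height function times an exponential of the Lorentz factor. -/
theorem IsAdaptedChart.height_bound (h : IsAdaptedChart κ T q β u₀ W₀ A A2 U W) {m : ℕ}
    (hm : m + 1 ≤ Fintype.card ι) {o : ι} (ho : ∀ i, κ i ≤ κ o)
    (heq : ∀ i, ∀ᶠ t in 𝓝 (0 : ℝ), SatisfiesEq (m + 1) (es Finset.univ κ (m + 1)) (A i t))
    {s M : ℝ} (hs : u₀ < s) (hM : W₀ ≤ M)
    (hmax : ∀ i, ∀ᶠ t in 𝓝 (0 : ℝ), (s - U i t) * Real.exp (1 / (2 * M) * W i t) ≤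
      (s - u₀) * Real.exp (1 / (2 * M) * W₀)) :
    (s - u₀) * κ o ≤ 4 * Fintype.card ι * M := by
  have hσ : 0 < s - u₀ := sub_pos.2 hs
  have hW1 := h.one_le
  have hM0 : 0 < M := by linarith
  set N := 1 / (2 * M) with hN
  have hN0 : 0 < N := by positivity
  have hNW : N * W₀ ≤ 1 / 2 := by
    rw [hN, one_div, inv_mul_le_iff₀ (by positivity)]; linarith
  have hb := es_pos (s := Finset.univ) (x := κ) (j := m + 1) (fun i _ => h.pos i) hm
  have hsum := sum_es_erase_mul κ m
  have hgrad := h.sum_gradient heq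
  have hSlow := le_card_mul_es_erase h.pos ho m
  set σ := s - u₀ with hσd
  have hdir : ∀ i, σ * (N * W₀) / 2 ≤ W₀ * (κ i)⁻¹ - ∑ j, β j * T i i j := by
    intro i
    have hj : HasJet (fun t => (s - U i t) * Real.exp (N * W i t)) _ _ :=
      ((hasJet_const s).sub (h.U_jet i)).mul ((h.W_jet i).const_mul N).exp
    have hmx : IsLocalMax (fun t => (s - U i t) * Real.exp (N * W i t)) 0 := by
      filter_upwards [hmax i] with t ht
      simpa only [h.U_zero, h.W_zero] using ht
    obtain ⟨h1, h2⟩ := hj.of_isLocalMax hmx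
    rw [h.U_zero, h.W_zero, ← hσd] at h1 h2
    set X := Real.exp (N * W₀)
    have hX : 0 < X := Real.exp_pos _
    -- By the critical point equation the cross term equals `-2σ(Nβ_i)²`, so the square of the
    -- gradient enters with a negative sign. Since `N W₀ ≤ 1/2`, it costs at most half of the good
    -- term `σ N W₀`.
    have h1' : β i * (κ i)⁻¹ = σ * N * β i := by
      have : X * (β i * (κ i)⁻¹) = X * (σ * N * β i) := by linarith
      exact mul_left_cancel₀ hX.ne' this
    have h2' : -(W₀ * (κ i)⁻¹ - ∑ j, β j * T i i j) - 2 * (β i * (κ i)⁻¹) * (N * β i) +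
        σ * (N * W₀ + (N * β i) ^ 2) ≤ 0 := by
      refine nonpos_of_mul_nonpos_right ?_ hX
      linarith
    rw [h1'] at h2'
    have h3 : (N * β i) ^ 2 ≤ N * W₀ / 2 := by
      have : N ^ 2 * β i ^ 2 ≤ N ^ 2 * W₀ ^ 2 :=
        mul_le_mul_of_nonneg_left (h.sq_le i) (by positivity)
      have h4 : N * W₀ * (N * W₀) ≤ N * W₀ * (1 / 2) := by gcongr
      linarith
    have h5 := mul_le_mul_of_nonneg_left h3 hσ.le
    linarith
  have key := Finset.sum_le_sum fun i (_ : i ∈ Finset.univ) =>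
    mul_le_mul_of_nonneg_left (hdir i) (mul_nonneg
      (es_nonneg (s := Finset.univ.erase i) (fun i _ => h.pos i) m) (sq_nonneg (κ i)))
  have kr : ∑ i, es (Finset.univ.erase i) κ m * κ i ^ 2 * (W₀ * (κ i)⁻¹ - ∑ j, β j * T i i j) =
      W₀ * ((m + 1) * es Finset.univ κ (m + 1)) := by
    simp only [mul_sub, Finset.sum_sub_distrib]
    rw [hgrad, sub_zero, ← hsum, Finset.mul_sum]
    refine Finset.sum_congr rfl fun i _ => ?_
    have := h.pos i
    field_simp
  rw [kr, ← Finset.sum_mul] at key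
  have hκo := h.pos o
  have hSa : es (Finset.univ.erase o) κ m * κ o ^ 2 ≤ ∑ i, es (Finset.univ.erase i) κ m * κ i ^ 2 :=
    Finset.single_le_sum (f := fun i => es (Finset.univ.erase i) κ m * κ i ^ 2)
      (fun i _ => mul_nonneg (es_nonneg (fun i _ => h.pos i) _) (sq_nonneg _)) (Finset.mem_univ o)
  set b := es Finset.univ κ (m + 1)
  have hkb : 0 < ((m : ℝ) + 1) * b := by positivity
  set n : ℝ := (Fintype.card ι : ℝ)
  have hn : 0 ≤ n := by positivity
  have e1 : ((m : ℝ) + 1) * b * κ o * (σ * (N * W₀) / 2) ≤ n * (W₀ * ((m + 1) * b)) := by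
    calc ((m : ℝ) + 1) * b * κ o * (σ * (N * W₀) / 2)
        ≤ n * (es (Finset.univ.erase o) κ m * κ o) * κ o * (σ * (N * W₀) / 2) := by gcongr
      _ = n * (es (Finset.univ.erase o) κ m * κ o ^ 2 * (σ * (N * W₀) / 2)) := by ring
      _ ≤ n * ((∑ i, es (Finset.univ.erase i) κ m * κ i ^ 2) * (σ * (N * W₀) / 2)) := by gcongr
      _ ≤ _ := by gcongr
  have e2 : ((m : ℝ) + 1) * b * W₀ * (σ * κ o) ≤ ((m : ℝ) + 1) * b * W₀ * (4 * n * M) := by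
    have : σ * κ o = 4 * M * (κ o * (σ * N / 2)) := by rw [hN]; field_simp; ring
    rw [this]
    have := mul_le_mul_of_nonneg_left e1 (by positivity : 0 ≤ 4 * M)
    linarith
  exact le_of_mul_le_mul_left e2 (by positivity)

/-- Applied with `c` the largest curvature and `σ_k = n.choose k`, this forces the largest curvature
to be at least one. -/
lemma es_le_pow_mul_choose {s : Finset ι} {κ : ι → ℝ} (hκ : ∀ i, 0 < κ i) {c : ℝ}
    (hc : ∀ i ∈ s, κ i ≤ c) (hc0 : 0 ≤ c) (j : ℕ) : es s κ j ≤ c ^ j * (s.card.choose j : ℝ) := by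
  induction s using Finset.induction_on generalizing j with
  | empty => cases j <;> simp
  | insert a s ha ih =>
    have ih := ih fun i hi => hc i (Finset.mem_insert_of_mem hi)
    cases j with
    | zero => simp
    | succ j =>
      rw [es_insert ha, Finset.card_insert_of_notMem ha, Nat.choose_succ_succ]
      have h1 := ih (j + 1)
      have h2 := ih j
      have h3 : κ a * es s κ j ≤ c * (c ^ j * (s.card.choose j : ℝ)) :=
        mul_le_mul (hc a (Finset.mem_insert_self a s)) h2 (es_nonneg (fun i _ => hκ i) j) hc0
      push_cast
      calc _ ≤ c ^ (j + 1) * (s.card.choose (j + 1) : ℝ) + c * (c ^ j * (s.card.choose j : ℝ)) :=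
            add_le_add h1 h3
        _ = _ := by ring

end Height

/-! ### Directional derivatives -/

section Directional

variable {F : Type*} [NormedAddCommGroup F] [NormedSpace ℝ F]

/-- The derivative of `g` in the direction `v`. -/
def dd (v : F) (g : F → ℝ) (y : F) : ℝ := fderiv ℝ g y v

variable {V : Set F} {g : F → ℝ}

lemma contDiffOn_dd (hV : IsOpen V) (hg : ContDiffOn ℝ (⊤ : ℕ∞) g V) (v : F) :
    ContDiffOn ℝ (⊤ : ℕ∞) (dd v g) V :=
  (hg.fderiv_of_isOpen hV (m := (⊤ : ℕ∞)) (by simp)).clm_apply contDiffOn_const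

lemma dd_congr (hV : IsOpen V) {g' : F → ℝ} (h : Set.EqOn g g' V) (v : F) :
    Set.EqOn (dd v g) (dd v g') V := fun y hy => by
  rw [dd, dd, (h.eventuallyEq_of_mem (hV.mem_nhds hy)).fderiv_eq]

lemma differentiableAt_of_mem (hV : IsOpen V) (hg : ContDiffOn ℝ (⊤ : ℕ∞) g V) {y : F} (hy : y ∈ V) :
    DifferentiableAt ℝ g y :=
  (hg.contDiffAt (hV.mem_nhds hy)).differentiableAt (by simp)

lemma dd_dd (hV : IsOpen V) (hg : ContDiffOn ℝ (⊤ : ℕ∞) g V) (v v' : F) {y : F} (hy : y ∈ V) :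
    dd v' (dd v g) y = fderiv ℝ (fderiv ℝ g) y v' v := by
  have h1 : DifferentiableAt ℝ (fderiv ℝ g) y :=
    ((hg.fderiv_of_isOpen hV (m := (⊤ : ℕ∞)) (by simp)).contDiffAt
      (hV.mem_nhds hy)).differentiableAt (by simp)
  have h2 := h1.hasFDerivAt.clm_apply (hasFDerivAt_const v y)
  have h3 : dd v g = fun y => (fderiv ℝ g y) v := rfl
  rw [h3, dd, h2.fderiv]
  simp

lemma dd_comm (hV : IsOpen V) (hg : ContDiffOn ℝ (⊤ : ℕ∞) g V) (v v' : F) :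
    Set.EqOn (dd v' (dd v g)) (dd v (dd v' g)) V := fun y hy => by
  rw [dd_dd hV hg v v' hy, dd_dd hV hg v' v hy]
  have := (hg.contDiffAt (hV.mem_nhds hy)).isSymmSndFDerivAt (by
    simp only [minSmoothness_of_isRCLikeNormedField]
    exact WithTop.coe_le_coe.2 (le_top : (2 : ℕ∞) ≤ ⊤))
  exact this v' v

lemma hasDerivAt_line (hV : IsOpen V) (hg : ContDiffOn ℝ (⊤ : ℕ∞) g V) (v : F) {t : ℝ}
    (ht : t • v ∈ V) : HasDerivAt (fun t : ℝ => g (t • v)) (dd v g (t • v)) t := by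
  have h1 := (differentiableAt_of_mem hV hg ht).hasFDerivAt
  have h2 : HasDerivAt (fun t : ℝ => t • v) v t := by
    simpa using (hasDerivAt_id t).smul_const v
  exact h1.comp_hasDerivAt t h2

lemma eventually_line_mem (hV : IsOpen V) (h0 : (0 : F) ∈ V) (v : F) :
    ∀ᶠ t in 𝓝 (0 : ℝ), t • v ∈ V := by
  have hc : ContinuousAt (fun t : ℝ => t • v) 0 := by fun_prop
  exact hc.eventually_mem (hV.mem_nhds (by simpa using h0))

lemma hasJet_line (hV : IsOpen V) (h0 : (0 : F) ∈ V) (hg : ContDiffOn ℝ (⊤ : ℕ∞) g V) (v : F) :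
    HasJet (fun t : ℝ => g (t • v)) (dd v g 0) (dd v (dd v g) 0) := by
  refine ⟨fun t => dd v g (t • v), ?_, by simp, ?_⟩
  · filter_upwards [eventually_line_mem hV h0 v] with t ht using hasDerivAt_line hV hg v ht
  · have := hasDerivAt_line hV (contDiffOn_dd hV hg v) v (t := 0) (by simpa using h0)
    simpa using this

end Directional

/-! ### The matrices of the metric -/

section Gamma

variable {n : ℕ}

lemma w_sq {p : E n} (hp : ‖p‖ < 1) : w p ^ 2 = 1 - ‖p‖ ^ 2 :=
  Real.sq_sqrt (by nlinarith [norm_nonneg p])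

lemma w_pos {p : E n} (hp : ‖p‖ < 1) : 0 < w p := Real.sqrt_pos.2 (by nlinarith [norm_nonneg p])

lemma gammaStar_eq (p : E n) :
    gammaStar p = 1 - (1 + w p)⁻¹ • Matrix.vecMulVec (WithLp.ofLp p) (WithLp.ofLp p) := by
  ext i j
  simp [gammaStar, Matrix.one_apply, Matrix.vecMulVec_apply]
  ring

lemma gammaUp_eq (p : E n) :
    gammaUp p = 1 + (w p * (1 + w p))⁻¹ • Matrix.vecMulVec (WithLp.ofLp p) (WithLp.ofLp p) := by
  ext i j
  simp only [gammaUp, Matrix.one_apply, Matrix.vecMulVec_apply, Matrix.of_apply, Matrix.add_apply,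
    Matrix.smul_apply, smul_eq_mul]
  ring

lemma vecMulVec_self_mul_self (p : E n) :
    Matrix.vecMulVec (WithLp.ofLp p) (WithLp.ofLp p) * Matrix.vecMulVec (WithLp.ofLp p) (WithLp.ofLp p) =
      ‖p‖ ^ 2 • Matrix.vecMulVec (WithLp.ofLp p) (WithLp.ofLp p) := by
  rw [Matrix.vecMulVec_mul_vecMulVec]
  have : WithLp.ofLp p ⬝ᵥ WithLp.ofLp p = ‖p‖ ^ 2 := by
    rw [EuclideanSpace.real_norm_sq_eq]
    simp [dotProduct, sq]
  rw [this]
  ext i j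
  simp [Matrix.vecMulVec_apply]
  ring

/-- All the metric matrices are rank one perturbations of the identity by multiples of the same `p
pᵀ`, so their products reduce to scalar identities. -/
lemma one_add_smul_mul_one_add_smul {P : Matrix (Fin n) (Fin n) ℝ} {r : ℝ} (hP : P * P = r • P)
    (a b : ℝ) : (1 + a • P) * (1 + b • P) = 1 + (a + b + a * b * r) • P := by
  rw [add_mul, mul_add, mul_add, one_mul, one_mul, mul_one, smul_mul_smul_comm, hP, smul_smul]
  module

lemma gammaUp_mul_gammaStar {p : E n} (hp : ‖p‖ < 1) : gammaUp p * gammaStar p = 1 := by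
  have hw := w_pos hp
  rw [gammaUp_eq, gammaStar_eq, sub_eq_add_neg, ← neg_smul,
    one_add_smul_mul_one_add_smul (vecMulVec_self_mul_self p)]
  have : ‖p‖ ^ 2 = 1 - w p ^ 2 := by rw [w_sq hp]; ring
  rw [this]
  convert add_zero (1 : Matrix (Fin n) (Fin n) ℝ) using 2
  convert zero_smul ℝ _ using 2
  field_simp
  ring

lemma gammaStar_mul_gammaUp {p : E n} (hp : ‖p‖ < 1) : gammaStar p * gammaUp p = 1 :=
  mul_eq_one_comm.1 (gammaUp_mul_gammaStar hp)

lemma gammaUp_mul_self {p : E n} (hp : ‖p‖ < 1) :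
    gammaUp p * gammaUp p = 1 + (w p ^ 2)⁻¹ • Matrix.vecMulVec (WithLp.ofLp p) (WithLp.ofLp p) := by
  have hw := w_pos hp
  rw [gammaUp_eq, one_add_smul_mul_one_add_smul (vecMulVec_self_mul_self p)]
  have : ‖p‖ ^ 2 = 1 - w p ^ 2 := by rw [w_sq hp]; ring
  rw [this]
  congr 2
  field_simp
  ring

lemma gammaStar_transpose (p : E n) : (gammaStar p).transpose = gammaStar p := by
  ext i j
  simp [gammaStar, eq_comm, mul_comm]

lemma gammaUp_transpose (p : E n) : (gammaUp p).transpose = gammaUp p := by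
  ext i j
  simp [gammaUp, eq_comm, mul_comm]

lemma eq_sum_single (x : E n) : x = ∑ i, x i • EuclideanSpace.single i (1 : ℝ) := by
  ext j
  simp [Finset.sum_apply, Pi.single_apply]

lemma hessian_form (f : E n → ℝ) (ξ x y : E n) :
    ∑ i, ∑ j, x i * hessian f ξ i j * y j = fderiv ℝ (fderiv ℝ f) ξ x y := by
  conv_rhs => rw [eq_sum_single x, eq_sum_single y]
  simp only [map_sum, map_smul, _root_.sum_apply, _root_.smul_apply,
    smul_eq_mul, Finset.mul_sum, hessian, Matrix.of_apply]
  rw [Finset.sum_comm]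
  exact Finset.sum_congr rfl fun i _ => Finset.sum_congr rfl fun j _ => by ring

end Gamma

end SigmaK

namespace SigmaK

variable {n : ℕ}

/-! ### The chart obtained by a Lorentz boost -/

/-- The linear part of the boost which maps the origin to `ξ₀`. -/
def boostLin (ξ₀ y : E n) : E n := w ξ₀ • y + (inner ℝ ξ₀ y / (1 + w ξ₀)) • ξ₀

/-- The denominator of the boost. -/
def boostDen (ξ₀ y : E n) : ℝ := 1 + inner ℝ ξ₀ y

/-- The projective transformation of the unit ball which maps the origin to `ξ₀`. -/
def boost (ξ₀ y : E n) : E n := (boostDen ξ₀ y)⁻¹ • (ξ₀ + boostLin ξ₀ y)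

/-- The dual function in the coordinates of the boost. -/
def chartFun (f : E n → ℝ) (ξ₀ y : E n) : ℝ := boostDen ξ₀ y * (w ξ₀)⁻¹ * f (boost ξ₀ y)

/-- The domain of `chartFun`. -/
def chartDomain (D : Set (E n)) (ξ₀ : E n) : Set (E n) := {y | 0 < boostDen ξ₀ y} ∩ boost ξ₀ ⁻¹' D

/-- The derivative of the boost. -/
def boostDir (ξ₀ y b : E n) : E n :=
  (boostDen ξ₀ y)⁻¹ • (boostLin ξ₀ b - inner ℝ ξ₀ b • boost ξ₀ y)

/-- The height function of the graph of the Legendre transform, at the point with dual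
coordinate `ξ`. -/
def height (f : E n → ℝ) (ξ : E n) : ℝ := fderiv ℝ f ξ ξ - f ξ

section Boost

variable {ξ₀ : E n}

lemma inner_boostLin (h : ‖ξ₀‖ < 1) (a : E n) : inner ℝ ξ₀ (boostLin ξ₀ a) = inner ℝ ξ₀ a := by
  have hw := w_pos h
  have hn : ‖ξ₀‖ ^ 2 = 1 - w ξ₀ ^ 2 := by rw [w_sq h]; ring
  rw [boostLin, inner_add_right, inner_smul_right, inner_smul_right, real_inner_self_eq_norm_sq, hn]
  field_simp
  ring

/-- The Lorentz isometry property of the boost in affine coordinates; every metric identity for the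
chart comes from it. -/
lemma inner_boostLin_boostLin (h : ‖ξ₀‖ < 1) (a b : E n) :
    inner ℝ (boostLin ξ₀ a) (boostLin ξ₀ b) =
      w ξ₀ ^ 2 * inner ℝ a b + inner ℝ ξ₀ a * inner ℝ ξ₀ b := by
  have hw := w_pos h
  conv_lhs => rw [boostLin, inner_add_left, inner_smul_left, inner_smul_left, inner_boostLin h, boostLin,
    inner_add_right, inner_smul_right, inner_smul_right, real_inner_comm ξ₀ a]
  simp only [conj_trivial]
  field_simp
  ring

lemma boostLin_add (a b : E n) : boostLin ξ₀ (a + b) = boostLin ξ₀ a + boostLin ξ₀ b := by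
  simp only [boostLin, inner_add_right]
  module

lemma boostLin_smul (c : ℝ) (a : E n) : boostLin ξ₀ (c • a) = c • boostLin ξ₀ a := by
  simp only [boostLin, inner_smul_right]
  module

@[simp] lemma boostDen_zero : boostDen ξ₀ 0 = 1 := by simp [boostDen]

@[simp] lemma boost_zero : boost ξ₀ 0 = ξ₀ := by simp [boost, boostLin]

lemma contDiff_boostDen : ContDiff ℝ (⊤ : ℕ∞) (boostDen ξ₀) := by
  unfold boostDen
  exact contDiff_const.add (innerSL ℝ ξ₀).contDiff

lemma contDiff_boostLin : ContDiff ℝ (⊤ : ℕ∞) (boostLin ξ₀) := by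
  unfold boostLin
  have hi : ContDiff ℝ (⊤ : ℕ∞) (fun y : E n => (inner ℝ ξ₀ y : ℝ)) := (innerSL ℝ ξ₀).contDiff
  exact (contDiff_id.const_smul (w ξ₀)).add ((hi.div_const _).smul contDiff_const)

lemma contDiffOn_boost : ContDiffOn ℝ (⊤ : ℕ∞) (boost ξ₀) {y | 0 < boostDen ξ₀ y} := by
  unfold boost
  refine ContDiffOn.smul (contDiff_boostDen.contDiffOn.inv fun y hy => ne_of_gt hy) ?_
  exact (contDiff_const.add contDiff_boostLin).contDiffOn

lemma isOpen_chartDomain {D : Set (E n)} (hD : IsOpen D) : IsOpen (chartDomain D ξ₀) :=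
  contDiffOn_boost.continuousOn.isOpen_inter_preimage
    (isOpen_lt continuous_const contDiff_boostDen.continuous) hD

lemma zero_mem_chartDomain {D : Set (E n)} (h : ξ₀ ∈ D) : 0 ∈ chartDomain D ξ₀ := by
  simp [chartDomain, h]

lemma contDiffOn_chartFun {D : Set (E n)} {f : E n → ℝ} (hf : ContDiffOn ℝ (⊤ : ℕ∞) f D) :
    ContDiffOn ℝ (⊤ : ℕ∞) (chartFun f ξ₀) (chartDomain D ξ₀) := by
  unfold chartFun
  refine ContDiffOn.mul (contDiff_boostDen.mul contDiff_const).contDiffOn ?_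
  exact hf.comp (contDiffOn_boost.mono Set.inter_subset_left) Set.inter_subset_right

lemma hasDerivAt_boostDen (y b : E n) :
    HasDerivAt (fun τ : ℝ => boostDen ξ₀ (y + τ • b)) (inner ℝ ξ₀ b) 0 := by
  simp only [boostDen, inner_add_right, inner_smul_right]
  have := (((hasDerivAt_id (0 : ℝ)).mul_const (inner ℝ ξ₀ b)).const_add (inner ℝ ξ₀ y)).const_add 1
  simpa using this

lemma hasDerivAt_boost {y : E n} (hy : 0 < boostDen ξ₀ y) (b : E n) :
    HasDerivAt (fun τ : ℝ => boost ξ₀ (y + τ • b)) (boostDir ξ₀ y b) 0 := by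
  have h1 := (hasDerivAt_boostDen (ξ₀ := ξ₀) y b).fun_inv (by simpa using hy.ne')
  have h2 : HasDerivAt (fun τ : ℝ => ξ₀ + boostLin ξ₀ (y + τ • b)) (boostLin ξ₀ b) 0 := by
    simp only [boostLin_add, boostLin_smul]
    have := (((hasDerivAt_id (0 : ℝ)).smul_const (boostLin ξ₀ b)).const_add
      (boostLin ξ₀ y)).const_add ξ₀
    simpa using this
  have h3 := h1.smul h2
  refine h3.congr_deriv ?_
  simp only [zero_smul, add_zero, boostDir, boost]
  rw [smul_sub, smul_smul, smul_smul, sub_eq_add_neg, ← neg_smul]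
  congr 2
  field_simp

lemma dd_eq_of_hasDerivAt {g : E n → ℝ} {y b : E n} {a : ℝ} (hg : DifferentiableAt ℝ g y)
    (h : HasDerivAt (fun τ : ℝ => g (y + τ • b)) a 0) : dd b g y = a := by
  have h2 : HasDerivAt (fun τ : ℝ => y + τ • b) b 0 := by
    simpa using ((hasDerivAt_id (0 : ℝ)).smul_const b).const_add y
  have h1 : HasFDerivAt g (fderiv ℝ g y) (y + (0 : ℝ) • b) := by simpa using hg.hasFDerivAt
  exact (h1.comp_hasDerivAt (0 : ℝ) h2).unique h

variable {D : Set (E n)} {f : E n → ℝ}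

lemma dd_chartFun (hD : IsOpen D) (hf : ContDiffOn ℝ (⊤ : ℕ∞) f D) {y : E n}
    (hy : y ∈ chartDomain D ξ₀) (b : E n) :
    dd b (chartFun f ξ₀) y = (w ξ₀)⁻¹ * (inner ℝ ξ₀ b * f (boost ξ₀ y) +
      fderiv ℝ f (boost ξ₀ y) (boostLin ξ₀ b - inner ℝ ξ₀ b • boost ξ₀ y)) := by
  refine dd_eq_of_hasDerivAt (differentiableAt_of_mem (isOpen_chartDomain hD)
    (contDiffOn_chartFun hf) hy) ?_
  have h1 : HasFDerivAt f (fderiv ℝ f (boost ξ₀ y)) (boost ξ₀ (y + (0 : ℝ) • b)) := by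
    simpa using (differentiableAt_of_mem hD hf hy.2).hasFDerivAt
  have h2 := ((hasDerivAt_boostDen (ξ₀ := ξ₀) y b).mul_const (w ξ₀)⁻¹).mul
    (h1.comp_hasDerivAt (0 : ℝ) (hasDerivAt_boost hy.1 b))
  refine h2.congr_deriv ?_
  have hd := (show 0 < boostDen ξ₀ y from hy.1).ne'
  simp only [zero_smul, add_zero, boostDir, map_smul, smul_eq_mul, Function.comp]
  field_simp

/-- The factor `boostDen` in `chartFun` is the weight under which degree one homogeneous functions
transform. It makes all first order terms cancel, so the Hessian is a pure pullback. -/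
lemma dd_dd_chartFun (hD : IsOpen D) (hf : ContDiffOn ℝ (⊤ : ℕ∞) f D) {y : E n}
    (hy : y ∈ chartDomain D ξ₀) (b b' : E n) :
    dd b' (dd b (chartFun f ξ₀)) y = boostDen ξ₀ y * (w ξ₀)⁻¹ *
      fderiv ℝ (fderiv ℝ f) (boost ξ₀ y) (boostDir ξ₀ y b') (boostDir ξ₀ y b) := by
  have hV := isOpen_chartDomain (ξ₀ := ξ₀) hD
  have hg := contDiffOn_chartFun (ξ₀ := ξ₀) hf
  refine dd_eq_of_hasDerivAt (differentiableAt_of_mem hV (contDiffOn_dd hV hg b) hy) ?_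
  have hev : ∀ᶠ τ in 𝓝 (0 : ℝ), y + τ • b' ∈ chartDomain D ξ₀ := by
    have hc : ContinuousAt (fun τ : ℝ => y + τ • b') 0 := by fun_prop
    exact hc.eventually_mem (hV.mem_nhds (by simpa using hy))
  have hξ := hasDerivAt_boost hy.1 b'
  have h1 : HasFDerivAt f (fderiv ℝ f (boost ξ₀ y)) (boost ξ₀ (y + (0 : ℝ) • b')) := by
    simpa using (differentiableAt_of_mem hD hf hy.2).hasFDerivAt
  have h2 : HasFDerivAt (fderiv ℝ f) (fderiv ℝ (fderiv ℝ f) (boost ξ₀ y))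
      (boost ξ₀ (y + (0 : ℝ) • b')) := by
    have : DifferentiableAt ℝ (fderiv ℝ f) (boost ξ₀ y) :=
      ((hf.fderiv_of_isOpen hD (m := (⊤ : ℕ∞)) (by simp)).contDiffAt
        (hD.mem_nhds hy.2)).differentiableAt (by simp)
    simpa using this.hasFDerivAt
  have k1 : HasDerivAt (fun τ : ℝ => f (boost ξ₀ (y + τ • b')))
      (fderiv ℝ f (boost ξ₀ y) (boostDir ξ₀ y b')) 0 := h1.comp_hasDerivAt (0 : ℝ) hξ
  have k2 : HasDerivAt (fun τ : ℝ => fderiv ℝ f (boost ξ₀ (y + τ • b')))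
      (fderiv ℝ (fderiv ℝ f) (boost ξ₀ y) (boostDir ξ₀ y b')) 0 := h2.comp_hasDerivAt (0 : ℝ) hξ
  have k3 : HasDerivAt (fun τ : ℝ => boostLin ξ₀ b - inner ℝ ξ₀ b • boost ξ₀ (y + τ • b'))
      (-((inner ℝ ξ₀ b : ℝ) • boostDir ξ₀ y b')) 0 :=
    (hξ.fun_const_smul (inner ℝ ξ₀ b : ℝ)).const_sub (boostLin ξ₀ b)
  have k4 := k2.clm_apply k3
  have h3 := ((k1.const_mul (inner ℝ ξ₀ b)).add k4).const_mul (w ξ₀)⁻¹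
  have h4 := h3.congr_of_eventuallyEq
    (f₁ := fun τ : ℝ => dd b (chartFun f ξ₀) (y + τ • b')) (by
      filter_upwards [hev] with τ hτ
      rw [dd_chartFun hD hf hτ]
      rfl)
  refine h4.congr_deriv ?_
  have hd := (show 0 < boostDen ξ₀ y from hy.1).ne'
  have e1 : boostLin ξ₀ b - inner ℝ ξ₀ b • boost ξ₀ y = boostDen ξ₀ y • boostDir ξ₀ y b := by
    rw [boostDir, smul_smul, mul_inv_cancel₀ hd, one_smul]
  simp only [zero_smul, add_zero, map_neg, map_smul, smul_eq_mul, e1]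
  ring

/-- The height is a linear coordinate of the position vector in Minkowski space, so in the boosted
frame it is a constant combination of the boosted height and the boosted space coordinates `dd · g`.
-/
lemma height_boost (hD : IsOpen D) (hf : ContDiffOn ℝ (⊤ : ℕ∞) f D) (h : ‖ξ₀‖ < 1) {y : E n}
    (hy : y ∈ chartDomain D ξ₀) :
    (w ξ₀)⁻¹ * (dd y (chartFun f ξ₀) y - chartFun f ξ₀ y) - dd (-(w ξ₀)⁻¹ • ξ₀) (chartFun f ξ₀) y =
      height f (boost ξ₀ y) := by
  have hw := w_pos h
  have hn : ‖ξ₀‖ ^ 2 = 1 - w ξ₀ ^ 2 := by rw [w_sq h]; ring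
  have hd := (show 0 < boostDen ξ₀ y from hy.1).ne'
  have e1 : boostLin ξ₀ y - inner ℝ ξ₀ y • boost ξ₀ y = boost ξ₀ y - ξ₀ := by
    have : boostDen ξ₀ y • boost ξ₀ y = ξ₀ + boostLin ξ₀ y := by
      rw [boost, smul_smul, mul_inv_cancel₀ hd, one_smul]
    rw [boostDen, add_smul, one_smul] at this
    rw [eq_sub_of_add_eq' this.symm]
    abel
  have e2 : boostLin ξ₀ ξ₀ = ξ₀ := by
    rw [boostLin, real_inner_self_eq_norm_sq, hn, ← add_smul]
    convert one_smul ℝ ξ₀ using 2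
    field_simp
    ring
  rw [dd_chartFun hD hf hy, dd_chartFun hD hf hy, e1, boostLin_smul, e2, inner_smul_right,
    real_inner_self_eq_norm_sq, hn, height, chartFun, boostDen]
  simp only [map_sub, map_smul, smul_eq_mul]
  field_simp
  ring

lemma norm_boost_sq (h : ‖ξ₀‖ < 1) {y : E n} (hy : 0 < boostDen ξ₀ y) :
    1 - ‖boost ξ₀ y‖ ^ 2 = (w ξ₀ / boostDen ξ₀ y) ^ 2 * (1 - ‖y‖ ^ 2) := by
  have hn : ‖ξ₀‖ ^ 2 = 1 - w ξ₀ ^ 2 := by rw [w_sq h]; ring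
  rw [boost, norm_smul, mul_pow, ← real_inner_self_eq_norm_sq (ξ₀ + boostLin ξ₀ y), inner_add_left,
    inner_add_right, inner_add_right, inner_boostLin_boostLin h, real_inner_comm ξ₀ (boostLin ξ₀ y),
    inner_boostLin h, real_inner_self_eq_norm_sq, real_inner_self_eq_norm_sq, hn, norm_inv, Real.norm_eq_abs, inv_pow,
    sq_abs]
  have hd : boostDen ξ₀ y ≠ 0 := hy.ne'
  have : (inner ℝ ξ₀ y : ℝ) = boostDen ξ₀ y - 1 := by simp [boostDen]
  rw [this]
  field_simp
  ring

lemma w_boost (h : ‖ξ₀‖ < 1) {y : E n} (hy : 0 < boostDen ξ₀ y) :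
    w (boost ξ₀ y) = w ξ₀ / boostDen ξ₀ y * √(1 - ‖y‖ ^ 2) := by
  have hw := w_pos h
  rw [w, norm_boost_sq h hy, Real.sqrt_mul (by positivity), Real.sqrt_sq (by positivity)]

end Boost

end SigmaK

namespace SigmaK

variable {n : ℕ}

/-! ### Jets of powers of `√(1 - t²)` -/

lemma hasJet_sqrt : HasJet (fun t : ℝ => √(1 - t ^ 2)) 0 (-1) := by
  refine ⟨fun t => -t / √(1 - t ^ 2), ?_, by simp, ?_⟩
  · have hev : ∀ᶠ t in 𝓝 (0 : ℝ), (0 : ℝ) < 1 - t ^ 2 := by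
      have hc : ContinuousAt (fun t : ℝ => 1 - t ^ 2) 0 := by fun_prop
      exact hc.eventually (lt_mem_nhds (by simp))
    filter_upwards [hev] with t ht
    have h := (((hasDerivAt_id t).pow 2).const_sub 1).sqrt ht.ne'
    refine h.congr_deriv ?_
    have hs := (Real.sqrt_pos.2 ht).ne'
    simp only [id_eq, Pi.pow_apply]
    field_simp
    norm_num
  · have h1 : HasDerivAt (fun t : ℝ => √(1 - t ^ 2)) 0 0 := by
      have h := (((hasDerivAt_id (0 : ℝ)).pow 2).const_sub 1).sqrt (by simp)
      refine h.congr_deriv (by simp)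
    have h := (hasDerivAt_id (0 : ℝ)).fun_neg.div h1 (by simp)
    refine h.congr_deriv (by simp)

lemma hasJet_inv_sqrt : HasJet (fun t : ℝ => (√(1 - t ^ 2))⁻¹) 0 1 := by
  obtain ⟨g, h1, h2, h3⟩ := hasJet_sqrt
  refine ⟨fun t => -g t / (√(1 - t ^ 2)) ^ 2, ?_, by simp [h2], ?_⟩
  · have hev : ∀ᶠ t in 𝓝 (0 : ℝ), √(1 - t ^ 2) ≠ 0 := by
      have hc : ContinuousAt (fun t : ℝ => √(1 - t ^ 2)) 0 := by fun_prop
      exact hc.eventually_ne (by simp)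
    filter_upwards [hev, h1] with t ht h1
    exact h1.fun_inv ht
  · have h := h3.fun_neg.div (h1.self_of_nhds.pow 2) (by simp)
    refine h.congr_deriv ?_
    simp [h2]

/-! ### The adapted chart at a point -/

lemma hessian_isSymm {D : Set (E n)} {f : E n → ℝ} (hD : IsOpen D)
    (hf : ContDiffOn ℝ (⊤ : ℕ∞) f D) {ξ : E n} (hξ : ξ ∈ D) : (hessian f ξ).IsSymm := by
  ext i j
  simp only [Matrix.transpose_apply, hessian, Matrix.of_apply]
  rw [← dd_dd hD hf _ _ hξ, ← dd_dd hD hf _ _ hξ]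
  exact dd_comm hD hf _ _ hξ

lemma dualMatrix_isHermitian {D : Set (E n)} {f : E n → ℝ} (hD : IsOpen D)
    (hf : ContDiffOn ℝ (⊤ : ℕ∞) f D) {ξ : E n} (hξ : ξ ∈ D) : (dualMatrix f ξ).IsHermitian := by
  rw [Matrix.IsHermitian, Matrix.conjTranspose_eq_transpose_of_trivial, dualMatrix,
    Matrix.transpose_smul, Matrix.transpose_mul, Matrix.transpose_mul, gammaStar_transpose,
    (hessian_isSymm hD hf hξ).eq, Matrix.mul_assoc]

/-- The matrix `Zᵀ H Z` for the Hessian `H` of `f` and a matrix `Z` with columns `z a`. -/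
lemma transpose_mul_hessian_mul (f : E n → ℝ) (ξ : E n) (z : Fin n → E n) (a b : Fin n) :
    ((Matrix.of fun j a => z a j).transpose * hessian f ξ * (Matrix.of fun j a => z a j)) a b =
      fderiv ℝ (fderiv ℝ f) ξ (z a) (z b) := by
  rw [← hessian_form]
  simp only [Matrix.mul_apply, Matrix.transpose_apply, Matrix.of_apply, Finset.sum_mul]
  rw [Finset.sum_comm]

lemma inner_eq_sum (x y : E n) : inner ℝ x y = ∑ j, x j * y j := by
  rw [PiLp.inner_apply]
  exact Finset.sum_congr rfl fun j _ => by simp [mul_comm]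

lemma transpose_mul_gamma_mul (ξ : E n) (c : ℝ) (z : Fin n → E n) (a b : Fin n) :
    ((Matrix.of fun j a => z a j).transpose *
      (1 + c • Matrix.vecMulVec (WithLp.ofLp ξ) (WithLp.ofLp ξ)) * (Matrix.of fun j a => z a j)) a b =
      inner ℝ (z a) (z b) + c * (inner ℝ ξ (z a) * inner ℝ ξ (z b)) := by
  rw [Matrix.mul_add, Matrix.add_mul, Matrix.mul_one, Matrix.add_apply, Matrix.mul_smul,
    Matrix.smul_mul, Matrix.smul_apply, smul_eq_mul]
  simp only [inner_eq_sum, Matrix.mul_apply, Matrix.transpose_apply, Matrix.of_apply,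
    Matrix.vecMulVec_apply]
  congr 2
  rw [Finset.sum_mul_sum]
  simp only [Finset.sum_mul]
  rw [Finset.sum_comm]
  exact Finset.sum_congr rfl fun i _ => Finset.sum_congr rfl fun j _ => by ring

/-- The dual matrix in the frame of the chart: the frame is orthonormal and the matrix is given by
the second derivatives of the chart function. -/
lemma exists_orthogonal {D : Set (E n)} {f : E n → ℝ} (hD : IsOpen D)
    (hDb : ∀ ξ ∈ D, ‖ξ‖ < 1)
    (hf : ContDiffOn ℝ (⊤ : ℕ∞) f D) {ξ₀ : E n} (hξ₀ : ξ₀ ∈ D)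
    (v : OrthonormalBasis (Fin n) ℝ (E n)) (i : Fin n) {t : ℝ} (ht : t • v i ∈ chartDomain D ξ₀)
    (ht1 : 0 < 1 - t ^ 2) :
    ∃ O : Matrix (Fin n) (Fin n) ℝ, O.transpose * O = 1 ∧
      O.transpose * dualMatrix f (boost ξ₀ (t • v i)) * O = Matrix.of fun a b =>
        √(1 - t ^ 2) * ((if a = i then √(1 - t ^ 2) else 1) * (if b = i then √(1 - t ^ 2) else 1)) *
          dd (v a) (dd (v b) (chartFun f ξ₀)) (t • v i) := by
  have hw := w_pos (hDb _ hξ₀)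
  have hξ := hDb _ ht.2
  have hwξ := w_pos hξ
  set y := t • v i with hy
  set ξ := boost ξ₀ y with hξd
  set d := boostDen ξ₀ y with hd
  have hd0 : 0 < d := ht.1
  set r := √(1 - t ^ 2) with hr
  have hr0 : 0 < r := Real.sqrt_pos.2 ht1
  have hr2 : r ^ 2 = 1 - t ^ 2 := Real.sq_sqrt ht1.le
  have hyn : ‖y‖ ^ 2 = t ^ 2 := by
    rw [hy, norm_smul, v.norm_eq_one, mul_one, Real.norm_eq_abs, sq_abs]
  have hwb : w ξ = w ξ₀ / d * r := by rw [hξd, w_boost (hDb _ hξ₀) ht.1, hyn]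
  -- In the projective model of hyperbolic space, at `t v_i`, the radial direction is longer than
  -- the transversal ones by the factor `1/r`; `ρ` normalizes it.
  set ρ : Fin n → ℝ := fun a => if a = i then r else 1 with hρ
  set z : Fin n → E n := fun a => (ρ a * (w ξ₀)⁻¹ * d) • boostDir ξ₀ y (v a) with hz
  set Z : Matrix (Fin n) (Fin n) ℝ := Matrix.of fun j a => z a j with hZ
  have hvv : ∀ a b, inner ℝ (v a) (v b) = if a = b then (1 : ℝ) else 0 :=
    orthonormal_iff_ite.1 v.orthonormal
  -- the inner products in Minkowski space
  have hdir : ∀ a, d • boostDir ξ₀ y (v a) = boostLin ξ₀ (v a) - inner ℝ ξ₀ (v a) • ξ := by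
    intro a
    rw [boostDir, smul_smul, ← hd, mul_inv_cancel₀ hd0.ne', one_smul]
  have hξB : ∀ a, inner ℝ ξ (boostLin ξ₀ (v a)) =
      inner ℝ ξ₀ (v a) + d⁻¹ * (t * w ξ₀ ^ 2 * if a = i then 1 else 0) := by
    intro a
    rw [hξd, boost, inner_smul_left, inner_add_left, inner_boostLin (hDb _ hξ₀),
      inner_boostLin_boostLin (hDb _ hξ₀), hy, inner_smul_left, inner_smul_right, hvv, ← hy, ← hd]
    have e : d = 1 + t * inner ℝ ξ₀ (v i) := by rw [hd, boostDen, hy, inner_smul_right]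
    have e' : t * inner ℝ ξ₀ (v i) = d - 1 := by rw [e]; ring
    rw [e']
    simp only [conj_trivial, eq_comm (a := i)]
    field_simp
    ring
  have hξn : inner ℝ ξ ξ = 1 - w ξ ^ 2 := by
    rw [real_inner_self_eq_norm_sq, w_sq hξ]; ring
  have hin1 : ∀ a, inner ℝ ξ (d • boostDir ξ₀ y (v a)) =
      w ξ ^ 2 * inner ℝ ξ₀ (v a) + d⁻¹ * (t * w ξ₀ ^ 2 * if a = i then 1 else 0) := by
    intro a
    rw [hdir, inner_sub_right, inner_smul_right, hξB, hξn]; ring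
  have hin2 : ∀ a b, inner ℝ (d • boostDir ξ₀ y (v a)) (d • boostDir ξ₀ y (v b)) =
      w ξ₀ ^ 2 * (if a = b then 1 else 0) - w ξ ^ 2 * inner ℝ ξ₀ (v a) * inner ℝ ξ₀ (v b) -
      inner ℝ ξ₀ (v a) * (d⁻¹ * (t * w ξ₀ ^ 2 * if b = i then 1 else 0)) -
      inner ℝ ξ₀ (v b) * (d⁻¹ * (t * w ξ₀ ^ 2 * if a = i then 1 else 0)) := by
    intro a b
    rw [hdir, hdir, inner_sub_left, inner_sub_right, inner_sub_right, inner_smul_left,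
      inner_smul_left, inner_smul_right, inner_smul_right, inner_boostLin_boostLin (hDb _ hξ₀),
      real_inner_comm ξ, hξB, hξB, hξn, hvv]
    simp only [conj_trivial]
    ring
  -- By `gammaUp_mul_self` this Gram matrix is that of the vectors `gammaUp ξ (z a)`, so it yields
  -- the orthogonality of `gammaUp ξ * Z`.
  have hG : ∀ a b, inner ℝ (z a) (z b) + (w ξ ^ 2)⁻¹ * (inner ℝ ξ (z a) * inner ℝ ξ (z b)) =
      if a = b then 1 else 0 := by
    intro a b
    have e1 : ∀ a, z a = (ρ a * (w ξ₀)⁻¹) • (d • boostDir ξ₀ y (v a)) := fun a => by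
      rw [smul_smul]
    generalize hbv : (fun a => d • boostDir ξ₀ y (v a)) = bv at *
    have hbv' : ∀ a, d • boostDir ξ₀ y (v a) = bv a := fun a => congrFun hbv a
    simp only [hbv'] at hin1 hin2 e1
    rw [e1, e1, inner_smul_left, inner_smul_right, inner_smul_right, inner_smul_right, hin1, hin1,
      hin2, hwb]
    simp only [hρ, conj_trivial]
    have ht2 : t ^ 2 = 1 - r ^ 2 := by rw [hr2]; ring
    by_cases ha : a = i
    · by_cases hb : b = i
      · subst ha; subst hb
        simp only [if_true]
        field_simp
        linear_combination d ^ 2 * ht2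
      · subst ha
        simp only [hb, Ne.symm hb, if_true, if_false]
        field_simp
        ring
    · by_cases hb : b = i
      · subst hb
        simp only [ha, if_true, if_false]
        field_simp
        ring
      · simp only [ha, hb, if_false]
        field_simp
        ring
  refine ⟨gammaUp ξ * Z, ?_, ?_⟩
  · rw [Matrix.transpose_mul, gammaUp_transpose, Matrix.mul_assoc, ← Matrix.mul_assoc (gammaUp ξ),
      gammaUp_mul_self hξ, ← Matrix.mul_assoc]
    ext a b
    rw [hZ, transpose_mul_gamma_mul, hG, Matrix.one_apply]
  · have e1 : (gammaUp ξ * Z).transpose * dualMatrix f ξ * (gammaUp ξ * Z) =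
        w ξ • (Z.transpose * hessian f ξ * Z) := by
      rw [Matrix.transpose_mul, gammaUp_transpose, dualMatrix, Matrix.mul_smul, Matrix.smul_mul]
      congr 1
      calc Z.transpose * gammaUp ξ * (gammaStar ξ * hessian f ξ * gammaStar ξ) * (gammaUp ξ * Z)
          = Z.transpose * (gammaUp ξ * gammaStar ξ) * hessian f ξ * (gammaStar ξ * gammaUp ξ) * Z := by
            simp only [Matrix.mul_assoc]
        _ = _ := by
            rw [gammaUp_mul_gammaStar hξ, gammaStar_mul_gammaUp hξ, Matrix.mul_one, Matrix.mul_one]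
    rw [e1]
    ext a b
    rw [Matrix.smul_apply, hZ, transpose_mul_hessian_mul, Matrix.of_apply, dd_dd_chartFun hD hf ht,
      ← hd, ← hξd, hwb]
    simp only [hz, map_smul, _root_.smul_apply, smul_eq_mul]
    field_simp
    simp only [hρ]
    ring

end SigmaK

namespace SigmaK

variable {n : ℕ}

lemma boostDir_zero {ξ₀ : E n} (h : ‖ξ₀‖ < 1) (b : E n) :
    WithLp.ofLp (boostDir ξ₀ 0 b) = w ξ₀ • (gammaStar ξ₀).mulVec (WithLp.ofLp b) := by
  have hw := w_pos h
  have e : (gammaStar ξ₀).mulVec (WithLp.ofLp b) =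
      WithLp.ofLp b - ((1 + w ξ₀)⁻¹ * inner ℝ ξ₀ b) • WithLp.ofLp ξ₀ := by
    rw [gammaStar_eq, Matrix.sub_mulVec, Matrix.one_mulVec, Matrix.smul_mulVec]
    congr 1
    ext j
    simp only [Matrix.mulVec, Matrix.vecMulVec_apply, dotProduct, Pi.smul_apply, smul_eq_mul,
      inner_eq_sum, Finset.mul_sum, Finset.sum_mul]
    exact Finset.sum_congr rfl fun i _ => by ring
  rw [e]
  ext j
  simp only [boostDir, boostDen_zero, boost_zero, inv_one, one_smul, boostLin, WithLp.ofLp_sub,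
    WithLp.ofLp_add, WithLp.ofLp_smul, Pi.sub_apply, Pi.add_apply, Pi.smul_apply, smul_eq_mul]
  field_simp
  ring

lemma dd_dd_chartFun_zero {D : Set (E n)} {f : E n → ℝ} (hD : IsOpen D)
    (hf : ContDiffOn ℝ (⊤ : ℕ∞) f D) {ξ₀ : E n} (hξ₀ : ξ₀ ∈ D) (h : ‖ξ₀‖ < 1) (a b : E n) :
    dd a (dd b (chartFun f ξ₀)) 0 =
      WithLp.ofLp a ⬝ᵥ (dualMatrix f ξ₀).mulVec (WithLp.ofLp b) := by
  have hw := w_pos h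
  rw [dd_dd_chartFun hD hf (zero_mem_chartDomain hξ₀), boostDen_zero, boost_zero, ← hessian_form]
  have e : ∀ x y : E n, ∑ i, ∑ j, x i * hessian f ξ₀ i j * y j =
      WithLp.ofLp x ⬝ᵥ (hessian f ξ₀).mulVec (WithLp.ofLp y) := by
    intro x y
    simp only [dotProduct, Matrix.mulVec, Finset.mul_sum, mul_assoc]
  rw [e, boostDir_zero h, boostDir_zero h, dualMatrix, Matrix.smul_mulVec, Matrix.mulVec_smul,
    dotProduct_smul, smul_dotProduct, dotProduct_smul, ← Matrix.mulVec_mulVec, ← Matrix.mulVec_mulVec,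
    Matrix.dotProduct_mulVec (WithLp.ofLp a), ← Matrix.mulVec_transpose, gammaStar_transpose]
  simp only [smul_eq_mul]
  field_simp

lemma eigenvals_eq {A : Matrix (Fin n) (Fin n) ℝ} (hA : A.IsHermitian) :
    eigenvals A = Multiset.map hA.eigenvalues Finset.univ.val := by
  rw [eigenvals, hA.roots_charpoly_eq_eigenvalues]
  rfl

/-- The frame is an eigenbasis of the dual matrix at `ξ₀`, and `T`, `q` are third and fourth
derivatives of the chart function at the origin, symmetric because partial derivatives commute. The
curvature of the ambient hyperbolic space enters only through the jet `(0, -1)` of `√(1 - t²)`,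
which produces the correction in `A2`. -/
theorem exists_adaptedChart {D : Set (E n)} {f : E n → ℝ} (hD : IsOpen D) (hDb : ∀ ξ ∈ D, ‖ξ‖ < 1)
    (hf : ContDiffOn ℝ (⊤ : ℕ∞) f D) {ξ₀ : E n} (hξ₀ : ξ₀ ∈ D)
    (hpos : ∀ l ∈ eigenvals (dualMatrix f ξ₀), 0 < l) :
    ∃ (κ : Fin n → ℝ) (T : Fin n → Fin n → Fin n → ℝ) (q : Fin n → Fin n → ℝ) (β : Fin n → ℝ)
      (A : Fin n → ℝ → Matrix (Fin n) (Fin n) ℝ) (A2 : Fin n → Matrix (Fin n) (Fin n) ℝ)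
      (U W : Fin n → ℝ → ℝ) (Ξ : Fin n → ℝ → E n),
      IsAdaptedChart κ T q β (height f ξ₀) (1 / w ξ₀) A A2 U W ∧ (∀ i, Ξ i 0 = ξ₀) ∧
      ∀ i, ∀ᶠ t in 𝓝 (0 : ℝ), Ξ i t ∈ D ∧ U i t = height f (Ξ i t) ∧ W i t = 1 / w (Ξ i t) ∧
        ∃ O : Matrix (Fin n) (Fin n) ℝ, O.transpose * O = 1 ∧
          A i t = O.transpose * dualMatrix f (Ξ i t) * O := by
  have h1 := hDb _ hξ₀
  have hw := w_pos h1
  have hA := dualMatrix_isHermitian hD hf hξ₀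
  set v : OrthonormalBasis (Fin n) ℝ (E n) := hA.eigenvectorBasis with hv
  set g := chartFun f ξ₀ with hg
  set V := chartDomain D ξ₀ with hVd
  have hV : IsOpen V := isOpen_chartDomain hD
  have h0 : (0 : E n) ∈ V := zero_mem_chartDomain hξ₀
  have hgs : ContDiffOn ℝ (⊤ : ℕ∞) g V := contDiffOn_chartFun hf
  have hlpos : ∀ i, 0 < hA.eigenvalues i := by
    intro i
    refine hpos _ ?_
    rw [eigenvals_eq hA]
    exact Multiset.mem_map_of_mem _ (Finset.mem_univ_val i)
  have hdiag : ∀ a b, dd (v a) (dd (v b) g) 0 = if a = b then hA.eigenvalues a else 0 := by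
    intro a b
    rw [hg, dd_dd_chartFun_zero hD hf hξ₀ h1, hv, hA.mulVec_eigenvectorBasis, dotProduct_smul,
      smul_eq_mul]
    have := orthonormal_iff_ite.1 hA.eigenvectorBasis.orthonormal a b
    rw [inner_eq_sum] at this
    rw [dotProduct, this]
    split_ifs with hab
    · rw [hab, mul_one]
    · rw [mul_zero]
  have hs1 : ∀ a, ContDiffOn ℝ (⊤ : ℕ∞) (dd (v a) g) V := fun a => contDiffOn_dd hV hgs _
  have hs2 : ∀ a b, ContDiffOn ℝ (⊤ : ℕ∞) (dd (v a) (dd (v b) g)) V :=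
    fun a b => contDiffOn_dd hV (hs1 b) _
  -- The coefficients of the boosted space coordinates in `height_boost`; together with `1 / w ξ₀`
  -- they form a unit timelike vector, which is the field `sq`.
  set β : Fin n → ℝ := fun i => inner ℝ (v i) (-(w ξ₀)⁻¹ • ξ₀) with hβ
  have hβi : ∀ i, β i = -(w ξ₀)⁻¹ * inner ℝ ξ₀ (v i) := fun i => by
    simp only [hβ]; rw [inner_smul_right, real_inner_comm]
  have hβsum : ∑ j, β j • v j = -(w ξ₀)⁻¹ • ξ₀ := v.sum_repr' _
  set r : ℝ → ℝ := fun t => √(1 - t ^ 2) with hr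
  have hr0 : r 0 = 1 := by simp [hr]
  have hrJ : HasJet r 0 (-1) := hasJet_sqrt
  have hρJ : ∀ a i : Fin n, HasJet (fun t => if a = i then r t else 1) 0 (if a = i then -1 else 0) := by
    intro a i
    split_ifs
    · exact hrJ
    · exact hasJet_const 1
  refine ⟨fun i => (hA.eigenvalues i)⁻¹, fun a b i => dd (v i) (dd (v a) (dd (v b) g)) 0,
    fun a i => dd (v i) (dd (v i) (dd (v a) (dd (v a) g))) 0, β,
    fun i t => Matrix.of fun a b => r t * ((if a = i then r t else 1) * (if b = i then r t else 1)) *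
      dd (v a) (dd (v b) g) (t • v i),
    fun i => Matrix.of fun a b => dd (v i) (dd (v i) (dd (v a) (dd (v b) g))) 0 -
      (1 + (if a = i then 1 else 0) + (if b = i then 1 else 0)) * (dd (v a) (dd (v b) g) 0),
    fun i t => (w ξ₀)⁻¹ * (t * dd (v i) g (t • v i) - g (t • v i)) - ∑ j, β j * dd (v j) g (t • v i),
    fun i t => (1 / w ξ₀ - t * β i) * (r t)⁻¹, fun i t => boost ξ₀ (t • v i), ?_, ?_, ?_⟩
  · refine ⟨fun i => inv_pos.2 (hlpos i), ?_, ?_, ?_, ?_, by positivity, ?_, ?_, ?_, ?_, ?_, ?_, ?_⟩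
    · intro a b i
      exact dd_congr hV (dd_comm hV hgs (v b) (v a)) (v i) h0
    · intro a b i
      have e1 : dd (v i) (dd (v a) (dd (v b) g)) 0 = dd (v a) (dd (v i) (dd (v b) g)) 0 :=
        dd_comm hV (hs1 b) (v a) (v i) h0
      have e2 : dd (v a) (dd (v i) (dd (v b) g)) 0 = dd (v a) (dd (v b) (dd (v i) g)) 0 :=
        dd_congr hV (dd_comm hV hgs (v b) (v i)) (v a) h0
      have e3 : dd (v a) (dd (v b) (dd (v i) g)) 0 = dd (v b) (dd (v a) (dd (v i) g)) 0 :=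
        dd_comm hV (hs1 i) (v b) (v a) h0
      exact e1.trans (e2.trans e3)
    · intro a i
      have e1 : dd (v i) (dd (v i) (dd (v a) (dd (v a) g))) 0 =
          dd (v i) (dd (v a) (dd (v i) (dd (v a) g))) 0 :=
        dd_congr hV (dd_comm hV (hs1 a) (v a) (v i)) (v i) h0
      have e2 : dd (v i) (dd (v a) (dd (v i) (dd (v a) g))) 0 =
          dd (v a) (dd (v i) (dd (v i) (dd (v a) g))) 0 := dd_comm hV (hs2 i a) (v a) (v i) h0
      have e3 : dd (v a) (dd (v i) (dd (v i) (dd (v a) g))) 0 =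
          dd (v a) (dd (v i) (dd (v a) (dd (v i) g))) 0 :=
        dd_congr hV (dd_congr hV (dd_comm hV hgs (v a) (v i)) (v i)) (v a) h0
      have e4 : dd (v a) (dd (v i) (dd (v a) (dd (v i) g))) 0 =
          dd (v a) (dd (v a) (dd (v i) (dd (v i) g))) 0 :=
        dd_congr hV (dd_comm hV (hs1 i) (v a) (v i)) (v a) h0
      exact e1.trans (e2.trans (e3.trans e4))
    · have e1 : ∑ i, β i ^ 2 = ‖-(w ξ₀)⁻¹ • ξ₀‖ ^ 2 := by
        rw [← v.sum_sq_norm_inner_right]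
        exact Finset.sum_congr rfl fun i _ => by simp [hβ]
      rw [e1, norm_smul, mul_pow, norm_neg, norm_inv, Real.norm_eq_abs, abs_of_pos hw]
      have : ‖ξ₀‖ ^ 2 = 1 - w ξ₀ ^ 2 := by rw [w_sq h1]; ring
      rw [this]
      field_simp
      ring
    · intro i
      ext a b
      simp [hr0, hdiag, Matrix.diagonal_apply]
    · intro i
      have := height_boost hD hf h1 h0
      rw [boost_zero, ← hβsum] at this
      rw [← this]
      simp only [zero_smul, zero_mul, dd, map_zero, map_sum, map_smul, smul_eq_mul, hg]
    · intro i
      simp [hr0]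
    · intro i a b
      have hj := (hrJ.mul ((hρJ a i).mul (hρJ b i))).mul (hasJet_line hV h0 (hs2 a b) (v i))
      refine hj.of_eq ?_ ?_
      · simp only [hr0, ite_self, zero_smul]; ring
      · simp only [hr0, ite_self, zero_smul, Matrix.of_apply]
        split_ifs <;> ring
    · intro i a
      simp only [Matrix.of_apply, hdiag, if_true, inv_inv]
      split_ifs <;> ring
    · intro i
      have hj := (((hasJet_id.mul (hasJet_line hV h0 (hs1 i) (v i))).sub
        (hasJet_line hV h0 hgs (v i))).const_mul (w ξ₀)⁻¹).sub
        (HasJet.sum (s := Finset.univ) fun j _ => (hasJet_line hV h0 (hs1 j) (v i)).const_mul (β j))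
      refine hj.of_eq ?_ ?_
      · simp only [zero_smul, hdiag, inv_inv]
        simp
      · simp only [zero_smul, hdiag, inv_inv, if_true]
        have : ∀ j, dd (v i) (dd (v i) (dd (v j) g)) 0 = dd (v j) (dd (v i) (dd (v i) g)) 0 := by
          intro j
          have e1 : dd (v i) (dd (v i) (dd (v j) g)) 0 = dd (v i) (dd (v j) (dd (v i) g)) 0 :=
            dd_congr hV (dd_comm hV hgs (v j) (v i)) (v i) h0
          exact e1.trans (dd_comm hV (hs1 i) (v j) (v i) h0)
        simp only [this]
        ring
    · intro i
      have hj := ((hasJet_const (1 / w ξ₀)).sub (hasJet_id.mul (hasJet_const (β i)))).mul hasJet_inv_sqrt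
      refine hj.of_eq ?_ ?_
      · simp
      · simp
  · intro i
    simp
  · intro i
    have hev : ∀ᶠ t in 𝓝 (0 : ℝ), (0 : ℝ) < 1 - t ^ 2 := by
      have hc : ContinuousAt (fun t : ℝ => 1 - t ^ 2) 0 := by fun_prop
      exact hc.eventually (lt_mem_nhds (by simp))
    filter_upwards [hev, eventually_line_mem hV h0 (v i)] with t ht1 ht
    refine ⟨ht.2, ?_, ?_, ?_⟩
    · rw [← height_boost hD hf h1 ht, ← hβsum]
      simp only [dd, map_sum, map_smul, smul_eq_mul, hg]
    · rw [w_boost h1 ht.1, norm_smul, v.norm_eq_one, mul_one, Real.norm_eq_abs, sq_abs, hβi, boostDen,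
        inner_smul_right]
      have h2 : 0 < √(1 - t ^ 2) := Real.sqrt_pos.2 ht1
      have h3 : 0 < boostDen ξ₀ (t • v i) := ht.1
      rw [boostDen, inner_smul_right] at h3
      simp only [hr]
      field_simp
      ring
    · obtain ⟨O, hO1, hO2⟩ := exists_orthogonal hD hDb hf hξ₀ v i ht ht1
      exact ⟨O, hO1, hO2.symm⟩

end SigmaK

namespace SigmaK

variable {n : ℕ}

/-! ### The curvature equation -/

lemma det_scalar_add {A : Matrix (Fin n) (Fin n) ℝ} (hA : A.IsHermitian) (x : ℝ) :
    (Matrix.scalar (Fin n) x + A).det = ∏ i, (x + hA.eigenvalues i) := by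
  have h1 : Matrix.scalar (Fin n) x + A = -(Matrix.scalar (Fin n) (-x) - A) := by
    rw [map_neg]; abel
  rw [h1, Matrix.det_neg, ← Matrix.eval_charpoly, hA.charpoly_eq, Polynomial.eval_prod,
    Fintype.card_fin]
  have h2 : ((-1 : ℝ)) ^ n = ∏ _i : Fin n, (-1 : ℝ) := by simp
  rw [h2, ← Finset.prod_mul_distrib]
  refine Finset.prod_congr rfl fun i _ => ?_
  simp
  ring

lemma satisfiesEq_of_sigma {A : Matrix (Fin n) (Fin n) ℝ} (hA : A.IsHermitian) {k : ℕ} {b : ℝ}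
    (hk : k ≤ n) (h : sigma (n - k) A = b * sigma n A) : SatisfiesEq k b A := by
  set S := eigenvals A with hS
  have hc : Multiset.card S = n := by
    rw [hS, eigenvals_eq hA]; simp
  refine ⟨(S.map fun r => X + C r).prod, ?_, ?_, ?_⟩
  · refine (Polynomial.natDegree_multiset_prod_le _).trans ?_
    rw [Multiset.map_map]
    simp [hc]
  · intro x
    rw [det_scalar_add hA, hS, eigenvals_eq hA, Multiset.map_map, Polynomial.eval_multiset_prod,
      Multiset.map_map]
    simp [Finset.prod]
  · rw [Multiset.prod_X_add_C_coeff _ (by omega), Multiset.prod_X_add_C_coeff _ (by omega), hc]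
    simpa [sigma] using h

lemma sigma_nonneg {A : Matrix (Fin n) (Fin n) ℝ} (h : ∀ l ∈ eigenvals A, 0 < l) (j : ℕ) :
    0 ≤ sigma j A := by
  refine Multiset.sum_nonneg fun x hx => ?_
  obtain ⟨t, ht, rfl⟩ := Multiset.mem_map.1 hx
  exact Multiset.prod_nonneg fun y hy =>
    (h y (Multiset.mem_of_le (Multiset.mem_powersetCard.1 ht).1 hy)).le

lemma sigma_eq_of_F_eq {A : Matrix (Fin n) (Fin n) ℝ} (h : ∀ l ∈ eigenvals A, 0 < l) {k : ℕ}
    (hk : 1 ≤ k) (hkn : k ≤ n) (hF : F k A = 1 / (n.choose k : ℝ) ^ (1 / (k : ℝ))) :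
    sigma (n - k) A = n.choose k * sigma n A := by
  have hb : (0 : ℝ) < n.choose k := by exact_mod_cast Nat.choose_pos hkn
  have hk0 : (0 : ℝ) < 1 / (k : ℝ) := by positivity
  have h1 : sigma n A / sigma (n - k) A = 1 / (n.choose k : ℝ) := by
    have h0 : 0 ≤ sigma n A / sigma (n - k) A := div_nonneg (sigma_nonneg h _) (sigma_nonneg h _)
    refine (Real.rpow_left_inj h0 (by positivity) hk0.ne').1 ?_
    rw [Real.div_rpow zero_le_one hb.le, Real.one_rpow]
    exact hF
  -- Division by zero gives zero, which the positive right side of the equation excludes.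
  have h2 : sigma (n - k) A ≠ 0 := by
    intro h2
    rw [h2, div_zero] at h1
    exact (by positivity : (1 / (n.choose k : ℝ)) ≠ 0) h1.symm
  field_simp at h1
  linarith

lemma SatisfiesEq.conj {A O : Matrix (Fin n) (Fin n) ℝ} {k : ℕ} {b : ℝ} (h : SatisfiesEq k b A)
    (hO : O.transpose * O = 1) : SatisfiesEq k b (O.transpose * A * O) := by
  obtain ⟨P, h1, h2, h3⟩ := h
  refine ⟨P, h1, fun x => ?_, h3⟩
  have e : Matrix.scalar (Fin n) x + O.transpose * A * O =
      O.transpose * (Matrix.scalar (Fin n) x + A) * O := by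
    have e1 : O.transpose * Matrix.scalar (Fin n) x * O = Matrix.scalar (Fin n) x := by
      rw [← (Matrix.scalar_commute x (fun r => Commute.all x r) O.transpose).eq, Matrix.mul_assoc, hO,
        Matrix.mul_one]
    rw [Matrix.mul_add, Matrix.add_mul, e1]
  have hd : O.transpose.det * O.det = 1 := by rw [← Matrix.det_mul, hO, Matrix.det_one]
  rw [h2, e, Matrix.det_mul, Matrix.det_mul]
  linear_combination (-(Matrix.scalar (Fin n) x + A).det) * hd

/-! ### Quadratic forms -/

lemma sum_sum_eq_dotProduct (A : Matrix (Fin n) (Fin n) ℝ) (v : Fin n → ℝ) :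
    ∑ a, ∑ b, A a b * (v a * v b) = v ⬝ᵥ A.mulVec v := by
  simp only [dotProduct, Matrix.mulVec, Finset.mul_sum]
  exact Finset.sum_congr rfl fun a _ => Finset.sum_congr rfl fun b _ => by ring

lemma sum_sq_eq_dotProduct (v : Fin n → ℝ) : ∑ a, v a ^ 2 = v ⬝ᵥ v := by
  simp only [dotProduct, sq]

lemma dotProduct_conj (A O : Matrix (Fin n) (Fin n) ℝ) (v : Fin n → ℝ) :
    v ⬝ᵥ (O.transpose * A * O).mulVec v = O.mulVec v ⬝ᵥ A.mulVec (O.mulVec v) := by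
  rw [← Matrix.mulVec_mulVec, ← Matrix.mulVec_mulVec, Matrix.dotProduct_mulVec,
    Matrix.vecMul_transpose]

lemma dotProduct_orthogonal {O : Matrix (Fin n) (Fin n) ℝ} (hO : O.transpose * O = 1)
    (v : Fin n → ℝ) : O.mulVec v ⬝ᵥ O.mulVec v = v ⬝ᵥ v := by
  have := dotProduct_conj 1 O v
  rw [Matrix.mul_one, hO, Matrix.one_mulVec, Matrix.one_mulVec] at this
  exact this.symm

lemma posDef_of_eigenvals {A : Matrix (Fin n) (Fin n) ℝ} (hA : A.IsHermitian)
    (h : ∀ l ∈ eigenvals A, 0 < l) : A.PosDef := by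
  refine hA.posDef_iff_eigenvalues_pos.2 fun i => h _ ?_
  rw [eigenvals_eq hA]
  exact Multiset.mem_map_of_mem _ (Finset.mem_univ_val i)

lemma dotProduct_mulVec_pos {A : Matrix (Fin n) (Fin n) ℝ} (hA : A.PosDef) {v : Fin n → ℝ}
    (hv : v ≠ 0) : 0 < v ⬝ᵥ A.mulVec v := by
  simpa using hA.dotProduct_mulVec_pos hv

lemma dotProduct_mulVec_nonneg {A : Matrix (Fin n) (Fin n) ℝ} (hA : A.PosDef) (v : Fin n → ℝ) :
    0 ≤ v ⬝ᵥ A.mulVec v := by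
  simpa using hA.posSemidef.dotProduct_mulVec_nonneg v

/-! ### Estimates at maxima -/

section Maxima

variable {D : Set (E n)} {f : E n → ℝ} {k : ℕ}

lemma exists_chart_of_solution (hk : 1 ≤ k) (hkn : k ≤ n)
    (hD : IsOpen D) (hDb : ∀ ξ ∈ D, ‖ξ‖ < 1) (hf : ContDiffOn ℝ (⊤ : ℕ∞) f D)
    (hpos : ∀ ξ ∈ D, ∀ l ∈ eigenvals (dualMatrix f ξ), 0 < l)
    (heq : ∀ ξ ∈ D, F k (dualMatrix f ξ) = 1 / (n.choose k : ℝ) ^ (1 / (k : ℝ)))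
    {ξ₀ : E n} (hξ₀ : ξ₀ ∈ D) :
    ∃ (κ : Fin n → ℝ) (T : Fin n → Fin n → Fin n → ℝ) (q : Fin n → Fin n → ℝ) (β : Fin n → ℝ)
      (A : Fin n → ℝ → Matrix (Fin n) (Fin n) ℝ) (A2 : Fin n → Matrix (Fin n) (Fin n) ℝ)
      (U W : Fin n → ℝ → ℝ) (o : Fin n) (Ξ : Fin n → ℝ → E n),
      IsAdaptedChart κ T q β (height f ξ₀) (1 / w ξ₀) A A2 U W ∧
      (∀ i, κ i ≤ κ o) ∧ es Finset.univ κ k = n.choose k ∧ 1 ≤ κ o ∧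
      (∀ i, ∀ᶠ t in 𝓝 (0 : ℝ), SatisfiesEq k (n.choose k) (A i t)) ∧
      (∀ z : Fin n → ℝ, (κ o)⁻¹ * (z ⬝ᵥ z) ≤ z ⬝ᵥ (dualMatrix f ξ₀).mulVec z) ∧
      ∀ i, ∀ᶠ t in 𝓝 (0 : ℝ), Ξ i t ∈ D ∧ U i t = height f (Ξ i t) ∧ W i t = 1 / w (Ξ i t) ∧
        ∀ v : Fin n → ℝ, ∃ z : Fin n → ℝ, ∑ a, v a ^ 2 = z ⬝ᵥ z ∧
          ∑ a, ∑ b, A i t a b * (v a * v b) = z ⬝ᵥ (dualMatrix f (Ξ i t)).mulVec z := by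
  obtain ⟨κ, T, q, β, A, A2, U, W, Ξ, hc, hΞ0, hΞ⟩ := exists_adaptedChart hD hDb hf hξ₀ (hpos _ hξ₀)
  have : Nonempty (Fin n) := ⟨⟨0, by omega⟩⟩
  obtain ⟨o, -, ho⟩ := Finset.exists_max_image Finset.univ κ Finset.univ_nonempty
  have ho : ∀ i, κ i ≤ κ o := fun i => ho i (Finset.mem_univ i)
  have hSE : ∀ i, ∀ᶠ t in 𝓝 (0 : ℝ), SatisfiesEq k (n.choose k) (A i t) := by
    intro i
    filter_upwards [hΞ i] with t ⟨h1, _, _, O, hO, hA⟩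
    rw [hA]
    exact (satisfiesEq_of_sigma (dualMatrix_isHermitian hD hf h1) hkn
      (sigma_eq_of_F_eq (hpos _ h1) hk hkn (heq _ h1))).conj hO
  have hes : es Finset.univ κ k = n.choose k := by
    have h1 := (hSE o).self_of_nhds
    rw [hc.A_zero] at h1
    exact es_eq_of_satisfiesEq hc.pos h1
  refine ⟨κ, T, q, β, A, A2, U, W, o, Ξ, hc, ho, hes, ?_, hSE, ?_, ?_⟩
  · by_contra hlt
    push Not at hlt
    have h1 := es_le_pow_mul_choose (s := Finset.univ) hc.pos (fun i _ => ho i) (hc.pos o).le k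
    rw [hes, Finset.card_univ, Fintype.card_fin] at h1
    have h2 : κ o ^ k < 1 := pow_lt_one₀ (hc.pos o).le hlt (by omega)
    have hb : (0 : ℝ) < n.choose k := by exact_mod_cast Nat.choose_pos hkn
    nlinarith
  · intro z
    obtain ⟨_, _, _, O, hO, hA⟩ := (hΞ o).self_of_nhds
    rw [hΞ0, hc.A_zero] at hA
    have hO' : O * O.transpose = 1 := mul_eq_one_comm.1 hO
    have hz : O.mulVec (O.transpose.mulVec z) = z := by
      rw [Matrix.mulVec_mulVec, hO', Matrix.one_mulVec]
    set v := O.transpose.mulVec z with hv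
    have e1 := dotProduct_conj (dualMatrix f ξ₀) O v
    rw [← hA, hz] at e1
    have e2 := dotProduct_orthogonal hO v
    rw [hz] at e2
    rw [← e1, e2, dotProduct, dotProduct, Finset.mul_sum]
    refine Finset.sum_le_sum fun i _ => ?_
    rw [Matrix.mulVec_diagonal]
    have : (κ o)⁻¹ ≤ (κ i)⁻¹ := inv_anti₀ (hc.pos i) (ho i)
    nlinarith [mul_self_nonneg (v i)]
  · intro i
    filter_upwards [hΞ i] with t ⟨h1, h2, h3, O, hO, hA⟩
    refine ⟨h1, h2, h3, fun v => ⟨O.mulVec v, ?_, ?_⟩⟩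
    · rw [sum_sq_eq_dotProduct, dotProduct_orthogonal hO]
    · rw [sum_sum_eq_dotProduct, hA, dotProduct_conj]

/-- The height estimate at a maximum of `(s - u) e^{W / (2M)}`. -/
lemma height_estimate (hk : 1 ≤ k) (hkn : k ≤ n)
    (hD : IsOpen D) (hDb : ∀ ξ ∈ D, ‖ξ‖ < 1) (hf : ContDiffOn ℝ (⊤ : ℕ∞) f D)
    (hpos : ∀ ξ ∈ D, ∀ l ∈ eigenvals (dualMatrix f ξ), 0 < l)
    (heq : ∀ ξ ∈ D, F k (dualMatrix f ξ) = 1 / (n.choose k : ℝ) ^ (1 / (k : ℝ)))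
    {ξ₀ : E n} (hξ₀ : ξ₀ ∈ D) {s M : ℝ} (hs : height f ξ₀ < s) (hM : 1 / w ξ₀ ≤ M)
    (hmax : ∀ ξ ∈ D, (s - height f ξ) * Real.exp (1 / (2 * M) * (1 / w ξ)) ≤
      (s - height f ξ₀) * Real.exp (1 / (2 * M) * (1 / w ξ₀))) :
    s - height f ξ₀ ≤ 4 * n * M := by
  obtain ⟨κ, T, q, β, A, A2, U, W, o, Ξ, hc, ho, hes, h1, hSE, -, hΞ⟩ :=
    exists_chart_of_solution hk hkn hD hDb hf hpos heq hξ₀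
  obtain ⟨m, rfl⟩ : ∃ m, k = m + 1 := ⟨k - 1, by omega⟩
  have h := hc.height_bound (m := m) (by simpa using hkn) ho (by rw [hes]; exact hSE) hs hM (by
    intro i
    filter_upwards [hΞ i] with t ⟨h1, h2, h3, _⟩
    rw [h2, h3]
    exact hmax _ h1)
  rw [Fintype.card_fin] at h
  nlinarith

/-- The curvature estimate at a maximum of `(s - u) e^{n W} / λ`, with `λ` the least eigenvalue of the
dual matrix. -/
lemma curvature_estimate (hk : 1 ≤ k) (hkn : k ≤ n)
    (hD : IsOpen D) (hDb : ∀ ξ ∈ D, ‖ξ‖ < 1) (hf : ContDiffOn ℝ (⊤ : ℕ∞) f D)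
    (hpos : ∀ ξ ∈ D, ∀ l ∈ eigenvals (dualMatrix f ξ), 0 < l)
    (heq : ∀ ξ ∈ D, F k (dualMatrix f ξ) = 1 / (n.choose k : ℝ) ^ (1 / (k : ℝ)))
    {ξ₀ : E n} (hξ₀ : ξ₀ ∈ D) {s M H m : ℝ} (hs : height f ξ₀ < s) (hM : 1 / w ξ₀ ≤ M)
    (hH : s - height f ξ₀ ≤ H) (hm0 : 0 ≤ m) {z₀ : Fin n → ℝ} (hz₀ : z₀ ≠ 0)
    (hm : m * (z₀ ⬝ᵥ (dualMatrix f ξ₀).mulVec z₀) ≤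
      (s - height f ξ₀) * Real.exp (n * (1 / w ξ₀)) * (z₀ ⬝ᵥ z₀))
    (hmax : ∀ ξ ∈ D, ∀ z : Fin n → ℝ, (s - height f ξ) * Real.exp (n * (1 / w ξ)) * (z ⬝ᵥ z) ≤
      m * (z ⬝ᵥ (dualMatrix f ξ).mulVec z)) :
    m ≤ Real.exp (n * M) * ((1 + n * (M + 2 * n * M ^ 2) + n * M ^ 2) +
      n.choose k * (4 * (n : ℝ) ^ 2) ^ (k - 1) * H) := by
  obtain ⟨κ, T, q, β, A, A2, U, W, o, Ξ, hc, ho, hes, h1, hSE, hz, hΞ⟩ :=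
    exists_chart_of_solution hk hkn hD hDb hf hpos heq hξ₀
  have hn : (1 : ℝ) ≤ n := by exact_mod_cast hk.trans hkn
  have hW1 : 1 ≤ 1 / w ξ₀ := hc.one_le
  have hM1 : 1 ≤ M := hW1.trans hM
  have hκo := hc.pos o
  have hs0 : 0 < s - height f ξ₀ := sub_pos.2 hs
  have hzz : 0 < z₀ ⬝ᵥ z₀ := by
    simpa using dotProduct_mulVec_pos (Matrix.PosDef.one (n := Fin n) (R := ℝ)) hz₀
  -- The quadratic form at `z₀` is at least `κ_o⁻¹ |z₀|²`. Thus `m` may be replaced by the value of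
  -- the test function in the eigendirection `e_o`, as the chart estimate requires.
  have hmκ : m ≤ (s - height f ξ₀) * Real.exp (n * (1 / w ξ₀)) * κ o := by
    have h2 := (mul_le_mul_of_nonneg_left (hz z₀) hm0).trans hm
    have h3 : (m * (κ o)⁻¹) * (z₀ ⬝ᵥ z₀) ≤
      ((s - height f ξ₀) * Real.exp (n * (1 / w ξ₀))) * (z₀ ⬝ᵥ z₀) := by linarith
    have h4 := le_of_mul_le_mul_right h3 hzz
    rwa [← div_eq_mul_inv, div_le_iff₀ hκo] at h4
  have hb0 : (0 : ℝ) ≤ n.choose k * (4 * (n : ℝ) ^ 2) ^ (k - 1) := by positivity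
  have hsmall : κ o ≤ n.choose k * (4 * (n : ℝ) ^ 2) ^ (k - 1) → (s - height f ξ₀) * κ o ≤
      (1 + n * (M + 2 * n * M ^ 2) + n * M ^ 2) +
        n.choose k * (4 * (n : ℝ) ^ 2) ^ (k - 1) * H := by
    intro h2
    have h3 : (s - height f ξ₀) * κ o ≤ H * (n.choose k * (4 * (n : ℝ) ^ 2) ^ (k - 1)) :=
      mul_le_mul hH h2 hκo.le (hs0.le.trans hH)
    have h4 : 0 ≤ 1 + n * (M + 2 * n * M ^ 2) + n * M ^ 2 := by positivity
    linarith
  have hkey : (s - height f ξ₀) * κ o ≤ (1 + n * (M + 2 * n * M ^ 2) + n * M ^ 2) +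
      n.choose k * (4 * (n : ℝ) ^ 2) ^ (k - 1) * H := by
    -- For `k = 1` the equation `∑ κ_i = n` already bounds every curvature. For `k ≥ 2`, if the
    -- largeness condition fails then `κ_o ≤ κ_o^k` gives a bound, since `κ_o ≥ 1`.
    obtain rfl | ⟨j, rfl⟩ : k = 1 ∨ ∃ j, k = j + 2 := by
      rcases Nat.lt_or_ge k 2 with h | h
      · left; omega
      · right; exact ⟨k - 2, by omega⟩
    · refine hsmall ?_
      rw [es_one] at hes
      rw [Nat.sub_self, pow_zero, mul_one, ← hes]
      exact Finset.single_le_sum (f := κ) (fun i _ => (hc.pos i).le) (Finset.mem_univ o)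
    · by_cases hl : es Finset.univ κ (j + 2) * (4 * (Fintype.card (Fin n) : ℝ) ^ 2) ^ (j + 1) ≤
          κ o ^ (j + 2)
      · have h := hc.curvature_bound (by simpa using hkn) ho hl (by rw [hes]; exact hSE) hs hM (by
          intro i
          filter_upwards [hΞ i] with t ⟨h1, h2, h3, h4⟩ v
          obtain ⟨z, hz1, hz2⟩ := h4 v
          rw [hz1, hz2, h2, h3, Fintype.card_fin]
          refine (hmax _ h1 z).trans (mul_le_mul_of_nonneg_right hmκ ?_)
          exact dotProduct_mulVec_nonneg
            (posDef_of_eigenvals (dualMatrix_isHermitian hD hf h1) (hpos _ h1)) z)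
        rw [Fintype.card_fin] at h
        have : 0 ≤ (n.choose (j + 2) : ℝ) * (4 * (n : ℝ) ^ 2) ^ (j + 2 - 1) * H :=
          mul_nonneg hb0 (hs0.le.trans hH)
        linarith
      · refine hsmall ?_
        push Not at hl
        rw [hes, Fintype.card_fin] at hl
        have h2 : κ o ≤ κ o ^ (j + 2) := le_self_pow₀ h1 (by omega)
        exact h2.trans hl.le
  calc m ≤ Real.exp (n * (1 / w ξ₀)) * ((s - height f ξ₀) * κ o) := by linarith
    _ ≤ Real.exp (n * M) * ((s - height f ξ₀) * κ o) := by
        gcongr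
    _ ≤ _ := by gcongr

end Maxima

end SigmaK

namespace SigmaK

variable {n : ℕ}

/-! ### The estimate on the dual side -/

section DualEstimate

variable {D : Set (E n)} {f : E n → ℝ}

lemma continuousOn_fderiv (hD : IsOpen D) (hf : ContDiffOn ℝ (⊤ : ℕ∞) f D) :
    ContinuousOn (fderiv ℝ f) D :=
  (hf.fderiv_of_isOpen hD (m := (⊤ : ℕ∞)) (by simp)).continuousOn

lemma continuousOn_height (hD : IsOpen D) (hf : ContDiffOn ℝ (⊤ : ℕ∞) f D) :
    ContinuousOn (height f) D :=
  ((continuousOn_fderiv hD hf).clm_apply continuousOn_id).sub hf.continuousOn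

lemma continuous_w : Continuous (w : E n → ℝ) := by
  unfold w
  fun_prop

lemma continuousOn_gammaStar : Continuous (gammaStar : E n → _) := by
  refine continuous_matrix fun i j => ?_
  simp only [gammaStar, Matrix.of_apply]
  have h : ∀ ξ : E n, 1 + w ξ ≠ 0 := fun ξ => by
    have : 0 ≤ w ξ := Real.sqrt_nonneg _
    positivity
  have hc := continuous_w (n := n)
  exact continuous_const.sub (Continuous.div (by fun_prop) (by fun_prop) h)

lemma continuousOn_dualMatrix (hD : IsOpen D) (hf : ContDiffOn ℝ (⊤ : ℕ∞) f D) :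
    ContinuousOn (dualMatrix f) D := by
  have h1 : ContinuousOn (hessian f) D := by
    refine continuousOn_pi.2 fun i => continuousOn_pi.2 fun j => ?_
    have h2 : ContinuousOn (dd (EuclideanSpace.single i (1 : ℝ))
        (dd (EuclideanSpace.single j (1 : ℝ)) f)) D :=
      (contDiffOn_dd hD (contDiffOn_dd hD hf _) _).continuousOn
    exact h2.congr fun ξ hξ => (dd_dd hD hf _ _ hξ).symm
  have h2 : ContinuousOn (gammaStar : E n → _) D := continuousOn_gammaStar.continuousOn
  have h3 : ContinuousOn (w : E n → ℝ) D := continuous_w.continuousOn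
  exact h3.smul ((h2.mul h1).mul h2)

/-- The bound for `s - u` in the estimates. -/
def heightConst (n : ℕ) (M : ℝ) : ℝ := 4 * n * M * Real.exp (1 / 2)

/-- The constant in the curvature estimate. -/
def curvatureConst (n k : ℕ) (M : ℝ) : ℝ :=
  Real.exp (n * M) * ((1 + n * (M + 2 * n * M ^ 2) + n * M ^ 2) +
    n.choose k * (4 * (n : ℝ) ^ 2) ^ (k - 1) * heightConst n M)

variable {k : ℕ}

lemma one_le_inv_w {ξ : E n} (h : ‖ξ‖ < 1) : 1 ≤ 1 / w ξ := by
  rw [le_div_iff₀ (w_pos h), one_mul]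
  have := w_sq h
  nlinarith [w_pos h, sq_nonneg ‖ξ‖]

/-- A maximum over the compact set `{u ≤ s}` is a maximum over all of `D`, since the test function
is nonpositive elsewhere. The exponential lies between `1` and `e^{1/2}` where `u < s`, so the bound
at the maximum passes to every such point. -/
lemma sub_height_le (hk : 1 ≤ k) (hkn : k ≤ n)
    (hD : IsOpen D) (hDb : ∀ ξ ∈ D, ‖ξ‖ < 1) (hf : ContDiffOn ℝ (⊤ : ℕ∞) f D)
    (hpos : ∀ ξ ∈ D, ∀ l ∈ eigenvals (dualMatrix f ξ), 0 < l)
    (heq : ∀ ξ ∈ D, F k (dualMatrix f ξ) = 1 / (n.choose k : ℝ) ^ (1 / (k : ℝ)))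
    {s M : ℝ} (hK : IsCompact {ξ | ξ ∈ D ∧ height f ξ ≤ s})
    (hM : ∀ ξ ∈ D, height f ξ < s → 1 / w ξ ≤ M) {ξ₁ : E n} (hξ₁ : ξ₁ ∈ D)
    (hs : height f ξ₁ < s) : s - height f ξ₁ ≤ heightConst n M := by
  set K := {ξ | ξ ∈ D ∧ height f ξ ≤ s} with hKd
  have hM1 : 1 ≤ M := (one_le_inv_w (hDb _ hξ₁)).trans (hM _ hξ₁ hs)
  set g : E n → ℝ := fun ξ => (s - height f ξ) * Real.exp (1 / (2 * M) * (1 / w ξ)) with hg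
  have hc : ContinuousOn g D := by
    have h1 := continuousOn_height hD hf
    have h2 : ContinuousOn (fun ξ : E n => 1 / w ξ) D :=
      continuousOn_const.div continuous_w.continuousOn fun ξ hξ => (w_pos (hDb _ hξ)).ne'
    exact (continuousOn_const.sub h1).mul (Real.continuous_exp.comp_continuousOn
      (continuousOn_const.mul h2))
  obtain ⟨ξ₀, ⟨hξ₀, h0s⟩, hmax⟩ := hK.exists_isMaxOn ⟨ξ₁, hξ₁, hs.le⟩
    (hc.mono fun ξ hξ => hξ.1)
  have h1 : g ξ₁ ≤ g ξ₀ := hmax (show ξ₁ ∈ K from ⟨hξ₁, hs.le⟩)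
  have hg1 : 0 < g ξ₁ := mul_pos (sub_pos.2 hs) (Real.exp_pos _)
  have hs0 : height f ξ₀ < s := by
    have := hg1.trans_le h1
    simp only [hg] at this
    exact sub_pos.1 (pos_of_mul_pos_left this (Real.exp_pos _).le)
  have h2 := height_estimate hk hkn hD hDb hf hpos heq hξ₀ hs0 (hM _ hξ₀ hs0) (by
    intro ξ hξ
    rcases le_or_gt (height f ξ) s with h | h
    · exact hmax (show ξ ∈ K from ⟨hξ, h⟩)
    · have h3 : (s - height f ξ) * Real.exp (1 / (2 * M) * (1 / w ξ)) ≤ 0 :=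
        mul_nonpos_of_nonpos_of_nonneg (by linarith) (Real.exp_pos _).le
      exact h3.trans (mul_nonneg (by linarith) (Real.exp_pos _).le))
  have h3 : s - height f ξ₁ ≤ g ξ₁ := by
    have hw := w_pos (hDb _ hξ₁)
    have : 1 ≤ Real.exp (1 / (2 * M) * (1 / w ξ₁)) := Real.one_le_exp (by positivity)
    simp only [hg]
    nlinarith
  have h4 : g ξ₀ ≤ heightConst n M := by
    simp only [hg, heightConst]
    have h5 : 1 / (2 * M) * (1 / w ξ₀) ≤ 1 / 2 := by
      have := hM _ hξ₀ hs0
      calc 1 / (2 * M) * (1 / w ξ₀) ≤ 1 / (2 * M) * M := by gcongr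
        _ = 1 / 2 := by field_simp
    gcongr
  exact h3.trans (h1.trans h4)

/-- The quotient by the quadratic form is maximized over the compact product of `{u ≤ s}` and the
unit sphere; homogeneity in `z` then gives the inequality for all vectors, with the maximum as
constant, and `curvature_estimate` bounds that maximum. -/
theorem sub_height_mul_le (hk : 1 ≤ k) (hkn : k ≤ n)
    (hD : IsOpen D) (hDb : ∀ ξ ∈ D, ‖ξ‖ < 1) (hf : ContDiffOn ℝ (⊤ : ℕ∞) f D)
    (hpos : ∀ ξ ∈ D, ∀ l ∈ eigenvals (dualMatrix f ξ), 0 < l)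
    (heq : ∀ ξ ∈ D, F k (dualMatrix f ξ) = 1 / (n.choose k : ℝ) ^ (1 / (k : ℝ)))
    {s M : ℝ} (hK : IsCompact {ξ | ξ ∈ D ∧ height f ξ ≤ s})
    (hM : ∀ ξ ∈ D, height f ξ < s → 1 / w ξ ≤ M) {ξ₁ : E n} (hξ₁ : ξ₁ ∈ D)
    (hs : height f ξ₁ < s) (z₁ : Fin n → ℝ) :
    (s - height f ξ₁) * (z₁ ⬝ᵥ z₁) ≤ curvatureConst n k M * (z₁ ⬝ᵥ (dualMatrix f ξ₁).mulVec z₁) := by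
  set K := {ξ | ξ ∈ D ∧ height f ξ ≤ s} with hKd
  have hPD : ∀ ξ ∈ D, (dualMatrix f ξ).PosDef := fun ξ hξ =>
    posDef_of_eigenvals (dualMatrix_isHermitian hD hf hξ) (hpos _ hξ)
  have hn : NeZero n := ⟨by omega⟩
  set G : E n × E n → ℝ := fun p => (s - height f p.1) * Real.exp (n * (1 / w p.1)) /
    (WithLp.ofLp p.2 ⬝ᵥ (dualMatrix f p.1).mulVec (WithLp.ofLp p.2)) with hG
  have hself : ∀ z : E n, WithLp.ofLp z ⬝ᵥ WithLp.ofLp z = ‖z‖ ^ 2 := by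
    intro z
    rw [EuclideanSpace.real_norm_sq_eq]
    simp [dotProduct, sq]
  have hden : ∀ p ∈ K ×ˢ Metric.sphere (0 : E n) 1,
      0 < WithLp.ofLp p.2 ⬝ᵥ (dualMatrix f p.1).mulVec (WithLp.ofLp p.2) := by
    rintro ⟨ξ, z⟩ ⟨h1, h2⟩
    refine dotProduct_mulVec_pos (hPD _ h1.1) fun h => ?_
    have h3 := hself z
    rw [h, mem_sphere_zero_iff_norm.1 h2] at h3
    simp at h3
  have hc : ContinuousOn G (K ×ˢ Metric.sphere (0 : E n) 1) := by
    have hfst : Set.MapsTo (Prod.fst : E n × E n → E n) (K ×ˢ Metric.sphere (0 : E n) 1) D :=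
      fun p hp => hp.1.1
    have h1 := (continuousOn_height hD hf).comp continuousOn_fst hfst
    have h2 : ContinuousOn (fun ξ : E n => 1 / w ξ) D :=
      continuousOn_const.div continuous_w.continuousOn fun ξ hξ => (w_pos (hDb _ hξ)).ne'
    have h2 := h2.comp continuousOn_fst hfst
    have h3 := (continuousOn_dualMatrix hD hf).comp continuousOn_fst hfst
    refine ContinuousOn.div ((continuousOn_const.sub h1).mul
      (Real.continuous_exp.comp_continuousOn (continuousOn_const.mul h2))) ?_
      fun p hp => (hden p hp).ne'
    simp only [← sum_sum_eq_dotProduct]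
    refine continuousOn_finsetSum _ fun a _ => continuousOn_finsetSum _ fun b _ => ?_
    refine ContinuousOn.mul (continuousOn_pi.1 (continuousOn_pi.1 h3 a) b) ?_
    exact Continuous.continuousOn (by fun_prop)
  obtain ⟨e, he⟩ : ∃ e : E n, ‖e‖ = 1 := ⟨EuclideanSpace.single 0 1, by simp⟩
  obtain ⟨⟨ξ₀, z₀⟩, hmem, hmax⟩ := (hK.prod (isCompact_sphere (0 : E n) 1)).exists_isMaxOn
    ⟨(ξ₁, e), ⟨hξ₁, hs.le⟩, by simpa using he⟩ hc
  obtain ⟨⟨hξ₀, h0s⟩, hz₀⟩ := hmem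
  have hmax : ∀ ξ ∈ K, ∀ z : E n, ‖z‖ = 1 → G (ξ, z) ≤ G (ξ₀, z₀) := fun ξ hξ z hz =>
    hmax (show (ξ, z) ∈ K ×ˢ Metric.sphere (0 : E n) 1 from ⟨hξ, by simpa using hz⟩)
  have hm0 : 0 < G (ξ₀, z₀) := lt_of_lt_of_le (div_pos (mul_pos (sub_pos.2 hs) (Real.exp_pos _))
    (hden (ξ₁, e) ⟨⟨hξ₁, hs.le⟩, by simpa using he⟩)) (hmax ξ₁ ⟨hξ₁, hs.le⟩ e he)
  have hden0 := hden (ξ₀, z₀) ⟨⟨hξ₀, h0s⟩, hz₀⟩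
  have hs0 : height f ξ₀ < s := by
    have h2 : 0 < (s - height f ξ₀) * Real.exp (n * (1 / w ξ₀)) := by
      have := mul_pos hm0 hden0
      simp only [hG] at this hden0
      rwa [div_mul_cancel₀ _ hden0.ne'] at this
    exact sub_pos.1 (pos_of_mul_pos_left h2 (Real.exp_pos _).le)
  have hglob : ∀ ξ ∈ D, ∀ z : Fin n → ℝ, (s - height f ξ) * Real.exp (n * (1 / w ξ)) * (z ⬝ᵥ z) ≤
      G (ξ₀, z₀) * (z ⬝ᵥ (dualMatrix f ξ).mulVec z) := by
    intro ξ hξ z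
    rcases le_or_gt (height f ξ) s with h | h
    · rcases eq_or_ne z 0 with rfl | hz
      · simp
      set y : E n := WithLp.toLp 2 z with hy
      have hy0 : y ≠ 0 := by
        intro h
        exact hz (by simpa [hy] using h)
      have hyn : 0 < ‖y‖ := norm_pos_iff.2 hy0
      have h1 := hmax ξ ⟨hξ, h⟩ (‖y‖⁻¹ • y) (by
        rw [norm_smul, norm_inv, norm_norm, inv_mul_cancel₀ hyn.ne'])
      have h2 := hself y
      simp only [hG, WithLp.ofLp_smul, Matrix.mulVec_smul, smul_dotProduct, dotProduct_smul,
        smul_eq_mul] at h1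
      have h3 := dotProduct_mulVec_pos (hPD _ hξ) hz
      have e1 : WithLp.ofLp y = z := rfl
      rw [e1] at h1 h2
      rw [h2]
      simp only [hG]
      rw [div_le_iff₀ (by positivity)] at h1
      calc _ = ‖y‖ ^ 2 * ((s - height f ξ) * Real.exp (n * (1 / w ξ))) := by ring
        _ ≤ ‖y‖ ^ 2 * _ := mul_le_mul_of_nonneg_left h1 (by positivity)
        _ = _ := by field_simp
    · have h3 : (s - height f ξ) * Real.exp (n * (1 / w ξ)) ≤ 0 :=
        mul_nonpos_of_nonpos_of_nonneg (by linarith) (Real.exp_pos _).le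
      have h4 : 0 ≤ z ⬝ᵥ z := by
        have := hself (WithLp.toLp 2 z)
        simp only at this
        rw [this]
        positivity
      exact (mul_nonpos_of_nonpos_of_nonneg h3 h4).trans
        (mul_nonneg hm0.le (dotProduct_mulVec_nonneg (hPD _ hξ) z))
  have hbound := curvature_estimate hk hkn hD hDb hf hpos heq hξ₀ hs0 (hM _ hξ₀ hs0)
    (sub_height_le hk hkn hD hDb hf hpos heq hK hM hξ₀ hs0) hm0.le (z₀ := WithLp.ofLp z₀)
    (by
      intro h
      have h3 := hself z₀
      rw [h, mem_sphere_zero_iff_norm.1 hz₀] at h3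
      simp at h3)
    (by
      rw [hself, mem_sphere_zero_iff_norm.1 hz₀, one_pow, mul_one]
      simp only [hG]
      rw [div_mul_cancel₀ _ hden0.ne']) hglob
  have h5 := hglob ξ₁ hξ₁ z₁
  have h6 : (s - height f ξ₁) * (z₁ ⬝ᵥ z₁) ≤
      (s - height f ξ₁) * Real.exp (n * (1 / w ξ₁)) * (z₁ ⬝ᵥ z₁) := by
    have hw := w_pos (hDb _ hξ₁)
    have h7 : 1 ≤ Real.exp (n * (1 / w ξ₁)) := Real.one_le_exp (by positivity)
    have h8 : 0 ≤ z₁ ⬝ᵥ z₁ := by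
      rw [← sum_sq_eq_dotProduct]; positivity
    have h9 := sub_pos.2 hs
    refine mul_le_mul_of_nonneg_right ?_ h8
    nlinarith
  exact h6.trans (h5.trans (mul_le_mul_of_nonneg_right hbound
    (dotProduct_mulVec_nonneg (hPD _ hξ₁) z₁)))

end DualEstimate

end SigmaK

namespace SigmaK

variable {n : ℕ}

/-! ### The Legendre transform -/

section Legendre

variable {D : Set (E n)} {f : E n → ℝ}

lemma inner_gradient (f : E n → ℝ) (ξ v : E n) : inner ℝ (gradient f ξ) v = fderiv ℝ f ξ v := by
  rw [gradient, InnerProductSpace.toDual_symm_apply]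

lemma hessian_pos {ξ : E n} (h : ‖ξ‖ < 1) (hPD : (dualMatrix f ξ).PosDef) {v : E n} (hv : v ≠ 0) :
    0 < fderiv ℝ (fderiv ℝ f) ξ v v := by
  have hw := w_pos h
  have e : (gammaUp ξ).transpose * dualMatrix f ξ * gammaUp ξ = w ξ • hessian f ξ := by
    rw [gammaUp_transpose, dualMatrix, Matrix.mul_smul, Matrix.smul_mul]
    congr 1
    calc gammaUp ξ * (gammaStar ξ * hessian f ξ * gammaStar ξ) * gammaUp ξ
        = (gammaUp ξ * gammaStar ξ) * hessian f ξ * (gammaStar ξ * gammaUp ξ) := by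
          simp only [Matrix.mul_assoc]
      _ = _ := by
          rw [gammaUp_mul_gammaStar h, gammaStar_mul_gammaUp h, Matrix.one_mul, Matrix.mul_one]
  have h1 := dotProduct_conj (dualMatrix f ξ) (gammaUp ξ) (WithLp.ofLp v)
  have h2 : (gammaUp ξ).mulVec (WithLp.ofLp v) ≠ 0 := by
    intro h2
    have h3 := congrArg (gammaStar ξ).mulVec h2
    rw [Matrix.mulVec_mulVec, gammaStar_mul_gammaUp h, Matrix.one_mulVec, Matrix.mulVec_zero] at h3
    exact hv (by ext j; simpa using congrFun h3 j)
  have h3 := dotProduct_mulVec_pos hPD h2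
  rw [← h1, e, Matrix.smul_mulVec, dotProduct_smul, smul_eq_mul] at h3
  rw [← hessian_form]
  have h4 : ∑ i, ∑ j, v i * hessian f ξ i j * v j =
      WithLp.ofLp v ⬝ᵥ (hessian f ξ).mulVec (WithLp.ofLp v) := by
    simp only [dotProduct, Matrix.mulVec, Finset.mul_sum, mul_assoc]
  rw [h4]
  exact pos_of_mul_pos_right h3 hw.le

/-- A function with positive definite Hessian lies strictly above its tangent planes. -/
lemma tangent_lt (hD : IsOpen D) (hconv : Convex ℝ D) (hf : ContDiffOn ℝ (⊤ : ℕ∞) f D)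
    (hpos : ∀ ξ ∈ D, ∀ v : E n, v ≠ 0 → 0 < fderiv ℝ (fderiv ℝ f) ξ v v)
    {ξ η : E n} (hξ : ξ ∈ D) (hη : η ∈ D) (hne : η ≠ ξ) :
    f ξ + fderiv ℝ f ξ (η - ξ) < f η := by
  set v := η - ξ with hv
  have hv0 : v ≠ 0 := sub_ne_zero.2 hne
  have hmem : ∀ t ∈ Set.Icc (0 : ℝ) 1, ξ + t • v ∈ D := fun t ht =>
    hconv.add_smul_sub_mem hξ hη ht
  have hline : ∀ t : ℝ, HasDerivAt (fun t : ℝ => ξ + t • v) v t := fun t => by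
    simpa using ((hasDerivAt_id t).smul_const v).const_add ξ
  have hd : ∀ (g : E n → ℝ), ContDiffOn ℝ (⊤ : ℕ∞) g D → ∀ t ∈ Set.Icc (0 : ℝ) 1,
      HasDerivAt (fun t : ℝ => g (ξ + t • v)) (dd v g (ξ + t • v)) t := fun g hg t ht =>
    (differentiableAt_of_mem hD hg (hmem t ht)).hasFDerivAt.comp_hasDerivAt t (hline t)
  obtain ⟨c, hc, hc'⟩ := exists_hasDerivAt_eq_slope (fun t : ℝ => f (ξ + t • v)) _ zero_lt_one
    (fun t ht => (hd f hf t ht).continuousAt.continuousWithinAt)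
    (fun t ht => hd f hf t (Set.Ioo_subset_Icc_self ht))
  have hsub : Set.Icc 0 c ⊆ Set.Icc (0 : ℝ) 1 := Set.Icc_subset_Icc_right hc.2.le
  have hs1 := contDiffOn_dd hD hf v
  obtain ⟨d, hd1, hd2⟩ := exists_hasDerivAt_eq_slope (fun t : ℝ => dd v f (ξ + t • v)) _ hc.1
    (fun t ht => (hd _ hs1 t (hsub ht)).continuousAt.continuousWithinAt)
    (fun t ht => hd _ hs1 t (hsub (Set.Ioo_subset_Icc_self ht)))
  have hdm := hmem d (hsub (Set.Ioo_subset_Icc_self hd1))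
  have h1 := hpos _ hdm v hv0
  rw [← dd_dd hD hf v v hdm, hd2] at h1
  have e : ξ + (1 : ℝ) • v = η := by rw [hv, one_smul]; abel
  simp only [e, zero_smul, add_zero, sub_zero, div_one] at h1 hc'
  rw [hc', div_pos_iff_of_pos_right hc.1] at h1
  have : dd v f ξ = fderiv ℝ f ξ v := rfl
  linarith

lemma tangent_le (hD : IsOpen D) (hconv : Convex ℝ D) (hf : ContDiffOn ℝ (⊤ : ℕ∞) f D)
    (hpos : ∀ ξ ∈ D, ∀ v : E n, v ≠ 0 → 0 < fderiv ℝ (fderiv ℝ f) ξ v v)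
    {ξ η : E n} (hξ : ξ ∈ D) (hη : η ∈ D) : f ξ + fderiv ℝ f ξ (η - ξ) ≤ f η := by
  rcases eq_or_ne η ξ with rfl | h
  · simp
  · exact (tangent_lt hD hconv hf hpos hξ hη h).le

lemma legendre_gradient (hD : IsOpen D) (hconv : Convex ℝ D) (hf : ContDiffOn ℝ (⊤ : ℕ∞) f D)
    (hpos : ∀ ξ ∈ D, ∀ v : E n, v ≠ 0 → 0 < fderiv ℝ (fderiv ℝ f) ξ v v) {ξ : E n} (hξ : ξ ∈ D) :
    legendre D f (gradient f ξ) = height f ξ := by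
  refine IsGreatest.csSup_eq ⟨⟨ξ, hξ, ?_⟩, ?_⟩
  · simp only [inner_gradient, height]
  · rintro _ ⟨η, hη, rfl⟩
    have := tangent_le hD hconv hf hpos hξ hη
    rw [map_sub] at this
    simp only [inner_gradient, height]
    linarith

/-- The gradient map is a local diffeomorphism, with derivative given by the Hessian. -/
lemma exists_hasStrictFDerivAt_gradient (hD : IsOpen D) (hf : ContDiffOn ℝ (⊤ : ℕ∞) f D)
    (hpos : ∀ ξ ∈ D, ∀ v : E n, v ≠ 0 → 0 < fderiv ℝ (fderiv ℝ f) ξ v v) {ξ : E n} (hξ : ξ ∈ D) :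
    ∃ G : E n ≃L[ℝ] E n, HasStrictFDerivAt (gradient f) (G : E n →L[ℝ] E n) ξ ∧
      ∀ v v', inner ℝ (G v) v' = fderiv ℝ (fderiv ℝ f) ξ v v' := by
  have h1 : ContDiffAt ℝ (⊤ : ℕ∞) (fderiv ℝ f) ξ :=
    (hf.fderiv_of_isOpen hD (m := (⊤ : ℕ∞)) (by simp)).contDiffAt (hD.mem_nhds hξ)
  have h2 := h1.hasStrictFDerivAt (by simp)
  set L : (E n →L[ℝ] ℝ) →L[ℝ] E n :=
    { toFun := (InnerProductSpace.toDual ℝ (E n)).symm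
      map_add' := map_add _
      map_smul' := fun c l => by simp
      cont := (InnerProductSpace.toDual ℝ (E n)).symm.continuous } with hL
  set G' : E n →L[ℝ] E n := L.comp (fderiv ℝ (fderiv ℝ f) ξ) with hG'
  have h3 : ∀ v v', inner ℝ (G' v) v' = fderiv ℝ (fderiv ℝ f) ξ v v' := fun v v' =>
    InnerProductSpace.toDual_symm_apply
  have hinj : Function.Injective G'.toLinearMap := by
    refine (injective_iff_map_eq_zero _).2 fun v hv => ?_
    by_contra hv0
    have h4 := hpos _ hξ v hv0
    rw [← h3] at h4
    have : G' v = 0 := hv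
    rw [this, inner_zero_left] at h4
    exact h4.false
  refine ⟨(LinearEquiv.ofInjectiveEndo G'.toLinearMap hinj).toContinuousLinearEquiv, ?_, ?_⟩
  · have h4 : HasStrictFDerivAt (gradient f) G' ξ := L.hasStrictFDerivAt.comp ξ h2
    convert h4 using 1
    ext v
    rfl
  · exact h3

lemma isOpen_gradImage (hD : IsOpen D) (hf : ContDiffOn ℝ (⊤ : ℕ∞) f D)
    (hpos : ∀ ξ ∈ D, ∀ v : E n, v ≠ 0 → 0 < fderiv ℝ (fderiv ℝ f) ξ v v) :
    IsOpen (gradImage D f) := by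
  refine isOpen_iff_mem_nhds.2 ?_
  rintro _ ⟨ξ, hξ, rfl⟩
  obtain ⟨G, hG, -⟩ := exists_hasStrictFDerivAt_gradient hD hf hpos hξ
  rw [← hG.map_nhds_eq_of_equiv]
  exact image_mem_map (hD.mem_nhds hξ)

/-- A local inverse of the gradient map. -/
lemma exists_localInverse (hD : IsOpen D) (hf : ContDiffOn ℝ (⊤ : ℕ∞) f D)
    (hpos : ∀ ξ ∈ D, ∀ v : E n, v ≠ 0 → 0 < fderiv ℝ (fderiv ℝ f) ξ v v) {ξ : E n} (hξ : ξ ∈ D) :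
    ∃ (G : E n ≃L[ℝ] E n) (g : E n → E n),
      (∀ v v', inner ℝ (G v) v' = fderiv ℝ (fderiv ℝ f) ξ v v') ∧ g (gradient f ξ) = ξ ∧
      HasFDerivAt g (G.symm : E n →L[ℝ] E n) (gradient f ξ) ∧
      ∀ᶠ x in 𝓝 (gradient f ξ), g x ∈ D ∧ gradient f (g x) = x := by
  obtain ⟨G, hG, hG'⟩ := exists_hasStrictFDerivAt_gradient hD hf hpos hξ
  have h1 := hG.to_localInverse.hasFDerivAt
  have h2 : hG.localInverse (gradient f) G ξ (gradient f ξ) = ξ := hG.localInverse_apply_image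
  refine ⟨G, hG.localInverse (gradient f) G ξ, hG', h2, h1, ?_⟩
  have h3 := h1.continuousAt.eventually_mem (s := D) (by rw [h2]; exact hD.mem_nhds hξ)
  filter_upwards [h3, hG.eventually_right_inverse] with x hx hx'
  exact ⟨hx, hx'⟩

/-- Near the point the transform is `x · g(x) - f(g(x))`, with `g` a local inverse of the gradient
map; the derivative of `g` drops out because `Df(g(x)) = x`. -/
lemma hasFDerivAt_legendre (hD : IsOpen D) (hconv : Convex ℝ D) (hf : ContDiffOn ℝ (⊤ : ℕ∞) f D)
    (hpos : ∀ ξ ∈ D, ∀ v : E n, v ≠ 0 → 0 < fderiv ℝ (fderiv ℝ f) ξ v v) {ξ : E n} (hξ : ξ ∈ D) :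
    HasFDerivAt (legendre D f) (innerSL ℝ ξ) (gradient f ξ) := by
  obtain ⟨G, g, -, hgx, hg, hev⟩ := exists_localInverse hD hf hpos hξ
  have h1 : HasFDerivAt f (fderiv ℝ f ξ) (g (gradient f ξ)) := by
    rw [hgx]; exact (differentiableAt_of_mem hD hf hξ).hasFDerivAt
  have h2 := ((hasFDerivAt_id (𝕜 := ℝ) (gradient f ξ)).inner ℝ hg).sub (h1.comp _ hg)
  refine (h2.congr_of_eventuallyEq ?_).congr_fderiv ?_
  · filter_upwards [hev] with x ⟨hx, hx'⟩
    conv_lhs => rw [← hx']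
    rw [legendre_gradient hD hconv hf hpos hx, height, ← inner_gradient, hx']
    rfl
  · ext v
    simp [hgx, real_inner_comm]

lemma gradient_legendre (hD : IsOpen D) (hconv : Convex ℝ D) (hf : ContDiffOn ℝ (⊤ : ℕ∞) f D)
    (hpos : ∀ ξ ∈ D, ∀ v : E n, v ≠ 0 → 0 < fderiv ℝ (fderiv ℝ f) ξ v v) {ξ : E n} (hξ : ξ ∈ D) :
    gradient (legendre D f) (gradient f ξ) = ξ := by
  rw [gradient, (hasFDerivAt_legendre hD hconv hf hpos hξ).fderiv]
  exact (InnerProductSpace.toDual ℝ (E n)).symm_apply_apply ξ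

lemma hessian_mul_hessian_legendre (hD : IsOpen D) (hconv : Convex ℝ D)
    (hf : ContDiffOn ℝ (⊤ : ℕ∞) f D)
    (hpos : ∀ ξ ∈ D, ∀ v : E n, v ≠ 0 → 0 < fderiv ℝ (fderiv ℝ f) ξ v v) {ξ : E n} (hξ : ξ ∈ D) :
    hessian f ξ * hessian (legendre D f) (gradient f ξ) = 1 := by
  obtain ⟨G, g, hG, hgx, hg, hev⟩ := exists_localInverse hD hf hpos hξ
  have h1 : fderiv ℝ (legendre D f) =ᶠ[𝓝 (gradient f ξ)] fun x => innerSL ℝ (g x) := by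
    filter_upwards [hev] with x ⟨hx, hx'⟩
    conv_lhs => rw [← hx']
    exact (hasFDerivAt_legendre hD hconv hf hpos hx).fderiv
  have h2 := ((innerSL ℝ (E := E n)).hasFDerivAt.comp _ hg).congr_of_eventuallyEq h1
  have e1 : ∀ i j, hessian f ξ i j = G (EuclideanSpace.single i 1) j := by
    intro i j
    rw [hessian, Matrix.of_apply, ← hG]
    simp [EuclideanSpace.inner_single_right]
  have e2 : ∀ i j, hessian (legendre D f) (gradient f ξ) i j =
      G.symm (EuclideanSpace.single i 1) j := by
    intro i j
    rw [hessian, Matrix.of_apply, h2.fderiv, ContinuousLinearMap.comp_apply, innerSL_apply_apply]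
    simp [EuclideanSpace.inner_single_right]
  ext i l
  rw [Matrix.mul_apply]
  simp only [e1, e2]
  have h3 : G.symm (G (EuclideanSpace.single i 1)) l = (EuclideanSpace.single i (1 : ℝ) : E n) l := by
    rw [G.symm_apply_apply]
  rw [eq_sum_single (G (EuclideanSpace.single i 1))] at h3
  simp only [map_sum, map_smul] at h3
  simpa [Finset.sum_apply, Matrix.one_apply, Pi.single_apply, eq_comm] using h3

lemma dualMatrix_mul_curvatureMatrix (hD : IsOpen D) (hconv : Convex ℝ D)
    (hDb : ∀ ξ ∈ D, ‖ξ‖ < 1) (hf : ContDiffOn ℝ (⊤ : ℕ∞) f D)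
    (hpos : ∀ ξ ∈ D, ∀ v : E n, v ≠ 0 → 0 < fderiv ℝ (fderiv ℝ f) ξ v v) {ξ : E n} (hξ : ξ ∈ D) :
    dualMatrix f ξ * curvatureMatrix (legendre D f) (gradient f ξ) = 1 := by
  have h := hDb _ hξ
  rw [curvatureMatrix, gradient_legendre hD hconv hf hpos hξ, dualMatrix, Matrix.smul_mul,
    Matrix.mul_smul, smul_smul, mul_inv_cancel₀ (w_pos h).ne', one_smul]
  set H := hessian (legendre D f) (gradient f ξ)
  calc gammaStar ξ * hessian f ξ * gammaStar ξ * (gammaUp ξ * H * gammaUp ξ)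
      = gammaStar ξ * hessian f ξ * (gammaStar ξ * gammaUp ξ) * H * gammaUp ξ := by
        simp only [Matrix.mul_assoc]
    _ = gammaStar ξ * (hessian f ξ * H) * gammaUp ξ := by
        rw [gammaStar_mul_gammaUp h, Matrix.mul_one]
        simp only [Matrix.mul_assoc]
    _ = 1 := by
        rw [hessian_mul_hessian_legendre hD hconv hf hpos hξ, Matrix.mul_one,
          gammaStar_mul_gammaUp h]

/-- The eigenvalues of the inverse of a positive definite matrix. -/
lemma exists_vector_of_mem_eigenvals_inv {A B : Matrix (Fin n) (Fin n) ℝ} (hA : A.PosDef)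
    (hAB : A * B = 1) {l : ℝ} (hl : l ∈ eigenvals B) :
    0 < l ∧ ∃ z : Fin n → ℝ, z ⬝ᵥ z = 1 ∧ z ⬝ᵥ A.mulVec z = l⁻¹ := by
  have hB : B = A⁻¹ := (Matrix.inv_eq_right_inv hAB).symm
  have hBp : B.PosDef := hB ▸ hA.inv
  have hBh := hBp.isHermitian
  rw [eigenvals_eq hBh] at hl
  obtain ⟨i, -, rfl⟩ := Multiset.mem_map.1 hl
  have hp : 0 < hBh.eigenvalues i := hBh.posDef_iff_eigenvalues_pos.1 hBp i
  set v := hBh.eigenvectorBasis i with hv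
  have h1 : WithLp.ofLp v ⬝ᵥ WithLp.ofLp v = 1 := by
    have h2 : ‖v‖ ^ 2 = 1 := by rw [hv, hBh.eigenvectorBasis.norm_eq_one, one_pow]
    rw [EuclideanSpace.real_norm_sq_eq] at h2
    rw [← h2]
    simp [dotProduct, sq]
  refine ⟨hp, WithLp.ofLp v, h1, ?_⟩
  have h3 := hBh.mulVec_eigenvectorBasis i
  rw [← hv] at h3
  have h4 := congrArg A.mulVec h3
  rw [Matrix.mulVec_mulVec, hAB, Matrix.one_mulVec, Matrix.mulVec_smul] at h4
  have h5 : A.mulVec (WithLp.ofLp v) = (hBh.eigenvalues i)⁻¹ • WithLp.ofLp v := by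
    rw [eq_inv_smul_iff₀ hp.ne']
    exact h4.symm
  rw [h5, dotProduct_smul, h1, smul_eq_mul, mul_one]

/-- The part of the domain in which the height is at most `s` is compact. -/
lemma isCompact_height_le (hD : IsAdmissibleDomain D) (hf : ContDiffOn ℝ (⊤ : ℕ∞) f (closure D))
    (hpos : ∀ ξ ∈ D, ∀ v : E n, v ≠ 0 → 0 < fderiv ℝ (fderiv ℝ f) ξ v v) {s : ℝ}
    (hs : ∀ x ∈ frontier (gradImage D f), s < legendre D f x) :
    IsCompact {ξ | ξ ∈ D ∧ height f ξ ≤ s} := by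
  have hfD := hf.mono (subset_closure (s := D))
  have hu : UniqueDiffOn ℝ (closure D) := uniqueDiffOn_convex hD.convex.closure
    ((hD.nonempty.mono (interior_maximal subset_closure hD.isOpen)))
  set P := fderivWithin ℝ f (closure D) with hP
  have hPc : ContinuousOn P (closure D) := hf.continuousOn_fderivWithin hu (by simp)
  have hPD : ∀ ξ ∈ D, P ξ = fderiv ℝ f ξ := fun ξ hξ =>
    fderivWithin_of_mem_nhds (mem_of_superset (hD.isOpen.mem_nhds hξ) subset_closure)
  have hfc := hf.continuousOn
  -- Smoothness up to the boundary carries the supporting plane inequality to the closure.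
  have htan : ∀ ξ ∈ closure D, ∀ η ∈ closure D, f ξ + P ξ (η - ξ) ≤ f η := by
    intro ξ hξ η hη
    have hcl : closure (D ×ˢ D) = closure D ×ˢ closure D := closure_prod_eq
    have hm1 : Set.MapsTo (Prod.fst : E n × E n → E n) (closure (D ×ˢ D)) (closure D) := by
      rw [hcl]; exact fun p hp => hp.1
    have hm2 : Set.MapsTo (Prod.snd : E n × E n → E n) (closure (D ×ˢ D)) (closure D) := by
      rw [hcl]; exact fun p hp => hp.2
    have hmem : (ξ, η) ∈ closure (D ×ˢ D) := by rw [hcl]; exact ⟨hξ, hη⟩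
    refine le_on_closure (s := D ×ˢ D) (f := fun p : E n × E n => f p.1 + P p.1 (p.2 - p.1))
      (g := fun p => f p.2) ?_ ?_ (hfc.comp continuousOn_snd hm2) hmem
    · rintro ⟨a, b⟩ ⟨ha, hb⟩
      simp only [hPD a ha]
      exact tangent_le hD.isOpen hD.convex hfD hpos ha hb
    · exact (hfc.comp continuousOn_fst hm1).add ((hPc.comp continuousOn_fst hm1).clm_apply
        (continuousOn_snd.sub continuousOn_fst))
  have hbdd : IsCompact (closure D) :=
    Metric.isCompact_of_isClosed_isBounded isClosed_closure
      (Metric.isBounded_ball.subset hD.closure_subset)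
  have hset : {ξ | ξ ∈ D ∧ height f ξ ≤ s} = closure D ∩ (fun ξ => P ξ ξ - f ξ) ⁻¹' Set.Iic s := by
    ext ξ
    constructor
    · rintro ⟨h1, h2⟩
      refine ⟨subset_closure h1, ?_⟩
      rw [Set.mem_preimage, hPD ξ h1]
      exact h2
    · rintro ⟨h1, h2⟩
      -- Only boundary points of `D` could spoil closedness. At such a point the limiting gradient
      -- `x` lies in the closure of the gradient image and has `u(x) ≤ s`; as `u > s` on the
      -- frontier, `x` is the gradient at some interior `ξ'`. Strict convexity at the midpoint of
      -- `ξ` and `ξ'` then excludes equal gradients.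
      suffices h : ξ ∈ D by
        refine ⟨h, ?_⟩
        rw [Set.mem_preimage, hPD ξ h] at h2
        exact h2
      by_contra hξ
      set x := (InnerProductSpace.toDual ℝ (E n)).symm (P ξ) with hx
      have hxi : ∀ v, inner ℝ x v = P ξ v := fun v => InnerProductSpace.toDual_symm_apply
      have hxs : legendre D f x ≤ s := by
        refine csSup_le (hD.nonempty.image _) ?_
        rintro _ ⟨η, hη, rfl⟩
        have h3 := htan ξ h1 η (subset_closure hη)
        rw [map_sub] at h3
        have h4 : P ξ ξ - f ξ ≤ s := h2
        simp only [hxi]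
        linarith
      have hxc : x ∈ closure (gradImage D f) := by
        have h3 : ContinuousOn (fun ξ => (InnerProductSpace.toDual ℝ (E n)).symm (P ξ)) (closure D) :=
          (InnerProductSpace.toDual ℝ (E n)).symm.continuous.comp_continuousOn hPc
        have h4 := h3.image_closure ⟨ξ, h1, rfl⟩
        have h5 : (fun ξ => (InnerProductSpace.toDual ℝ (E n)).symm (P ξ)) '' D = gradImage D f := by
          refine Set.image_congr fun η hη => ?_
          rw [hPD η hη, gradient]
        rwa [h5] at h4
      have hxΩ : x ∈ gradImage D f := by
        by_contra hxΩ
        have h3 : x ∈ frontier (gradImage D f) := by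
          rw [frontier, (isOpen_gradImage hD.isOpen hfD hpos).interior_eq]
          exact ⟨hxc, hxΩ⟩
        exact (hs x h3).not_ge hxs
      obtain ⟨ξ', hξ', hx'⟩ := hxΩ
      have hPP : P ξ = P ξ' := by
        rw [hPD ξ' hξ']
        ext v
        rw [← hxi, ← hx', inner_gradient]
      have hne : ξ ≠ ξ' := fun h => hξ (h ▸ hξ')
      set η := (1 / 2 : ℝ) • ξ + (1 / 2 : ℝ) • ξ' with hη
      have hηD : η ∈ D := by
        have h3 := hD.convex.combo_closure_interior_mem_interior h1
          (by rwa [hD.isOpen.interior_eq]) (by norm_num : (0 : ℝ) ≤ 1 / 2)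
          (by norm_num : (0 : ℝ) < 1 / 2) (by norm_num)
        exact interior_subset h3
      have hd1 : η - ξ' = (1 / 2 : ℝ) • (ξ - ξ') := by rw [hη]; module
      have hd2 : ξ - η = (1 / 2 : ℝ) • (ξ - ξ') := by rw [hη]; module
      have hd3 : ξ' - η = -(1 / 2 : ℝ) • (ξ - ξ') := by rw [hη]; module
      have hηne : η ≠ ξ' := by
        intro h
        rw [h, sub_self] at hd1
        exact (smul_ne_zero (by norm_num) (sub_ne_zero.2 hne)) hd1.symm
      have t1 := tangent_lt hD.isOpen hD.convex hfD hpos hξ' hηD hηne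
      have t2 := htan η (subset_closure hηD) ξ h1
      have t3 := htan η (subset_closure hηD) ξ' (subset_closure hξ')
      have t4 := htan ξ h1 ξ' (subset_closure hξ')
      have hd4 : ξ' - ξ = -(ξ - ξ') := by abel
      rw [← hPD ξ' hξ', hd1, map_smul, smul_eq_mul] at t1
      rw [hd2, map_smul, smul_eq_mul] at t2
      rw [hd3, map_smul, smul_eq_mul] at t3
      rw [hd4, map_neg, hPP] at t4
      linarith
  rw [hset]
  have hcl := ((hPc.clm_apply continuousOn_id).sub hfc).preimage_isClosed_of_isClosed
    isClosed_closure (isClosed_Iic (a := s))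
  exact hbdd.of_isClosed_subset hcl Set.inter_subset_left

end Legendre

end SigmaK

end

/-! ### From the dual estimate to the graph -/

theorem lemma6p8 (n k : ℕ) (hk : 1 ≤ k) (hkn : k ≤ n) (M : ℝ) :
    ∃ C : ℝ, ∀ (D : ℕ → Set (SigmaK.E n)) (φ ustar : ℕ → SigmaK.E n → ℝ),
      (∀ J, SigmaK.IsAdmissibleDomain (D J)) →
      (∀ J, SigmaK.IsDirichletSolution k (D J) (φ J) (ustar J)) →
      ∀ s : ℝ, 1 < s → ∀ Js : ℕ,
      -- `u^J > s` on `∂Ω_J` for `J > J_s`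
      (∀ J, Js < J → ∀ x ∈ frontier (SigmaK.gradImage (D J) (ustar J)),
        s < SigmaK.legendre (D J) (ustar J) x) →
      -- `M` is a bound for `(1 - |Du^J|²)^{-1/2}` where `u^J < s`
      (∀ J, Js < J → ∀ x ∈ SigmaK.gradImage (D J) (ustar J),
        SigmaK.legendre (D J) (ustar J) x < s →
        1 / √(1 - ‖gradient (SigmaK.legendre (D J) (ustar J)) x‖ ^ 2) ≤ M) →
      ∀ J, Js < J → ∀ x ∈ SigmaK.gradImage (D J) (ustar J),
        (s - SigmaK.legendre (D J) (ustar J) x) *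
          SigmaK.kappaMax (SigmaK.legendre (D J) (ustar J)) x ≤ C := by
  -- The `0` covers points with `u ≥ s`, where the product is nonpositive, and arbitrary real `M`,
  -- for which `curvatureConst` need not be nonnegative.
  refine ⟨max 0 (SigmaK.curvatureConst n k M), ?_⟩
  intro D φ ustar hD hsol s _ Js hfr hM J hJ
  have hDJ := hD J
  have hsm := (hsol J).smooth
  have hpe := (hsol J).positive
  have heq := (hsol J).equation
  have hfr := hfr J hJ
  have hM := hM J hJ
  generalize D J = D at *
  generalize ustar J = f at *
  have hDb : ∀ ξ ∈ D, ‖ξ‖ < 1 := fun ξ hξ => by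
    simpa using hDJ.closure_subset (subset_closure hξ)
  have hf := hsm.mono (subset_closure (s := D))
  have hPD : ∀ ξ ∈ D, (SigmaK.dualMatrix f ξ).PosDef := fun ξ hξ =>
    SigmaK.posDef_of_eigenvals (SigmaK.dualMatrix_isHermitian hDJ.isOpen hf hξ) (hpe _ hξ)
  have hpos : ∀ ξ ∈ D, ∀ v : SigmaK.E n, v ≠ 0 → 0 < fderiv ℝ (fderiv ℝ f) ξ v v :=
    fun ξ hξ v hv => SigmaK.hessian_pos (hDb _ hξ) (hPD _ hξ) hv
  have hleg := fun ξ hξ => SigmaK.legendre_gradient hDJ.isOpen hDJ.convex hf hpos (ξ := ξ) hξ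
  have hMD : ∀ ξ ∈ D, SigmaK.height f ξ < s → 1 / SigmaK.w ξ ≤ M := by
    intro ξ hξ h
    have h1 := hM _ ⟨ξ, hξ, rfl⟩ (by rwa [hleg _ hξ])
    rwa [SigmaK.gradient_legendre hDJ.isOpen hDJ.convex hf hpos hξ] at h1
  have hcomp := SigmaK.isCompact_height_le hDJ hsm hpos hfr
  rintro _ ⟨ξ, hξ, rfl⟩
  have hev : ∀ l ∈ SigmaK.eigenvals
      (SigmaK.curvatureMatrix (SigmaK.legendre D f) (gradient f ξ)), 0 < l ∧
      ∃ z : Fin n → ℝ, z ⬝ᵥ z = 1 ∧ z ⬝ᵥ (SigmaK.dualMatrix f ξ).mulVec z = l⁻¹ := fun l hl =>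
    SigmaK.exists_vector_of_mem_eigenvals_inv (hPD _ hξ)
      (SigmaK.dualMatrix_mul_curvatureMatrix hDJ.isOpen hDJ.convex hDb hf hpos hξ) hl
  have hk0 : 0 ≤ SigmaK.kappaMax (SigmaK.legendre D f) (gradient f ξ) :=
    Real.sSup_nonneg fun l hl => (hev l hl).1.le
  rw [hleg _ hξ]
  rcases le_or_gt s (SigmaK.height f ξ) with h | h
  · exact (mul_nonpos_of_nonpos_of_nonneg (by linarith) hk0).trans (le_max_left _ _)
  · have hs := sub_pos.2 h
    rw [mul_comm, ← le_div_iff₀ hs]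
    refine Real.sSup_le (fun l hl => ?_) (div_nonneg (le_max_left _ _) hs.le)
    obtain ⟨hl0, z, hz1, hz2⟩ := hev l hl
    have h1 := SigmaK.sub_height_mul_le hk hkn hDJ.isOpen hDb hf hpe heq hcomp hMD hξ h z
    rw [hz1, hz2, mul_one, ← div_eq_mul_inv, le_div_iff₀ hl0] at h1
    rw [le_div_iff₀ hs, mul_comm]
    exact h1.trans (le_max_right _ _)
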